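/- Let $\varepsilon=-1$ (Case I) or $\varepsilon=1$ (Case II), and let $\mathbb B_\infty=\mathbb R\oplus\mathbb R\zeta\oplus\mathbb R\xi\oplus\mathbb R\zeta\xi$ be the real quaternion algebra with $\zeta^2=\varepsilon$, $\xi^2=-1$, $\zeta\xi=-\xi\zeta$ (Hamilton's quaternions in Case I, $\cong M_2(\mathbb R)$ in Case II). For a matrix $X$ over $\mathbb B_\infty$ or over $\mathbb B_\infty\otimes_{\mathbb R}\mathbb C$ let $X^*$ be the transpose of its entrywise main involution (extended $\mathbb C$-linearly), and let $\det$ be the reduced norm. For $m\ge 0$ let $$\mathcal H_m=\{Z=X+iY:\ X,Y\in M_m(\mathbb B_\infty),\ X^*=-\varepsilon X,\ Y^*=-\varepsilon Y,\ Y>0\},$$ where $Y>0$ means that $Y$ is a positive definite quaternionic hermitian matrix in Case I, and that the real symmetric matrix $\mathfrak i(Y)\,\mathrm{diag}[J_1,\dots,J_1]$ is positive definite in Case II; here $\mathfrak i:M_m(\mathbb B_\infty)\cong M_{2m}(\mathbb R)$ sends each entry $a+b\zeta+c\xi+d\zeta\xi$ to $\begin{pmatrix}a+b&c+d\\-c+d&a-b\end{pmatrix}$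 and $J_1=\begin{pmatrix}0&-1\\1&0\end{pmatrix}$. It is an open subset of the complex vector space $\{Z\in M_m(\mathbb B_\infty\otimes\mathbb C):Z^*=-\varepsilon Z\}$. Let $$G_m(\mathbb R)=\Big\{g\in \mathrm{SL}_{2m}(\mathbb B_\infty):\ g\begin{pmatrix}0&\varepsilon\\1_m&0\end{pmatrix}g^*=\begin{pmatrix}0&\varepsilon\\1_m&0\end{pmatrix}\Big\},$$ acting on $\mathcal H_m$ by $gZ=(aZ+b)(cZ+d)^{-1}$ for $g=\begin{pmatrix}a&b\\c&d\end{pmatrix}$, and for $\kappa\in\mathbb Z$ put $(f|_\kappa g)(Z)=\det(cZ+d)^{-\kappa}f(gZ)$. Let $n\ge 0$. Write $Z=\begin{pmatrix}z_1&z_2\\z_3&z_4\end{pmatrix}\in\mathcal H_{2n}$ with $n\times n$ blocks, put $(f|V)\begin{pmatrix}z_1&z_2\\z_3&z_4\end{pmatrix}=f\begin{pmatrix}z_4&z_3\\z_2&z_1\end{pmatrix}$, and for $\gamma_i=\begin{pmatrix}a_i&b_i\\c_i&d_i\end{pmatrix}\in G_n(\mathbb R)$ let $\gamma_1\times\gamma_2\in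 G_{2n}(\mathbb R)$ be the element with blocks $\mathrm{diag}[a_1,a_2],\mathrm{diag}[b_1,b_2],\mathrm{diag}[c_1,c_2],\mathrm{diag}[d_1,d_2]$. Then, in both cases, there is a family $(\mathfrak D_\alpha)_{\alpha\in\mathbb C}$ of holomorphic linear differential operators of finite order on $\mathcal H_{2n}$, with coefficients that are polynomials in $\alpha$ and in the coordinates of $z_2$, such that for every integer $\kappa>2n$, every holomorphic $f:\mathcal H_{2n}\to\mathbb C$ and every $\gamma\in G_n(\mathbb R)$ $$\mathfrak D_\kappa(f|V)=(\mathfrak D_\kappa f)|V,$$ $$\mathfrak D_\kappa(f|_\kappa(1\times\gamma))=(\mathfrak D_\kappa f)|_{\kappa+1}(1\times\gamma),\qquad \mathfrak D_\kappa(f|_\kappa(\gamma\times1))=(\mathfrak D_\kappa f)|_{\kappa+1}(\gamma\times1).$$ Moreover the operators are non-trivial: for every integer $\kappa>2n$ there is a constant $a_\kappa\ne0$ with $\mathfrak D_\kappa(\det z_2)=a_\kappa$ on $\mathcal H_{2n}$. -/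

import Mathlib

open scoped Quaternion Matrix ComplexOrder

noncomputable section

namespace QuaternionicUpperHalfSpace

/-- Case I: `𝔹` is definite. Case II: `𝔹` is indefinite. -/
inductive QCase
  | I
  | II

/-- The sign `ε`: it is `-1` in Case I and `1` in Case II. -/
def QCase.eps : QCase → ℤ
  | .I => -1
  | .II => 1

/-- The real quaternion algebra `𝔹_∞ = 𝔹 ⊗ ℝ = ℝ ⊕ ℝζ ⊕ ℝξ ⊕ ℝζξ` with `ζ² = ε`, `ξ² = -1`,
`ζξ = -ξζ`: the Hamilton quaternions in Case I, the split algebra `≅ M₂(ℝ)` in Case II.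
`star` is the main involution. -/
abbrev BR (c : QCase) : Type := ℍ[ℝ, (c.eps : ℝ), 0, -1]

/-- The complexification `𝔹_∞ ⊗_ℝ ℂ`; `star` is the `ℂ`-linear extension of the main
involution, i.e. `(x + iy)^* = x^* + i y^*`. -/
abbrev BC (c : QCase) : Type := ℍ[ℂ, (c.eps : ℂ), 0, -1]

/-- The inclusion `𝔹_∞ → 𝔹_∞ ⊗ ℂ`. -/
def toBC {c : QCase} (x : BR c) : BC c := ⟨x.re, x.imI, x.imJ, x.imK⟩

/-- The `y` in `z = x + iy`, with `x, y ∈ 𝔹_∞`. -/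
def imPart {c : QCase} (z : BC c) : BR c := ⟨z.re.im, z.imI.im, z.imJ.im, z.imK.im⟩

/-- A complex square root of `ε`. -/
def QCase.rootEps : QCase → ℂ
  | .I => Complex.I
  | .II => 1

/-- The isomorphism `𝔹_∞ ⊗ ℂ ≅ M₂(ℂ)` with `ζ ↦ diag(√ε, -√ε)`, `ξ ↦ [0, 1; -1, 0]`. On `𝔹_∞`
it turns the main involution into the conjugate transpose in Case I, and it is real-valued
in Case II. -/
def splitEntry {c : QCase} (x : BC c) : Matrix (Fin 2) (Fin 2) ℂ :=
  !![x.re + c.rootEps * x.imI, x.imJ + c.rootEps * x.imK;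
     -x.imJ + c.rootEps * x.imK, x.re - c.rootEps * x.imI]

section
variable {c : QCase} {ι : Type} [Fintype ι] [DecidableEq ι]

/-- The isomorphism `M_m(𝔹_∞ ⊗ ℂ) ≅ M_{2m}(ℂ)`, entry by entry. -/
def split (X : Matrix ι ι (BC c)) : Matrix (ι × Fin 2) (ι × Fin 2) ℂ :=
  Matrix.of fun p q => splitEntry (X p.1 q.1) p.2 q.2

/-- The determinant of a quaternionic matrix, meaning its reduced norm. -/
def nrd (X : Matrix ι ι (BC c)) : ℂ := (split X).det

/-- `diag[J₁, …, J₁]` with `J₁ = [0, -1; 1, 0]`. -/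
def Jdiag (ι : Type) [DecidableEq ι] : Matrix (ι × Fin 2) (ι × Fin 2) ℂ :=
  Matrix.of fun p q => if p.1 = q.1 then (!![0, -1; 1, 0] : Matrix (Fin 2) (Fin 2) ℂ) p.2 q.2 else 0

/-- `S(ℝ) ⊗ ℂ = {X : X^* = -εX}`. -/
def hermC (c : QCase) (ι : Type) : Set (Matrix ι ι (BC c)) :=
  {X | Xᴴ = -((c.eps : ℂ) • X)}

/-- Positive definiteness of `y ∈ S(ℝ)`: in Case I, `y` is a positive definite quaternionic
hermitian matrix; in Case II, the real symmetric matrix `𝔦(y) J'` is positive definite. -/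
def IsPosDef : {c : QCase} → Matrix ι ι (BR c) → Prop
  | .I, y => (split (y.map toBC)).PosDef
  | .II, y => (split (y.map toBC) * Jdiag ι).PosDef

/-- The upper half space `ℋ`, of degree the cardinality of `ι`. -/
def upperHalf (c : QCase) (ι : Type) [Fintype ι] [DecidableEq ι] : Set (Matrix ι ι (BC c)) :=
  {Z | Z ∈ hermC c ι ∧ IsPosDef (Z.map imPart)}

/-- The form `[0, ε; 1, 0]`, that is `J_n` in Case I and `I_n` in Case II. -/
def formK (c : QCase) (ι : Type) [DecidableEq ι] : Matrix (ι ⊕ ι) (ι ⊕ ι) (BR c) :=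
  Matrix.fromBlocks 0 ((c.eps : ℝ) • (1 : Matrix ι ι (BR c))) 1 0

/-- The group `G(ℝ)` of degree the cardinality of `ι`. -/
def groupG (c : QCase) (ι : Type) [Fintype ι] [DecidableEq ι] :
    Set (Matrix (ι ⊕ ι) (ι ⊕ ι) (BR c)) :=
  {g | nrd (g.map toBC) = 1 ∧ g * formK c ι * gᴴ = formK c ι}

/-- `μ(g, Z) = cZ + d`. -/
def muFactor (g : Matrix (ι ⊕ ι) (ι ⊕ ι) (BR c)) (Z : Matrix ι ι (BC c)) : Matrix ι ι (BC c) :=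
  g.toBlocks₂₁.map toBC * Z + g.toBlocks₂₂.map toBC

/-- `gZ = (aZ + b)(cZ + d)⁻¹`. -/
def act (g : Matrix (ι ⊕ ι) (ι ⊕ ι) (BR c)) (Z : Matrix ι ι (BC c)) : Matrix ι ι (BC c) :=
  (g.toBlocks₁₁.map toBC * Z + g.toBlocks₁₂.map toBC) * Ring.inverse (muFactor g Z)

/-- The weight `κ` slash action of `G(ℝ)`: `(f|_κ g)(Z) = j(g, Z)^{-κ} f(gZ)`, where
`j(g, Z) = det(cZ + d)`. -/
def slash (κ : ℤ) (f : Matrix ι ι (BC c) → ℂ) (g : Matrix (ι ⊕ ι) (ι ⊕ ι) (BR c)) :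
    Matrix ι ι (BC c) → ℂ :=
  fun Z => nrd (muFactor g Z) ^ (-κ) * f (act g Z)

/-- The doubling embedding `(g₁, g₂) ↦ g₁ × g₂`. -/
def double (g₁ g₂ : Matrix (ι ⊕ ι) (ι ⊕ ι) (BR c)) :
    Matrix ((ι ⊕ ι) ⊕ (ι ⊕ ι)) ((ι ⊕ ι) ⊕ (ι ⊕ ι)) (BR c) :=
  Matrix.fromBlocks
    (Matrix.fromBlocks g₁.toBlocks₁₁ 0 0 g₂.toBlocks₁₁)
    (Matrix.fromBlocks g₁.toBlocks₁₂ 0 0 g₂.toBlocks₁₂)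
    (Matrix.fromBlocks g₁.toBlocks₂₁ 0 0 g₂.toBlocks₂₁)
    (Matrix.fromBlocks g₁.toBlocks₂₂ 0 0 g₂.toBlocks₂₂)

/-- `(f|V)([z₁, z₂; z₃, z₄]) = f([z₄, z₃; z₂, z₁])`. -/
def swapV (f : Matrix (ι ⊕ ι) (ι ⊕ ι) (BC c) → ℂ) : Matrix (ι ⊕ ι) (ι ⊕ ι) (BC c) → ℂ :=
  fun Z => f (Matrix.fromBlocks Z.toBlocks₂₂ Z.toBlocks₂₁ Z.toBlocks₁₂ Z.toBlocks₁₁)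

/-- `f` is holomorphic on `ℋ`, an open subset of the complex vector space `S(ℝ) ⊗ ℂ`: around
each point of `ℋ` it is complex analytic in any linear coordinates. Only the values of `f`
on `ℋ` matter. -/
def IsHolo (f : Matrix ι ι (BC c) → ℂ) : Prop :=
  ∀ Z ∈ upperHalf c ι, ∀ (d : ℕ) (v : Fin d → Matrix ι ι (BC c)), (∀ k, v k ∈ hermC c ι) →
    AnalyticAt ℂ (fun t : Fin d → ℂ => f (Z + ∑ k, t k • v k)) 0

/-- The four complex coordinates (with respect to `1, ζ, ξ, ζξ`) of an entry of a matrix. -/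
def coord (X : Matrix ι ι (BC c)) (p : ι × ι × Fin 4) : ℂ :=
  ![(X p.1 p.2.1).re, (X p.1 p.2.1).imI, (X p.1 p.2.1).imJ, (X p.1 p.2.1).imK] p.2.2

/-- The iterated directional derivative `∂_{v₁} ⋯ ∂_{v_k} f`. -/
def iterDeriv (l : List (hermC c ι)) (f : Matrix ι ι (BC c) → ℂ) : Matrix ι ι (BC c) → ℂ :=
  l.foldr (fun v g => fun Z => lineDeriv ℂ g Z (v : Matrix ι ι (BC c))) f

end

/-- A family, indexed by `α ∈ ℂ`, of holomorphic linear differential operators on `ℋ_{2m}`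
(`m` the cardinality of `ι`): a finite sum of terms `P(α, z₂) ∂_{v₁} ⋯ ∂_{v_k}`, where `P` is a
polynomial in `α` and the coordinates of the block `z₂`, and `v₁, …, v_k` are holomorphic
tangent directions of `ℋ_{2m}`. -/
structure DiffOpFamily (c : QCase) (ι : Type) where
  /-- number of terms -/
  len : ℕ
  /-- coefficient of each term -/
  coeff : Fin len → MvPolynomial (ι × ι × Fin 4) (Polynomial ℂ)
  /-- directions of differentiation of each term -/
  dirs : Fin len → List (hermC c (ι ⊕ ι))

/-- The operator `𝔇_α` of the family, applied to a function. -/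
def DiffOpFamily.op {c : QCase} {ι : Type} (D : DiffOpFamily c ι) (α : ℂ)
    (f : Matrix (ι ⊕ ι) (ι ⊕ ι) (BC c) → ℂ) : Matrix (ι ⊕ ι) (ι ⊕ ι) (BC c) → ℂ :=
  fun Z => ∑ k, (D.coeff k).eval₂ (Polynomial.evalRingHom α) (coord Z.toBlocks₁₂) *
    iterDeriv (D.dirs k) f Z

end QuaternionicUpperHalfSpace

end

/-!
The operators are found in linear coordinates. Composing `Z ↦ split Z` with multiplication by
`diag[J₁, …, J₁]` identifies `S(ℝ) ⊗ ℂ` with the space of complex matrices `S` of even size `2N`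
with `Sᵀ = ε S`; then `nrd Z = det S`, and `nrd z₂` is the determinant of the block `S₁₂`.

**Construction.** The derivatives of the test functions `det(S + R)^{-α}` are
`∂_μ det(S + R)^{-α} = g_μ(α, (S + R)⁻¹) det(S + R)^{-α}` with explicit polynomials `g_μ`
(`derivPoly`, `wordDeriv_detPow`). Let `Φ(α)` be the square matrix of the coefficients of the `g_μ`
with `|μ| ≤ 2N` (`symbolMatrix`). Inverting it by the adjugate gives, for every polynomial `P` of
degree at most `2N`, an operator with coefficients polynomial in `α` that multiplies
`det(S + R)^{-α}` by `det Φ(α) P(U)`, `U = (S + R)⁻¹`. Take `P(U) = det(R₁₂) det U`; this is a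
polynomial in `U` and `S₁₂` alone (`det_pencil_inv`). The resulting operator has
`𝔇_α det(S + R)^{-α} = det Φ(α) det(R₁₂) det(S + R)^{-α-1}` (`coreOp_detPow`).

**Nondegeneracy.** For an integer `κ ≥ N` one has `det Φ(κ) ≠ 0`. Let `x, y` be `κ`-tuples of
vectors and `⟨·, ·⟩` the Fischer pairing of polynomials in their entries. The Gaussian identity
`⟨exp(yᵀ V x), exp(yᵀ Uᵀ x)⟩ = det(1 - V U)^{-κ}` shows that `g_μ(κ, ·)` is, up to sign, the
transform `U ↦ ⟨p_μ, exp(yᵀ Uᵀ x)⟩` of a product `p_μ` of the quadratic forms `yᵀ bₖ x` of a basis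
`bₖ` (`transform_quadWord`). Positivity of the pairing makes the transform injective
(`eq_zero_of_transform_eq_zero`), and for `κ ≥ N` the quadratic forms are algebraically independent
(`eq_zero_of_aeval_quadY`).

**Covariance.** Let `Λ` be the difference of the two sides of a covariance relation at a point, a
linear functional on germs depending on finitely many derivatives. By nondegeneracy the jets of the
functions `det(S - S₀ + X)^{-κ}`, for small invertible `X`, span all jets (`eq_zero_of_detPow`), so
`Λ = 0` can be checked on test functions (`coreOp_comp`). The identity
`(gZ + R)(cZ + d) = (a + Rc)(Z + R')`, `R' = (a + Rc)⁻¹(b + Rd)`, shows that `g` permutes the test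
functions up to factors, and the relation reduces to `nrd R'₁₂ · nrd(a + Rc) = nrd R₁₂`
(`diffOp_slash`). This is verified for `1 × γ`, `γ × 1` and for `diag[P, P]`, `P = [0, 1; 1, 0]`,
whose slash action is `V`.

**Nontriviality.** Covariance under homotheties makes `𝔇_κ(det S₁₂)` homogeneous of degree zero,
hence constant (`coreOp_det_eq`). Its value at the origin is a nonzero multiple of `⟨p, p⟩`, where
`p` is a polynomial, real up to a scalar, whose transform is proportional to `det S₁₂`
(`coreOp_det_ne_zero`).
-/

noncomputable section

namespace QuaternionicDiffOp

open MvPolynomial Filter Topology Asymptotics QuaternionicUpperHalfSpace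

/-! ### The Fischer pairing -/

section Fischer

variable {V : Type} [Fintype V]

/-- The Fischer (apolar) pairing `⟨p, q⟩ = ∑ μ! p_μ q_μ`, that is `p(∂) q` at the origin. -/
def pair : MvPolynomial V ℂ →ₗ[ℂ] MvPolynomial V ℂ →ₗ[ℂ] ℂ :=
  (basisMonomials V ℂ).constr ℂ fun μ => ((∏ i, ((μ i).factorial : ℂ)) • lcoeff ℂ μ)

theorem pair_monomial_left (μ : V →₀ ℕ) (a : ℂ) (q : MvPolynomial V ℂ) :
    pair (monomial μ a) q = a * ((∏ i, ((μ i).factorial : ℂ)) * coeff μ q) := by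
  have := (basisMonomials V ℂ).constr_basis ℂ
    (fun μ : V →₀ ℕ => ((∏ i, ((μ i).factorial : ℂ)) • lcoeff ℂ μ)) μ
  rw [coe_basisMonomials] at this
  have h : (monomial μ a : MvPolynomial V ℂ) = a • monomial μ 1 := by
    rw [smul_monomial, smul_eq_mul, mul_one]
  rw [h, map_smul, LinearMap.smul_apply, pair, this]
  simp [lcoeff]

theorem pair_one_left (q : MvPolynomial V ℂ) : pair 1 q = coeff 0 q := by
  have := pair_monomial_left 0 1 q
  simpa using this

/-- Multiplication by a variable is adjoint to the corresponding partial derivative. -/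
theorem pair_X_mul (i : V) (p q : MvPolynomial V ℂ) :
    pair (X i * p) q = pair p (pderiv i q) := by
  classical
  induction p using MvPolynomial.induction_on' with
  | add p q hp hq => simp [mul_add, hp, hq]
  | monomial μ a =>
    rw [X, monomial_mul, one_mul, pair_monomial_left, pair_monomial_left, coeff_pderiv,
      add_comm μ]
    have : ∏ j, (((Finsupp.single i 1 + μ : V →₀ ℕ) j).factorial : ℂ) =
        (μ i + 1) * ∏ j, ((μ j).factorial : ℂ) := by
      rw [← Finset.mul_prod_erase _ _ (Finset.mem_univ i),
        ← Finset.mul_prod_erase _ (fun j => ((μ j).factorial : ℂ)) (Finset.mem_univ i)]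
      have h : ∏ x ∈ Finset.univ.erase i, (((Finsupp.single i 1 + μ : V →₀ ℕ) x).factorial : ℂ) =
          ∏ x ∈ Finset.univ.erase i, ((μ x).factorial : ℂ) :=
        Finset.prod_congr rfl fun j hj => by
          simp [Finsupp.single_eq_of_ne (Finset.ne_of_mem_erase hj)]
      rw [h]
      simp [add_comm 1 (μ i), Nat.factorial_succ]
      ring
    rw [this]
    ring

/-- Conjugation of the coefficients of a polynomial. -/
abbrev conjP : MvPolynomial V ℂ →+* MvPolynomial V ℂ := MvPolynomial.map (starRingEnd ℂ)

theorem pair_conj (p q : MvPolynomial V ℂ) :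
    pair (conjP p) (conjP q) = starRingEnd ℂ (pair p q) := by
  induction p using MvPolynomial.induction_on' with
  | add p q hp hq => simp_all
  | monomial μ a =>
    simp [map_monomial, pair_monomial_left, coeff_map]

/-- The Fischer pairing is positive definite: `⟨p, p̄⟩ = ∑ μ! |p_μ|²`. -/
theorem eq_zero_of_pair_conj_eq_zero {p : MvPolynomial V ℂ} (h : pair p (conjP p) = 0) :
    p = 0 := by
  have key : ∀ p q : MvPolynomial V ℂ, pair p q =
      ∑ μ ∈ p.support, coeff μ p * ((∏ i, ((μ i).factorial : ℂ)) * coeff μ q) := by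
    intro p q
    conv_lhs => rw [p.as_sum]
    rw [map_sum, LinearMap.sum_apply]
    exact Finset.sum_congr rfl fun μ _ => pair_monomial_left _ _ _
  have h2 : pair p (conjP p) =
      ((∑ μ ∈ p.support, (∏ i, ((μ i).factorial : ℝ)) * ‖coeff μ p‖ ^ 2 : ℝ) : ℂ) := by
    rw [key]
    push_cast
    refine Finset.sum_congr rfl fun μ _ => ?_
    rw [coeff_map, ← Complex.mul_conj']
    ring
  rw [h2, Complex.ofReal_eq_zero, Finset.sum_eq_zero_iff_of_nonneg
    (fun μ _ => by positivity)] at h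
  by_contra hp
  obtain ⟨μ, hμ⟩ := support_nonempty.2 hp
  have h3 := h μ hμ
  have hpos : (0 : ℝ) < ∏ i, ((μ i).factorial : ℝ) :=
    Finset.prod_pos fun i _ => by exact_mod_cast Nat.factorial_pos _
  rw [mul_eq_zero] at h3
  rcases h3 with h3 | h3
  · exact hpos.ne' h3
  · simp at h3
    exact (mem_support_iff.1 hμ) h3

end Fischer

/-! ### Quadratic forms in Gaussian variables -/

section Quadratic

variable {K : Type} [Fintype K] {r : ℕ}

/-- The indeterminates: the entries of two `K × r` matrices `y` (`Sum.inl`) and `x` (`Sum.inr`). -/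
abbrev XY (K : Type) (r : ℕ) : Type := (K × Fin r) ⊕ (K × Fin r)

/-- The quadratic polynomial `∑ₐ yₐᵀ v xₐ` attached to a matrix `v`. -/
def quadY (r : ℕ) : Matrix K K ℂ →ₗ[ℂ] MvPolynomial (XY K r) ℂ where
  toFun v := ∑ i, ∑ j, ∑ a, v i j • (X (Sum.inl (i, a)) * X (Sum.inr (j, a)))
  map_add' u v := by simp [add_smul, Finset.sum_add_distrib]
  map_smul' c v := by simp [mul_smul, Finset.smul_sum]

theorem quadY_apply (v : Matrix K K ℂ) : quadY r v =
    ∑ i, ∑ j, ∑ a, v i j • (X (Sum.inl (i, a)) * X (Sum.inr (j, a))) := rfl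

/-- The second order operator `∑ₐ ∑ᵢⱼ vᵢⱼ ∂_{y_{ia}} ∂_{x_{ja}}`. -/
def lap (v : Matrix K K ℂ) : MvPolynomial (XY K r) ℂ →ₗ[ℂ] MvPolynomial (XY K r) ℂ :=
  ∑ i, ∑ j, ∑ a, v i j • ((pderiv (Sum.inr (j, a))).toLinearMap ∘ₗ
    (pderiv (Sum.inl (i, a))).toLinearMap)

theorem lap_apply (v : Matrix K K ℂ) (q : MvPolynomial (XY K r) ℂ) : lap v q =
    ∑ i, ∑ j, ∑ a, v i j • pderiv (Sum.inr (j, a)) (pderiv (Sum.inl (i, a)) q) := by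
  simp [lap, LinearMap.sum_apply]

theorem pair_quadY_mul (v : Matrix K K ℂ) (p q : MvPolynomial (XY K r) ℂ) :
    pair (quadY r v * p) q = pair p (lap v q) := by
  simp only [quadY_apply, lap_apply, Finset.sum_mul, map_sum, LinearMap.sum_apply, smul_mul_assoc,
    map_smul, LinearMap.smul_apply]
  refine Finset.sum_congr rfl fun i _ => Finset.sum_congr rfl fun j _ =>
    Finset.sum_congr rfl fun a _ => ?_
  rw [mul_assoc, pair_X_mul, mul_comm, mul_comm, pair_X_mul]

theorem conjP_quadY (v : Matrix K K ℂ) :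
    conjP (quadY r v) = quadY r (v.map (starRingEnd ℂ)) := by
  simp [quadY_apply, MvPolynomial.smul_eq_C_mul]

variable [DecidableEq K]

theorem pderiv_inl_quadY (v : Matrix K K ℂ) (i : K) (a : Fin r) :
    pderiv (Sum.inl (i, a)) (quadY r v) = ∑ j, v i j • X (Sum.inr (j, a)) := by
  simp only [quadY_apply, map_sum, Derivation.map_smul, pderiv_mul, pderiv_X, Pi.single_apply]
  simp [Prod.ext_iff, ite_and, ite_mul]

theorem pderiv_inr_quadY (v : Matrix K K ℂ) (j : K) (a : Fin r) :
    pderiv (Sum.inr (j, a)) (quadY r v) = ∑ i, v i j • X (Sum.inl (i, a)) := by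
  simp only [quadY_apply, map_sum, Derivation.map_smul, pderiv_mul, pderiv_X, Pi.single_apply]
  simp [Prod.ext_iff, ite_and]

/-- The computation behind the Laplace transform of a Gaussian: the operator `lap v` acts on
powers of the quadratic form of `Uᵀ` through a first order operator in `U`. -/
theorem lap_quadY_pow (v U : Matrix K K ℂ) (j : ℕ) :
    lap v (quadY r Uᵀ ^ (j + 1)) = ((j : ℂ) + 1) • (((r : ℂ) * (U * v).trace) • quadY r Uᵀ ^ j +
      (j : ℂ) • (quadY r Uᵀ ^ (j - 1) * quadY r (U * v * U)ᵀ)) := by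
  have h1 : ∀ i l a, pderiv (Sum.inr (l, a)) (pderiv (Sum.inl (i, a)) (quadY r Uᵀ ^ (j + 1))) =
      ((j : ℂ) + 1) • (U l i • quadY r Uᵀ ^ j + (j : ℂ) • (quadY r Uᵀ ^ (j - 1) *
        ((∑ k, U l k • X (Sum.inl (k, a))) * ∑ k, U k i • X (Sum.inr (k, a))))) := by
    intro i l a
    rw [pderiv_pow, pderiv_inl_quadY, mul_assoc, ← map_natCast (C (σ := XY K r) (R := ℂ)),
      pderiv_C_mul, pderiv_mul, pderiv_pow, pderiv_inr_quadY]
    have h2 : pderiv (Sum.inr (l, a)) (∑ k, Uᵀ i k • X (Sum.inr (k, a)) : MvPolynomial (XY K r) ℂ)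
        = C (U l i) := by
      simp only [map_sum, Derivation.map_smul, pderiv_X, Pi.single_apply]
      simp [Prod.ext_iff, smul_eq_C_mul]
    rw [h2]
    simp only [smul_eq_C_mul, Matrix.transpose_apply, Nat.add_sub_cancel, map_add, map_natCast,
      map_one, Nat.cast_add, Nat.cast_one]
    ring
  have h3 : (∑ i, ∑ l, ∑ a : Fin r, v i l • U l i • quadY r Uᵀ ^ j) =
      ((r : ℂ) * (U * v).trace) • quadY r Uᵀ ^ j := by
    simp only [Finset.sum_const, Finset.card_univ, Fintype.card_fin, Matrix.trace, Matrix.diag,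
      Matrix.mul_apply, smul_smul, ← Finset.sum_smul, ← Nat.cast_smul_eq_nsmul ℂ]
    rw [Finset.mul_sum, Finset.sum_comm]
    simp only [Finset.mul_sum]
    congr 1
    refine Finset.sum_congr rfl fun i _ => Finset.sum_congr rfl fun l _ => ?_
    ring
  have h4 : (∑ i, ∑ l, ∑ a : Fin r, v i l • ((∑ k, U l k • X (Sum.inl (k, a))) *
      ∑ k, U k i • X (Sum.inr (k, a)) : MvPolynomial (XY K r) ℂ)) = quadY r (U * v * U)ᵀ := by
    simp only [quadY_apply, Matrix.transpose_apply, Matrix.mul_apply, Finset.sum_mul,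
      Finset.mul_sum, Finset.smul_sum, Finset.sum_smul, smul_smul, smul_mul_smul_comm]
    have h5 : ∀ F : K → K → Fin r → K → K → MvPolynomial (XY K r) ℂ,
        ∑ i, ∑ l, ∑ a, ∑ k', ∑ k, F i l a k k' = ∑ k, ∑ k', ∑ a, ∑ l, ∑ i, F i l a k k' := by
      intro F
      simp only [← Fintype.sum_prod_type' (fun _ _ => _)]
      exact Fintype.sum_equiv ⟨fun p => (p.2.2.2.2, p.2.2.2.1, p.2.2.1, p.2.1, p.1),
        fun p => (p.2.2.2.2, p.2.2.2.1, p.2.2.1, p.2.1, p.1), fun _ => rfl, fun _ => rfl⟩ _ _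
        fun _ => rfl
    rw [h5]
    refine Finset.sum_congr rfl fun i _ => Finset.sum_congr rfl fun l _ =>
      Finset.sum_congr rfl fun a _ => Finset.sum_congr rfl fun k _ =>
      Finset.sum_congr rfl fun k' _ => ?_
    congr 1
    ring
  obtain ⟨z, hz⟩ : ∃ z : K → K → Fin r → MvPolynomial (XY K r) ℂ, ∀ i l a, z i l a =
      (∑ k, U l k • X (Sum.inl (k, a))) * ∑ k, U k i • X (Sum.inr (k, a)) :=
    ⟨_, fun _ _ _ => rfl⟩
  simp only [← hz] at h1 h4
  rw [lap_apply, ← h3, ← h4]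
  simp only [h1, Finset.smul_sum, Finset.mul_sum, ← Finset.sum_add_distrib]
  refine Finset.sum_congr rfl fun i _ => Finset.sum_congr rfl fun l _ =>
      Finset.sum_congr rfl fun a _ => ?_
  simp only [smul_eq_C_mul, map_add, map_natCast, map_one]
  ring

end Quadratic

/-! ### Symmetric and alternating matrices in coordinates -/

/-- Linear coordinates on the space of complex matrices with `Sᵀ = ε S`, together with an
extension `coords` of the inverse coordinate map to all matrices. -/
structure SymChart (ε : ℂ) (K : Type) (d : ℕ) where
  /-- the matrix with the given coordinates -/
  mat : (Fin d → ℂ) →ₗ[ℂ] Matrix K K ℂ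
  /-- the coordinates of a matrix -/
  coords : Matrix K K ℂ →ₗ[ℂ] (Fin d → ℂ)
  transpose_mat : ∀ t, (mat t)ᵀ = ε • mat t
  coords_mat : ∀ t, coords (mat t) = t
  mat_coords : ∀ M, Mᵀ = ε • M → mat (coords M) = M

namespace SymChart

variable {ε : ℂ} {K : Type} {d : ℕ} (c : SymChart ε K d)

/-- The basis of the space of `ε`-symmetric matrices given by the coordinates. -/
def basis (k : Fin d) : Matrix K K ℂ := c.mat (Pi.single k 1)

theorem mat_eq_sum (t : Fin d → ℂ) : c.mat t = ∑ k, t k • c.basis k := by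
  conv_lhs => rw [← Finset.univ_sum_single t]
  rw [map_sum]
  refine Finset.sum_congr rfl fun k _ => ?_
  rw [basis, ← map_smul, ← Pi.single_smul, smul_eq_mul, mul_one]

theorem mat_injective : Function.Injective c.mat :=
  Function.LeftInverse.injective c.coords_mat

end SymChart

/-- Evaluation of a polynomial over `ℂ[α]` at a parameter `κ` and a point `u`. -/
def ev {σ : Type} (κ : ℂ) (u : σ → ℂ) : MvPolynomial σ (Polynomial ℂ) →+* ℂ :=
  eval₂Hom (Polynomial.evalRingHom κ) u

section ev
variable {σ : Type} {κ : ℂ} {u : σ → ℂ}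

@[simp] theorem ev_X (i : σ) : ev κ u (X i) = u i := by simp [ev]
@[simp] theorem ev_C (a : Polynomial ℂ) : ev κ u (C a) = a.eval κ := by simp [ev]

theorem hasDerivAt_ev [Fintype σ] [DecidableEq σ] (p : MvPolynomial σ (Polynomial ℂ))
    {γ : ℂ → σ → ℂ} {γ' : σ → ℂ} {s₀ : ℂ} (hγ : ∀ j, HasDerivAt (fun s => γ s j) (γ' j) s₀) :
    HasDerivAt (fun s => ev κ (γ s) p) (∑ j, γ' j * ev κ (γ s₀) (pderiv j p)) s₀ := by
  induction p using MvPolynomial.induction_on with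
  | C a => simpa using hasDerivAt_const s₀ _
  | add p q hp hq =>
    simp only [map_add, mul_add, Finset.sum_add_distrib]
    exact hp.add hq
  | mul_X p i hp =>
    simp only [map_mul, ev_X, pderiv_mul]
    convert! hp.mul (hγ i) using 1
    simp only [pderiv_X, Pi.single_apply, map_add, map_mul, ev_X, mul_add, Finset.sum_add_distrib,
      Finset.sum_mul]
    congr 1
    · exact Finset.sum_congr rfl fun j _ => by ring
    · rw [Finset.sum_eq_single i]
      · simp; ring
      · intro j _ hj
        simp [hj.symm]
      · simp

end ev

/-- The directional derivative of a linear functional of a power. -/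
theorem hasDerivAt_linear_pow {A : Type*} [CommRing A] [Algebra ℂ A] (φ : A →ₗ[ℂ] ℂ) (a b : A)
    (j : ℕ) :
    HasDerivAt (fun s : ℂ => φ ((a + s • b) ^ j)) (j * φ (a ^ (j - 1) * b)) 0 := by
  have key : ∀ P : Polynomial A, HasDerivAt (fun s : ℂ => φ (P.eval (algebraMap ℂ A s)))
      (φ (P.derivative.eval 0)) 0 := by
    intro P
    induction P using Polynomial.induction_on' with
    | add p q hp hq =>
      simp only [Polynomial.eval_add, map_add]
      exact hp.add hq
    | monomial n x =>
      simp only [Polynomial.eval_monomial, Polynomial.derivative_monomial]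
      have h1 : ∀ s : ℂ, φ (x * algebraMap ℂ A s ^ n) = s ^ n * φ x := by
        intro s
        rw [← map_pow, mul_comm, ← Algebra.smul_def, map_smul, smul_eq_mul]
      simp only [h1]
      convert! (hasDerivAt_pow n (0 : ℂ)).mul_const (φ x) using 1
      rcases n with _ | _ | n <;> simp
  have := key ((Polynomial.C a + Polynomial.X * Polynomial.C b) ^ j)
  simp only [Polynomial.eval_pow, Polynomial.eval_add, Polynomial.eval_C, Polynomial.eval_mul,
    Polynomial.eval_X, Polynomial.derivative_pow, Polynomial.derivative_add,
    Polynomial.derivative_C, Polynomial.derivative_mul, Polynomial.derivative_X,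
    Polynomial.eval_one, Polynomial.eval_zero, ← Algebra.smul_def] at this
  convert! this using 1
  simp only [zero_add, one_mul, mul_zero, add_zero, zero_mul]
  rw [mul_assoc, ← nsmul_eq_mul, ← nsmul_eq_mul, map_nsmul]

section DerivPoly

variable {ε : ℂ} {K : Type} [Fintype K] {d : ℕ} (c : SymChart ε K d)

/-- The polynomial `g_l`, over `ℂ[α]`, in the coordinates of `U = S⁻¹`, with
`∂_l det(S)^{-α} = g_l(S⁻¹) det(S)^{-α}`. It is built by the recursion
`g_{k :: l}(U) = -(α tr(U bₖ) g_l(U) + ∂_{U bₖ U} g_l(U))`. -/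
def derivPoly : List (Fin d) → MvPolynomial (Fin d) (Polynomial ℂ)
  | [] => 1
  | k :: l => -(C Polynomial.X * (∑ j, C (Polynomial.C (c.basis j * c.basis k).trace) * X j) *
      derivPoly l + ∑ j, (∑ i, ∑ i', C (Polynomial.C
        (c.coords (c.basis i * c.basis k * c.basis i') j)) * X i * X i') * pderiv j (derivPoly l))

theorem ev_derivPoly_cons (κ : ℂ) (u : Fin d → ℂ) (k : Fin d) (l : List (Fin d)) :
    ev κ u (derivPoly c (k :: l)) = -(κ * (c.mat u * c.basis k).trace * ev κ u (derivPoly c l) +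
      ∑ j, c.coords (c.mat u * c.basis k * c.mat u) j * ev κ u (pderiv j (derivPoly c l))) := by
  have h1 : (c.mat u * c.basis k).trace = ∑ j, (c.basis j * c.basis k).trace * u j := by
    rw [c.mat_eq_sum, Finset.sum_mul, Matrix.trace_sum]
    exact Finset.sum_congr rfl fun j _ => by rw [smul_mul_assoc, Matrix.trace_smul, smul_eq_mul,
      mul_comm]
  have h2 : ∀ j, c.coords (c.mat u * c.basis k * c.mat u) j =
      ∑ i, ∑ i', c.coords (c.basis i * c.basis k * c.basis i') j * u i * u i' := by
    intro j
    rw [c.mat_eq_sum]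
    simp only [Finset.sum_mul, Finset.mul_sum, map_sum, Finset.sum_apply, smul_mul_assoc,
      mul_smul_comm, map_smul, Pi.smul_apply, smul_eq_mul]
    rw [Finset.sum_comm]
    exact Finset.sum_congr rfl fun i _ => Finset.sum_congr rfl fun i' _ => by ring
  simp [derivPoly, h1, h2]

theorem derivPoly_isHomogeneous (l : List (Fin d)) : (derivPoly c l).IsHomogeneous l.length := by
  induction l with
  | nil => exact isHomogeneous_one _ _
  | cons k l ih =>
    rw [derivPoly]
    refine ((IsHomogeneous.add ?_ ?_)).neg
    · rw [List.length_cons, add_comm]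
      refine IsHomogeneous.mul ?_ ih
      exact ((IsHomogeneous.sum _ _ 1 fun j _ => isHomogeneous_C_mul_X _ _)).C_mul _
    · refine IsHomogeneous.sum _ _ _ fun j _ => ?_
      have hB : (∑ i, ∑ i', C (Polynomial.C
          (c.coords (c.basis i * c.basis k * c.basis i') j)) * X i * X i' :
          MvPolynomial (Fin d) (Polynomial ℂ)).IsHomogeneous 2 :=
        IsHomogeneous.sum _ _ 2 fun i _ => IsHomogeneous.sum _ _ 2 fun i' _ =>
          (isHomogeneous_C_mul_X _ _).mul (isHomogeneous_X _ _)
      rcases l with _ | ⟨k', l⟩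
      · simpa [derivPoly] using isHomogeneous_zero _ _ _
      · have := hB.mul (ih.pderiv (i := j))
        convert! this using 1
        simp only [List.length_cons]
        omega

end DerivPoly

section GaussianIdentity

variable {ε : ℂ} {K : Type} [Fintype K] {d r : ℕ} (c : SymChart ε K d)

/-- The product of the quadratic forms attached to a word in the basis. -/
def quadWord (r : ℕ) (l : List (Fin d)) : MvPolynomial (XY K r) ℂ :=
  (l.map fun k => quadY r (c.basis k)).prod

theorem hasDerivAt_pair_quadY_pow (p : MvPolynomial (XY K r) ℂ) (u a : Fin d → ℂ) (j : ℕ) :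
    HasDerivAt (fun s : ℂ => pair p (quadY r (c.mat (u + s • a))ᵀ ^ j))
      (j * pair p (quadY r (c.mat u)ᵀ ^ (j - 1) * quadY r (c.mat a)ᵀ)) 0 := by
  simpa using hasDerivAt_linear_pow (pair p) (quadY r (c.mat u)ᵀ) (quadY r (c.mat a)ᵀ) j

variable [DecidableEq K]

/-- The polynomials `g_l` at `α = r` are the apolar transforms of the products of quadratic forms
in `r` Gaussian vectors. -/
theorem pair_quadWord_pow (hε : ε * ε = 1) (l : List (Fin d)) (j : ℕ) (u : Fin d → ℂ) :
    pair (quadWord c r l) (quadY r (c.mat u)ᵀ ^ j) =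
      if j = l.length then (j.factorial : ℂ) * (-1) ^ j * ev (r : ℂ) u (derivPoly c l) else 0 := by
  induction l generalizing j u with
  | nil =>
    rw [quadWord, List.map_nil, List.prod_nil, pair_one_left, List.length_nil, ← constantCoeff_eq,
      map_pow]
    have : constantCoeff (quadY r (c.mat u)ᵀ) = 0 := by
      simp [quadY_apply, constantCoeff_smul]
    rw [this]
    split_ifs with h
    · simp [h, derivPoly]
    · simp [h]
  | cons k l ih =>
    rw [quadWord, List.map_cons, List.prod_cons, pair_quadY_mul, ← quadWord]
    rcases j with _ | j
    · simp [lap_apply]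
    · rw [lap_quadY_pow]
      have hsym : (c.mat u * c.basis k * c.mat u)ᵀ = ε • (c.mat u * c.basis k * c.mat u) := by
        have h1 : (c.mat u)ᵀ = ε • c.mat u := c.transpose_mat u
        have h2 : (c.basis k)ᵀ = ε • c.basis k := c.transpose_mat _
        rw [Matrix.transpose_mul, Matrix.transpose_mul, h1, h2]
        simp only [smul_mul_assoc, mul_smul_comm, smul_smul, hε, one_mul, ← mul_assoc]
      -- differentiate the induction hypothesis in the direction `U bₖ U`
      have hd := hasDerivAt_pair_quadY_pow (r := r) c (quadWord c r l) u
        (c.coords (c.mat u * c.basis k * c.mat u)) j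
      rw [c.mat_coords _ hsym] at hd
      have hd2 : HasDerivAt (fun s : ℂ => if j = l.length then (j.factorial : ℂ) * (-1) ^ j *
          ev (r : ℂ) (u + s • c.coords (c.mat u * c.basis k * c.mat u)) (derivPoly c l) else 0)
          (if j = l.length then (j.factorial : ℂ) * (-1) ^ j *
            ∑ i, c.coords (c.mat u * c.basis k * c.mat u) i * ev (r : ℂ) u (pderiv i (derivPoly c l)) else 0)
          0 := by
        split_ifs
        · have := (hasDerivAt_ev (κ := r) (derivPoly c l)
            (γ := fun s => u + s • c.coords (c.mat u * c.basis k * c.mat u))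
            (γ' := c.coords (c.mat u * c.basis k * c.mat u)) (s₀ := 0) fun i => by
              simpa using ((hasDerivAt_id (0 : ℂ)).mul_const
                (c.coords (c.mat u * c.basis k * c.mat u) i)).const_add (u i)).const_mul
                ((j.factorial : ℂ) * (-1) ^ j)
          simpa using this
        · exact hasDerivAt_const _ _
      simp only [ih] at hd
      have h3 := hd.unique hd2
      simp only [map_smul, map_add, smul_eq_mul, List.length_cons, add_left_inj]
      rw [h3, ev_derivPoly_cons, ih]
      split_ifs
      · push_cast [Nat.factorial_succ]
        ring
      · simp

end GaussianIdentity

/-! ### The transform attached to the Fischer pairing -/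

/-- The iterated directional derivative along a list of directions. -/
def dirDeriv {d : ℕ} (as : List (Fin d → ℂ)) (f : (Fin d → ℂ) → ℂ) : (Fin d → ℂ) → ℂ :=
  as.foldr (fun a g => fun u => lineDeriv ℂ g u a) f

section Injectivity

variable {ε : ℂ} {K : Type} [Fintype K] {d r : ℕ} (c : SymChart ε K d)

/-- The truncated exponential generating function `∑_{j ≤ M} ⟨p, (yᵀ Uᵀ x)^j / j!⟩` of the apolar
transform of `p`. -/
def transform (M : ℕ) (p : MvPolynomial (XY K r) ℂ) (u : Fin d → ℂ) : ℂ :=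
  ∑ j ∈ Finset.range (M + 1), ((j.factorial : ℂ))⁻¹ * pair p (quadY r (c.mat u)ᵀ ^ j)

theorem dirDeriv_transform (p : MvPolynomial (XY K r) ℂ) (as : List (Fin d → ℂ)) (N : ℕ) :
    dirDeriv as (transform c (N + as.length) p) = fun u => ∑ j ∈ Finset.range (N + 1),
      ((j.factorial : ℂ))⁻¹ * pair p (quadY r (c.mat u)ᵀ ^ j *
        (as.map fun a => quadY r (c.mat a)ᵀ).prod) := by
  induction as generalizing N with
  | nil => simp only [dirDeriv, List.foldr_nil, List.map_nil, List.prod_nil, mul_one]; rfl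
  | cons a as ih =>
    have h := ih (N + 1)
    rw [show N + 1 + as.length = N + (a :: as).length by simp only [List.length_cons]; ring] at h
    change (fun u => lineDeriv ℂ (dirDeriv as _) u a) = _
    rw [h]
    funext u
    have hd : HasDerivAt (fun s : ℂ => ∑ j ∈ Finset.range (N + 1 + 1), ((j.factorial : ℂ))⁻¹ *
        pair p (quadY r (c.mat (u + s • a))ᵀ ^ j * (as.map fun a => quadY r (c.mat a)ᵀ).prod))
        (∑ j ∈ Finset.range (N + 1 + 1), ((j.factorial : ℂ))⁻¹ * (j * pair p
          (quadY r (c.mat u)ᵀ ^ (j - 1) * quadY r (c.mat a)ᵀ *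
            (as.map fun a => quadY r (c.mat a)ᵀ).prod))) 0 := by
      refine HasDerivAt.fun_sum fun j _ => HasDerivAt.const_mul _ ?_
      simpa using hasDerivAt_linear_pow ((pair p) ∘ₗ LinearMap.mulRight ℂ
        (as.map fun a => quadY r (c.mat a)ᵀ).prod) (quadY r (c.mat u)ᵀ) (quadY r (c.mat a)ᵀ) j
    rw [lineDeriv, hd.deriv, Finset.sum_range_succ']
    simp only [Nat.cast_zero, zero_mul, mul_zero, add_zero, Nat.add_sub_cancel, List.map_cons,
      List.prod_cons, ← mul_assoc]
    refine Finset.sum_congr rfl fun j _ => ?_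
    rw [Nat.factorial_succ]
    have : ((j : ℂ) + 1) ≠ 0 := Nat.cast_add_one_ne_zero j
    push_cast
    field_simp

theorem dirDeriv_transform_zero (p : MvPolynomial (XY K r) ℂ) (as : List (Fin d → ℂ)) {M : ℕ}
    (hM : as.length ≤ M) :
    dirDeriv as (transform c M p) 0 = pair p (as.map fun a => quadY r (c.mat a)ᵀ).prod := by
  obtain ⟨N, rfl⟩ := Nat.exists_eq_add_of_le' hM
  rw [dirDeriv_transform]
  change ∑ j ∈ Finset.range (N + 1), _ = _
  rw [Finset.sum_range_succ']
  simp

/-- The span of the products of at most `M` of the quadratic forms. -/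
def wordSpan (r M : ℕ) : Submodule ℂ (MvPolynomial (XY K r) ℂ) :=
  Submodule.span ℂ {q | ∃ as : List (Fin d → ℂ), as.length ≤ M ∧
    q = (as.map fun a => quadY r (c.mat a)).prod}

theorem quadWord_mem_wordSpan {M : ℕ} {l : List (Fin d)} (hl : l.length ≤ M) :
    quadWord c r l ∈ wordSpan c r M :=
  Submodule.subset_span ⟨l.map fun k => Pi.single k 1, by simpa using hl, by
    simp [quadWord, SymChart.basis, Function.comp_def]⟩

theorem conjP_mem_wordSpan (hε : starRingEnd ℂ ε = ε) {M : ℕ} {p : MvPolynomial (XY K r) ℂ}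
    (hp : p ∈ wordSpan c r M) : conjP p ∈ wordSpan c r M := by
  induction hp using Submodule.span_induction with
  | mem q hq =>
    obtain ⟨as, has, rfl⟩ := hq
    refine Submodule.subset_span
      ⟨as.map fun a => c.coords ((c.mat a).map (starRingEnd ℂ)), by simpa using has, ?_⟩
    rw [map_list_prod, List.map_map, List.map_map]
    congr 1
    refine List.map_congr_left fun a _ => ?_
    simp only [Function.comp_apply]
    rw [c.mat_coords]
    · exact conjP_quadY _
    · rw [← Matrix.transpose_map, c.transpose_mat]
      ext i j
      simp [hε]
  | zero => simp
  | add p q _ _ hp hq => rw [map_add]; exact add_mem hp hq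
  | smul a p _ hp =>
    rw [smul_eq_C_mul, map_mul, map_C, ← smul_eq_C_mul]
    exact Submodule.smul_mem _ _ hp

/-- The apolar transform is injective: the derivatives of the transform of `p` at the origin are
the Fischer pairings of `p` with the words, and `⟨p, p̄⟩ > 0` for `p ≠ 0`. -/
theorem eq_zero_of_transform_eq_zero (hε : ε = 1 ∨ ε = -1) {M : ℕ} {p : MvPolynomial (XY K r) ℂ}
    (hp : p ∈ wordSpan c r M) (h : ∀ u, transform c M p u = 0) : p = 0 := by
  have hzero : transform c M p = fun _ => 0 := funext h
  have h1 : ∀ q ∈ wordSpan c r M, pair p q = 0 := by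
    intro q hq
    induction hq using Submodule.span_induction with
    | mem q hq =>
      obtain ⟨as, has, rfl⟩ := hq
      have h2 := dirDeriv_transform_zero c p as has
      have h3 : ∀ as : List (Fin d → ℂ), dirDeriv as (fun _ => (0 : ℂ)) = fun _ => 0 := by
        intro as
        induction as with
        | nil => rfl
        | cons a as ih =>
          change (fun u => lineDeriv ℂ (dirDeriv as _) u a) = _
          rw [ih]
          simp [lineDeriv]
      rw [hzero, h3] at h2
      have h4 : (as.map fun a => quadY r (c.mat a)ᵀ).prod =
          ε ^ as.length • (as.map fun a => quadY r (c.mat a)).prod := by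
        clear has h2
        induction as with
        | nil => simp
        | cons a as ih =>
          rw [List.map_cons, List.prod_cons, ih, c.transpose_mat, map_smul, smul_mul_smul_comm,
            List.map_cons, List.prod_cons, List.length_cons, pow_succ']
      rw [h4, map_smul, smul_eq_mul, eq_comm, mul_eq_zero] at h2
      refine h2.resolve_left (pow_ne_zero _ ?_)
      rcases hε with rfl | rfl <;> norm_num
    | zero => simp
    | add p q _ _ hp hq => rw [map_add, hp, hq, add_zero]
    | smul a p _ hp => rw [map_smul, hp, smul_zero]
  refine eq_zero_of_pair_conj_eq_zero (h1 _ (conjP_mem_wordSpan c ?_ hp))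
  rcases hε with rfl | rfl <;> simp

variable [DecidableEq K] in
theorem transform_quadWord (hε : ε * ε = 1) {M : ℕ} {l : List (Fin d)} (hl : l.length ≤ M)
    (u : Fin d → ℂ) :
    transform c M (quadWord c r l) u = (-1) ^ l.length * ev (r : ℂ) u (derivPoly c l) := by
  rw [transform, Finset.sum_eq_single l.length]
  · rw [pair_quadWord_pow c hε, if_pos rfl]
    have : ((l.length.factorial : ℂ)) ≠ 0 := by exact_mod_cast Nat.factorial_ne_zero _
    field_simp
  · intro j _ hj
    rw [pair_quadWord_pow c hε, if_neg hj, mul_zero]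
  · intro h
    simp at h
    omega

end Injectivity

theorem eq_zero_of_eventually_eval_eq_zero {σ : Type} [Fintype σ] {P : MvPolynomial σ ℂ}
    {u₀ : σ → ℂ} (h : ∀ᶠ u in 𝓝 u₀, eval u P = 0) : P = 0 := by
  obtain ⟨δ, hδ, hb⟩ := Metric.eventually_nhds_iff.1 h
  refine funext_set (fun i => Metric.ball (u₀ i) δ) (fun i => ?_) fun u hu => ?_
  · exact infinite_of_mem_nhds (u₀ i) (Metric.ball_mem_nhds _ hδ)
  · rw [map_zero]
    exact hb ((dist_pi_lt_iff hδ).2 fun i => hu i (Set.mem_univ i))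

section Independence

variable {ε : ℂ} {m : Type} [Fintype m] [DecidableEq m] {d r : ℕ} (c : SymChart ε (m ⊕ m) d)

theorem eval_quadY {K : Type} [Fintype K] (z : XY K r → ℂ) (v : Matrix K K ℂ) : eval z (quadY r v) =
    ∑ i, ∑ j, ∑ a, v i j * (z (Sum.inl (i, a)) * z (Sum.inr (j, a))) := by
  simp [quadY_apply]

/-- If the number `r` of Gaussian vectors is at least half the size of the matrices, then the
quadratic forms attached to a basis are algebraically independent: at `x = (1, 0)`, `y = (0, 1)`
the map they define is a submersion. -/
theorem eq_zero_of_aeval_quadY (hr : Fintype.card m ≤ r) {P : MvPolynomial (Fin d) ℂ}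
    (hP : aeval (fun k => quadY r (c.basis k)) P = 0) : P = 0 := by
  obtain ⟨f⟩ : Nonempty (m ↪ Fin r) :=
    Function.Embedding.nonempty_of_card_le (by simpa using hr)
  let τ : (XY (m ⊕ m) r → ℂ) → (Fin d → ℂ) := fun z k => eval z (quadY r (c.basis k))
  let z₀ : XY (m ⊕ m) r → ℂ := Sum.elim
    (fun p => Sum.elim (fun _ => 0) (fun i => if p.2 = f i then 1 else 0) p.1)
    (fun p => Sum.elim (fun i => if p.2 = f i then 1 else 0) (fun _ => 0) p.1)
  let τ' : (XY (m ⊕ m) r → ℂ) →L[ℂ] (Fin d → ℂ) := ContinuousLinearMap.pi fun k =>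
    ∑ i, ∑ j, ∑ a, c.basis k i j •
      (z₀ (Sum.inl (i, a)) • ContinuousLinearMap.proj (Sum.inr (j, a)) +
        z₀ (Sum.inr (j, a)) • ContinuousLinearMap.proj (Sum.inl (i, a)))
  have hτ : HasStrictFDerivAt τ τ' z₀ := by
    rw [hasStrictFDerivAt_pi']
    intro k
    simp only [τ, eval_quadY]
    refine HasStrictFDerivAt.fun_sum fun i _ => HasStrictFDerivAt.fun_sum fun j _ =>
      HasStrictFDerivAt.fun_sum fun a _ => HasStrictFDerivAt.const_mul ?_ _
    exact (hasStrictFDerivAt_apply _ _).mul (hasStrictFDerivAt_apply _ _)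
  have hτ' : ∀ w k, τ' w k = ∑ i, ∑ j, ∑ a, c.basis k i j *
      (z₀ (Sum.inl (i, a)) * w (Sum.inr (j, a)) + z₀ (Sum.inr (j, a)) * w (Sum.inl (i, a))) := by
    intro w k
    simp only [τ', ContinuousLinearMap.pi_apply, _root_.sum_apply,
      _root_.smul_apply, _root_.add_apply,
      ContinuousLinearMap.proj_apply, smul_eq_mul]
  have hsurj : τ'.range = ⊤ := by
    by_contra hne
    obtain ⟨η, hη, hker⟩ := Submodule.exists_le_ker_of_lt_top _ (lt_top_iff_ne_top.2 hne)
    have hη2 : ∀ v : Fin d → ℂ, η v = ∑ k, v k * η (Pi.single k 1) := by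
      intro v
      conv_lhs => rw [← Finset.univ_sum_single v]
      rw [map_sum]
      refine Finset.sum_congr rfl fun k _ => ?_
      rw [← smul_eq_mul, ← map_smul, ← Pi.single_smul, smul_eq_mul, mul_one]
    -- a functional vanishing on the range is a matrix `B` of the same symmetry, and testing it on
    -- the coordinate vectors shows that three of its four blocks vanish
    set B := c.mat fun k => η (Pi.single k 1) with hB
    have hBij : ∀ i j, B i j = ∑ k, c.basis k i j * η (Pi.single k 1) := by
      intro i j
      rw [hB, c.mat_eq_sum, Matrix.sum_apply]
      exact Finset.sum_congr rfl fun k _ => by rw [Matrix.smul_apply, smul_eq_mul, mul_comm]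
    have h0 : ∀ w, ∑ k, τ' w k * η (Pi.single k 1) = 0 := fun w => by
      rw [← hη2]
      exact hker ⟨w, rfl⟩
    have h1 : ∀ i j, B i (Sum.inl j) = 0 := by
      intro i j
      rw [hBij, ← h0 (Pi.single (Sum.inl (i, f j)) 1)]
      refine Finset.sum_congr rfl fun k _ => ?_
      congr 1
      simp [hτ', z₀, Pi.single_apply, Prod.ext_iff, ite_and]
    have h2 : ∀ i j, B (Sum.inr i) j = 0 := by
      intro i j
      rw [hBij, ← h0 (Pi.single (Sum.inr (j, f i)) 1)]
      refine Finset.sum_congr rfl fun k _ => ?_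
      congr 1
      simp [hτ', z₀, Pi.single_apply, Prod.ext_iff, ite_and]
    have h3 : B = 0 := by
      ext i j
      rcases j with j | j
      · exact h1 i j
      · rcases i with i | i
        · have := congrFun (congrFun (c.transpose_mat fun k => η (Pi.single k 1)) (Sum.inr j))
            (Sum.inl i)
          rw [← hB, Matrix.transpose_apply, Matrix.smul_apply, h1, smul_zero] at this
          exact this
        · exact h2 _ _
    apply hη
    have h4 := c.mat_injective (h3.trans (map_zero c.mat).symm)
    refine LinearMap.ext fun v => ?_
    rw [hη2]
    exact Finset.sum_eq_zero fun k _ => by rw [congrFun h4 k]; simp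
  have hmap := hτ.map_nhds_eq_of_surj hsurj
  refine eq_zero_of_eventually_eval_eq_zero (u₀ := τ z₀) ?_
  rw [← hmap]
  refine Filter.mem_map.2 (Filter.Eventually.of_forall fun z => ?_)
  have := congrArg (eval z) hP
  rw [map_zero, map_aeval] at this
  have h5 : (eval z).comp (algebraMap ℂ (MvPolynomial (XY (m ⊕ m) r) ℂ)) = RingHom.id ℂ := by
    ext x
    simp
  rw [h5] at this
  exact this

end Independence

/-! ### The coefficients of the operators -/

/-- The multi-indices of degree at most `M`. -/
abbrev MultiIdx (d M : ℕ) : Type := {μ : Fin d →₀ ℕ // μ.degree ≤ M}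

instance (d M : ℕ) : Fintype (MultiIdx d M) :=
  (Finsupp.finite_of_degree_le (σ := Fin d) M).fintype

/-- The word listing each index `i` with multiplicity `μ i`. -/
def word {d : ℕ} (μ : Fin d →₀ ℕ) : List (Fin d) := (Finsupp.toMultiset μ).toList

theorem length_word {d : ℕ} (μ : Fin d →₀ ℕ) : (word μ).length = μ.degree := by
  rw [word, Multiset.length_toList, Finsupp.card_toMultiset]
  rfl

theorem prod_map_word {d : ℕ} {A : Type*} [CommMonoid A] (μ : Fin d →₀ ℕ) (f : Fin d → A) :
    ((word μ).map f).prod = μ.prod fun i n => f i ^ n := by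
  rw [word, ← Multiset.prod_coe, ← Multiset.map_coe, Multiset.coe_toList, Finsupp.toMultiset_map,
    Finsupp.prod_toMultiset, Finsupp.prod_mapDomain_index (by simp) (by simp [pow_add])]

/-- Expansion of a polynomial of degree at most `M`. -/
theorem eval₂Hom_eq_sum_multiIdx {d M : ℕ} {R S : Type*} [CommRing R] [CommRing S] (φ : R →+* S)
    (u : Fin d → S) {p : MvPolynomial (Fin d) R} (hp : p.totalDegree ≤ M) :
    eval₂Hom φ u p = ∑ ν : MultiIdx d M, φ (coeff ν.1 p) * ∏ i, u i ^ ν.1 i := by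
  rw [coe_eval₂Hom, eval₂_eq']
  have h1 : ∀ ν ∈ p.support, ν.degree ≤ M := fun ν hν => (le_totalDegree hν).trans hp
  have h2 := Finset.sum_map Finset.univ (Function.Embedding.subtype fun ν : Fin d →₀ ℕ =>
    ν.degree ≤ M) fun ν => φ (coeff ν p) * ∏ i, u i ^ ν i
  simp only [Function.Embedding.subtype_apply] at h2
  rw [← h2]
  refine Finset.sum_subset (fun ν hν => ?_) fun ν _ hν => ?_
  · exact Finset.mem_map.2 ⟨⟨ν, h1 ν hν⟩, Finset.mem_univ _, rfl⟩
  · rw [notMem_support_iff.1 hν, map_zero, zero_mul]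

section Core

variable {ε : ℂ} {m : Type} [Fintype m] {d : ℕ} (c : SymChart ε (m ⊕ m) d)

/-- The matrix, over `ℂ[α]`, of the map sending the symbol of a constant coefficient operator `P`
of order at most `M` to the polynomial `g` with `P(∂) det(S)^{-α} = g(S⁻¹) det(S)^{-α}`. -/
def symbolMatrix (M : ℕ) : Matrix (MultiIdx d M) (MultiIdx d M) (Polynomial ℂ) :=
  Matrix.of fun ν μ => coeff ν.1 (derivPoly c (word μ.1))

theorem totalDegree_derivPoly_word {M : ℕ} (μ : MultiIdx d M) :
    (derivPoly c (word μ.1)).totalDegree ≤ M :=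
  (derivPoly_isHomogeneous c _).totalDegree_le.trans ((length_word _).trans_le μ.2)

theorem ev_derivPoly_word {M : ℕ} (κ : ℂ) (u : Fin d → ℂ) (μ : MultiIdx d M) :
    ev κ u (derivPoly c (word μ.1)) =
      ∑ ν, (symbolMatrix c M ν μ).eval κ * ∏ i, u i ^ ν.1 i :=
  eval₂Hom_eq_sum_multiIdx _ _ (totalDegree_derivPoly_word c μ)

theorem quadWord_word (r : ℕ) (μ : Fin d →₀ ℕ) :
    quadWord c r (word μ) = aeval (fun k => quadY r (c.basis k)) (monomial μ (1 : ℂ)) := by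
  rw [quadWord, prod_map_word, aeval_monomial, map_one, one_mul]

/-- The combination of words attached to a vector of coefficients. -/
def wordSum (r : ℕ) {M : ℕ} (a : MultiIdx d M → ℂ) : MvPolynomial (XY (m ⊕ m) r) ℂ :=
  ∑ μ, a μ • quadWord c r (word μ.1)

theorem wordSum_mem {r M : ℕ} (a : MultiIdx d M → ℂ) : wordSum c r a ∈ wordSpan c r M :=
  Submodule.sum_mem _ fun μ _ => Submodule.smul_mem _ _
    (quadWord_mem_wordSpan c ((length_word _).trans_le μ.2))

theorem transform_sum_smul {K : Type} [Fintype K] (c : SymChart ε K d) {r M : ℕ} {ι : Type*}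
    (s : Finset ι) (a : ι → ℂ)
    (p : ι → MvPolynomial (XY K r) ℂ) (u : Fin d → ℂ) :
    transform c M (∑ i ∈ s, a i • p i) u = ∑ i ∈ s, a i * transform c M (p i) u := by
  simp only [transform, map_sum, map_smul, LinearMap.sum_apply, LinearMap.smul_apply, smul_eq_mul,
    Finset.mul_sum]
  rw [Finset.sum_comm]
  exact Finset.sum_congr rfl fun i _ => Finset.sum_congr rfl fun j _ => by ring

variable [DecidableEq m]

theorem transform_wordSum (hε : ε * ε = 1) {r M : ℕ} (a : MultiIdx d M → ℂ) (u : Fin d → ℂ) :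
    transform c M (wordSum c r a) u =
      ∑ μ, a μ * ((-1) ^ μ.1.degree * ev (r : ℂ) u (derivPoly c (word μ.1))) := by
  rw [wordSum, transform_sum_smul]
  refine Finset.sum_congr rfl fun μ _ => ?_
  rw [transform_quadWord c hε ((length_word _).trans_le μ.2), length_word]

theorem eq_zero_of_wordSum_eq_zero {r M : ℕ} (hr : Fintype.card m ≤ r) {a : MultiIdx d M → ℂ}
    (h : wordSum c r a = 0) : a = 0 := by
  have h1 : wordSum c r a =
      aeval (fun k => quadY r (c.basis k)) (∑ μ : MultiIdx d M, monomial μ.1 (a μ)) := by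
    rw [map_sum]
    refine Finset.sum_congr rfl fun μ _ => ?_
    rw [quadWord_word, ← map_smul, smul_monomial, smul_eq_mul, mul_one]
  have h2 := eq_zero_of_aeval_quadY c hr (h1.symm.trans h)
  funext μ
  have h3 := congrArg (coeff μ.1) h2
  rw [coeff_sum, Finset.sum_eq_single μ] at h3
  · simpa using h3
  · intro ν _ hν
    rw [coeff_monomial, if_neg fun h => hν (Subtype.ext h)]
  · simp

/-- At an integer parameter `r ≥ |m|` the derivatives of `det(S)^{-r}` of order at most `M` along
distinct multi-indices are linearly independent. -/
theorem eq_zero_of_sum_ev_derivPoly (hε : ε = 1 ∨ ε = -1) {r M : ℕ} (hr : Fintype.card m ≤ r)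
    {a : MultiIdx d M → ℂ}
    (h : ∀ u, ∑ μ, a μ * ev (r : ℂ) u (derivPoly c (word μ.1)) = 0) : a = 0 := by
  have hε2 : ε * ε = 1 := by rcases hε with rfl | rfl <;> norm_num
  have h1 : (fun μ : MultiIdx d M => a μ * (-1) ^ μ.1.degree) = 0 := by
    refine eq_zero_of_wordSum_eq_zero c hr
      (eq_zero_of_transform_eq_zero c hε (wordSum_mem c (r := r) _) fun u => ?_)
    rw [transform_wordSum c hε2, ← h u]
    refine Finset.sum_congr rfl fun μ _ => ?_
    have : ((-1 : ℂ) ^ μ.1.degree) * (-1) ^ μ.1.degree = 1 := by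
      rw [← mul_pow]; norm_num
    linear_combination (a μ * ev (r : ℂ) u (derivPoly c (word μ.1))) * this
  funext μ
  have := congrFun h1 μ
  simpa using this

theorem eval_det_symbolMatrix_ne_zero (hε : ε = 1 ∨ ε = -1) {r M : ℕ} (hr : Fintype.card m ≤ r) :
    (symbolMatrix c M).det.eval (r : ℂ) ≠ 0 := by
  intro h
  have h1 : ((Polynomial.evalRingHom (r : ℂ)).mapMatrix (symbolMatrix c M)).det = 0 := by
    rw [← RingHom.map_det]
    exact h
  obtain ⟨a, ha, hb⟩ := Matrix.exists_mulVec_eq_zero_iff.2 h1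
  refine ha (eq_zero_of_sum_ev_derivPoly c hε hr fun u => ?_)
  simp only [ev_derivPoly_word, Finset.mul_sum]
  rw [Finset.sum_comm]
  refine Finset.sum_eq_zero fun ν _ => ?_
  have h2 := congrFun hb ν
  simp only [Matrix.mulVec, dotProduct, RingHom.mapMatrix_apply, Matrix.map_apply,
    Polynomial.coe_evalRingHom, Pi.zero_apply] at h2
  calc _ = (∑ μ, (symbolMatrix c M ν μ).eval (r : ℂ) * a μ) * ∏ i, u i ^ ν.1 i := by
        rw [Finset.sum_mul]
        exact Finset.sum_congr rfl fun μ _ => by ring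
    _ = 0 := by rw [h2, zero_mul]

/-- The matrix `[1, 0; 0, 0] + [0, -w; -1, 0] U`. Its determinant at `U = Σ⁻¹` is
`det(Σ₂ - w) det(Σ)⁻¹`, where `Σ₂` is the upper right block. -/
def pencil {R : Type*} [CommRing R] (w : Matrix m m R) (U : Matrix (m ⊕ m) (m ⊕ m) R) :
    Matrix (m ⊕ m) (m ⊕ m) R :=
  Matrix.fromBlocks (1 : Matrix m m R) 0 0 0 +
    Matrix.fromBlocks (0 : Matrix m m R) (-w) (-1 : Matrix m m R) 0 * U

theorem det_fromBlocks_neg_one {R : Type*} [CommRing R] (A X : Matrix m m R) :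
    (Matrix.fromBlocks A X (-1 : Matrix m m R) 0).det = X.det := by
  -- the interchange of the two block columns, as a product of unitriangular matrices
  have h : Matrix.fromBlocks A X (-1 : Matrix m m R) 0 *
      (Matrix.fromBlocks (1 : Matrix m m R) (-1 : Matrix m m R) 0 (1 : Matrix m m R) *
        Matrix.fromBlocks (1 : Matrix m m R) 0 (1 : Matrix m m R) (1 : Matrix m m R) *
        Matrix.fromBlocks (1 : Matrix m m R) (-1 : Matrix m m R) 0 (1 : Matrix m m R)) =
      Matrix.fromBlocks X (-A) 0 (1 : Matrix m m R) := by
    simp [Matrix.fromBlocks_multiply]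
  have h2 := congrArg Matrix.det h
  simpa [Matrix.det_mul, Matrix.det_fromBlocks_zero₁₂, Matrix.det_fromBlocks_zero₂₁] using h2

theorem det_pencil_inv {R : Type*} [CommRing R] (w : Matrix m m R) {S : Matrix (m ⊕ m) (m ⊕ m) R}
    (hS : IsUnit S.det) : (pencil w S⁻¹).det * S.det = (S.toBlocks₁₂ - w).det := by
  have h : pencil w S⁻¹ * S =
      Matrix.fromBlocks S.toBlocks₁₁ (S.toBlocks₁₂ - w) (-1 : Matrix m m R) 0 := by
    rw [pencil, add_mul, mul_assoc, Matrix.nonsing_inv_mul _ hS, mul_one]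
    conv_lhs => rw [← Matrix.fromBlocks_toBlocks S]
    simp [Matrix.fromBlocks_multiply, Matrix.fromBlocks_add, sub_eq_add_neg]
  rw [← Matrix.det_mul, h, det_fromBlocks_neg_one]

/-- The determinant of `pencil`, as a polynomial in the coordinates of `U` over the polynomials in
`α` and the entries of `w`. -/
def pencilPoly : MvPolynomial (Fin d) (MvPolynomial (m × m) (Polynomial ℂ)) :=
  (pencil (R := MvPolynomial (Fin d) (MvPolynomial (m × m) (Polynomial ℂ)))
    (Matrix.of fun i j => C (X (i, j)))
    (∑ k, (X k : MvPolynomial (Fin d) (MvPolynomial (m × m) (Polynomial ℂ))) •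
      (c.basis k).map fun z => C (C (Polynomial.C z)))).det

theorem eval₂Hom_pencilPoly (κ : ℂ) (w : Matrix m m ℂ) (u : Fin d → ℂ) :
    eval₂Hom (ev κ fun p : m × m => w p.1 p.2) u (pencilPoly c) = (pencil w (c.mat u)).det := by
  rw [pencilPoly, c.mat_eq_sum]
  refine (RingHom.map_det (n := m ⊕ m)
    (R := MvPolynomial (Fin d) (MvPolynomial (m × m) (Polynomial ℂ)))
    (S := ℂ) (eval₂Hom (ev κ fun p : m × m => w p.1 p.2) u) _).trans ?_
  congr 1
  ext i j
  simp only [pencil, RingHom.mapMatrix_apply, Matrix.map_apply, Matrix.add_apply, Matrix.mul_apply,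
    map_add, map_sum, map_mul, Matrix.sum_apply, Matrix.smul_apply, smul_eq_mul]
  congr 1
  · rcases i with i | i <;> rcases j with j | j <;> simp [Matrix.one_apply, apply_ite]
  · refine Finset.sum_congr rfl fun k _ => ?_
    congr 1
    · rcases i with i | i <;> rcases k with k | k <;> simp [Matrix.one_apply, apply_ite]
    · simp

theorem totalDegree_pencilPoly : (pencilPoly c).totalDegree ≤ Fintype.card (m ⊕ m) := by
  have h1 : ∀ i j, (pencil (R := MvPolynomial (Fin d) (MvPolynomial (m × m) (Polynomial ℂ)))
      (Matrix.of fun i j => C (X (i, j)))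
      (∑ k, (X k : MvPolynomial (Fin d) (MvPolynomial (m × m) (Polynomial ℂ))) •
        (c.basis k).map fun z => C (C (Polynomial.C z))) i j).totalDegree ≤ 1 := by
    intro i j
    rw [pencil, Matrix.add_apply, Matrix.mul_apply]
    refine (totalDegree_add _ _).trans (max_le ?_ (totalDegree_finsetSum_le fun k _ => ?_))
    · rcases i with i | i <;> rcases j with j | j <;> simp [Matrix.one_apply, apply_ite]
    · refine (totalDegree_mul _ _).trans ?_
      have h2 : (Matrix.fromBlocks (0 : Matrix m m _) (-(Matrix.of fun i j => C (X (i, j))))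
          (-1 : Matrix m m _) 0 i k :
          MvPolynomial (Fin d) (MvPolynomial (m × m) (Polynomial ℂ))).totalDegree = 0 := by
        rcases i with i | i <;> rcases k with k | k <;> simp [Matrix.one_apply, apply_ite]
      rw [h2, zero_add, Matrix.sum_apply]
      refine totalDegree_finsetSum_le fun k' _ => ?_
      rw [Matrix.smul_apply, smul_eq_mul]
      refine (totalDegree_mul _ _).trans ?_
      simp
  rw [pencilPoly, Matrix.det_apply']
  refine totalDegree_finsetSum_le fun σ _ => (totalDegree_mul _ _).trans ?_
  have h3 : ((((Equiv.Perm.sign σ : ℤˣ) : ℤ) :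
      MvPolynomial (Fin d) (MvPolynomial (m × m) (Polynomial ℂ)))).totalDegree = 0 := by
    rcases Int.units_eq_one_or (Equiv.Perm.sign σ) with h | h
    · rw [h, Units.val_one, Int.cast_one, totalDegree_one]
    · rw [h, Units.val_neg, Units.val_one, Int.cast_neg, Int.cast_one, totalDegree_neg,
        totalDegree_one]
  rw [h3, zero_add]
  refine (totalDegree_finsetProd _ _).trans ?_
  refine (Finset.sum_le_sum fun i _ => h1 _ _).trans ?_
  simp

/-- The coefficients of the operator family: they solve
`∑ μ, opCoeff μ * g_μ = det (symbolMatrix) * pencilPoly`. -/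
def opCoeff (μ : MultiIdx d (Fintype.card (m ⊕ m))) : MvPolynomial (m × m) (Polynomial ℂ) :=
  ∑ ν, C ((symbolMatrix c (Fintype.card (m ⊕ m))).adjugate μ ν) * coeff ν.1 (pencilPoly c)

theorem sum_opCoeff_mul (κ : ℂ) (w : Matrix m m ℂ) (u : Fin d → ℂ) :
    ∑ μ, ev κ (fun p : m × m => w p.1 p.2) (opCoeff c μ) * ev κ u (derivPoly c (word μ.1)) =
      (symbolMatrix c (Fintype.card (m ⊕ m))).det.eval κ * (pencil w (c.mat u)).det := by
  rw [← eval₂Hom_pencilPoly c κ, eval₂Hom_eq_sum_multiIdx _ _ (totalDegree_pencilPoly c)]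
  simp only [ev_derivPoly_word, opCoeff, map_sum, map_mul, ev_C]
  set Φ := symbolMatrix c (Fintype.card (m ⊕ m))
  have h : ∀ ν ν', ∑ μ, (Φ ν μ).eval κ * (Φ.adjugate μ ν').eval κ =
      if ν = ν' then Φ.det.eval κ else 0 := by
    intro ν ν'
    have h1 := congrFun (congrFun Φ.mul_adjugate ν) ν'
    have h2 := congrArg (Polynomial.eval κ) h1
    rw [Matrix.mul_apply, Polynomial.eval_finsetSum] at h2
    simp only [Polynomial.eval_mul] at h2
    rw [h2, Matrix.smul_apply, Matrix.one_apply]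
    split_ifs <;> simp
  calc _ = ∑ ν, ∑ ν', (∑ μ, (Φ ν μ).eval κ * (Φ.adjugate μ ν').eval κ) *
        ev κ (fun p : m × m => w p.1 p.2) (coeff ν'.1 (pencilPoly c)) * ∏ i, u i ^ ν.1 i := by
        simp only [Finset.sum_mul, Finset.mul_sum]
        rw [Finset.sum_comm]
        refine Finset.sum_congr rfl fun ν _ => ?_
        rw [Finset.sum_comm]
        exact Finset.sum_congr rfl fun ν' _ => Finset.sum_congr rfl fun μ _ => by ring
    _ = _ := by
        rw [Finset.mul_sum]
        refine Finset.sum_congr rfl fun ν _ => ?_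
        simp only [h, ite_mul, zero_mul, Finset.sum_ite_eq, Finset.mem_univ, if_true]
        ring

end Core

/-! ### Jets of analytic functions -/

section Jets

variable {d : ℕ} {f g : (Fin d → ℂ) → ℂ} {t₀ : Fin d → ℂ}

theorem dirDeriv_congr (as : List (Fin d → ℂ)) (h : f =ᶠ[𝓝 t₀] g) :
    dirDeriv as f =ᶠ[𝓝 t₀] dirDeriv as g := by
  induction as with
  | nil => exact h
  | cons a as ih =>
    filter_upwards [ih.eventuallyEq_nhds] with t ht
    exact ht.lineDeriv_eq

theorem lineDeriv_eventuallyEq_fderiv (hf : AnalyticAt ℂ f t₀) (a : Fin d → ℂ) :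
    (fun t => lineDeriv ℂ f t a) =ᶠ[𝓝 t₀] fun t => fderiv ℂ f t a := by
  filter_upwards [hf.eventually_analyticAt] with t ht
  exact ht.differentiableAt.lineDeriv_eq_fderiv

theorem analyticAt_lineDeriv (hf : AnalyticAt ℂ f t₀) (a : Fin d → ℂ) :
    AnalyticAt ℂ (fun t => lineDeriv ℂ f t a) t₀ := by
  refine AnalyticAt.congr ?_ (lineDeriv_eventuallyEq_fderiv hf a).symm
  exact ((ContinuousLinearMap.apply ℂ ℂ a).analyticAt _).comp hf.fderiv

theorem analyticAt_dirDeriv (as : List (Fin d → ℂ)) (hf : AnalyticAt ℂ f t₀) :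
    AnalyticAt ℂ (dirDeriv as f) t₀ := by
  induction as with
  | nil => exact hf
  | cons a as ih => exact analyticAt_lineDeriv ih a

theorem dirDeriv_const_mul (as : List (Fin d → ℂ)) (a : ℂ) (hf : AnalyticAt ℂ f t₀) :
    dirDeriv as (fun t => a * f t) =ᶠ[𝓝 t₀] fun t => a * dirDeriv as f t := by
  induction as with
  | nil => exact EventuallyEq.rfl
  | cons b as ih =>
    filter_upwards [ih.eventuallyEq_nhds, (analyticAt_dirDeriv as hf).eventually_analyticAt]
      with t ht ht2
    refine ht.lineDeriv_eq.trans ?_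
    refine ((ht2.differentiableAt.hasFDerivAt.const_mul a).hasLineDerivAt b).lineDeriv.trans ?_
    exact congrArg (a * ·) ht2.differentiableAt.lineDeriv_eq_fderiv.symm

theorem dirDeriv_add (as : List (Fin d → ℂ)) (hf : AnalyticAt ℂ f t₀) (hg : AnalyticAt ℂ g t₀) :
    dirDeriv as (fun t => f t + g t) =ᶠ[𝓝 t₀] fun t => dirDeriv as f t + dirDeriv as g t := by
  induction as with
  | nil => exact EventuallyEq.rfl
  | cons b as ih =>
    filter_upwards [ih.eventuallyEq_nhds, (analyticAt_dirDeriv as hf).eventually_analyticAt,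
      (analyticAt_dirDeriv as hg).eventually_analyticAt] with t ht ht2 ht3
    refine ht.lineDeriv_eq.trans ?_
    have h1 : HasFDerivAt (fun t => dirDeriv as f t + dirDeriv as g t)
        (fderiv ℂ (dirDeriv as f) t + fderiv ℂ (dirDeriv as g) t) t :=
      ht2.differentiableAt.hasFDerivAt.add ht3.differentiableAt.hasFDerivAt
    exact (h1.hasLineDerivAt b).lineDeriv.trans (congrArg₂ (· + ·)
      ht2.differentiableAt.lineDeriv_eq_fderiv.symm ht3.differentiableAt.lineDeriv_eq_fderiv.symm)

/-- Directional derivatives of analytic functions commute. -/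
theorem dirDeriv_perm {as bs : List (Fin d → ℂ)} (h : as.Perm bs) (hf : AnalyticAt ℂ f t₀) :
    dirDeriv as f =ᶠ[𝓝 t₀] dirDeriv bs f := by
  induction h with
  | nil => exact EventuallyEq.rfl
  | cons a _ ih =>
    filter_upwards [ih.eventuallyEq_nhds] with t ht
    exact ht.lineDeriv_eq
  | swap a b as =>
    have hF := analyticAt_dirDeriv as hf
    filter_upwards [hF.eventually_analyticAt] with t ht
    change lineDeriv ℂ (fun u => lineDeriv ℂ (dirDeriv as f) u a) t b =
      lineDeriv ℂ (fun u => lineDeriv ℂ (dirDeriv as f) u b) t a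
    have key : ∀ a b, lineDeriv ℂ (fun u => lineDeriv ℂ (dirDeriv as f) u a) t b =
        fderiv ℂ (fderiv ℂ (dirDeriv as f)) t b a := by
      intro a b
      rw [(lineDeriv_eventuallyEq_fderiv ht a).lineDeriv_eq]
      have := (ContinuousLinearMap.apply ℂ ℂ a).hasFDerivAt.comp t
        ht.fderiv.differentiableAt.hasFDerivAt
      exact (this.hasLineDerivAt b).lineDeriv
    rw [key, key]
    exact ht.contDiffAt.isSymmSndFDerivAt (n := 2) (by simp) b a
  | trans _ _ ih1 ih2 => exact ih1.trans ih2

/-- Cauchy estimate: differentiating lowers the order of vanishing by at most one. -/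
theorem lineDeriv_isBigO {n : ℕ} (hf : AnalyticAt ℂ f t₀)
    (h : f =O[𝓝 t₀] fun t => ‖t - t₀‖ ^ (n + 1)) (a : Fin d → ℂ) :
    (fun t => lineDeriv ℂ f t a) =O[𝓝 t₀] fun t => ‖t - t₀‖ ^ n := by
  rcases Nat.eq_zero_or_pos n with rfl | hn
  · simp only [pow_zero]
    exact (analyticAt_lineDeriv hf a).continuousAt.isBigO_one ℝ
  obtain ⟨C, hC⟩ := h.bound
  obtain ⟨δ, hδ, hb⟩ := Metric.eventually_nhds_iff.1 (hC.and hf.eventually_analyticAt)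
  have hA : 0 < 1 + ‖a‖ := by positivity
  refine IsBigO.of_bound (C * (1 + ‖a‖) ^ (n + 1)) ?_
  refine Metric.eventually_nhds_iff.2 ⟨δ / (1 + ‖a‖), by positivity, fun t ht => ?_⟩
  rw [dist_eq_norm, lt_div_iff₀ hA] at ht
  rcases eq_or_ne t t₀ with rfl | hne
  · have h0 : HasFDerivAt f (0 : (Fin d → ℂ) →L[ℂ] ℂ) t := h.hasFDerivAt (by omega)
    rw [(h0.hasLineDerivAt a).lineDeriv]
    simp [hn.ne']
  have hρ : 0 < ‖t - t₀‖ := norm_pos_iff.2 (sub_ne_zero.2 hne)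
  have hin : ∀ s ∈ Metric.closedBall (0 : ℂ) ‖t - t₀‖,
      ‖t + s • a - t₀‖ ≤ ‖t - t₀‖ * (1 + ‖a‖) := by
    intro s hs
    rw [mem_closedBall_zero_iff] at hs
    calc ‖t + s • a - t₀‖ = ‖(t - t₀) + s • a‖ := by congr 1; abel
      _ ≤ ‖t - t₀‖ + ‖s‖ * ‖a‖ := (norm_add_le _ _).trans_eq (by rw [norm_smul])
      _ ≤ _ := by nlinarith [norm_nonneg a]
  have hd : DiffContOnCl ℂ (fun s : ℂ => f (t + s • a)) (Metric.ball 0 ‖t - t₀‖) := by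
    refine DifferentiableOn.diffContOnCl_ball (U := Metric.closedBall 0 ‖t - t₀‖)
      (fun s hs => DifferentiableAt.differentiableWithinAt ?_) le_rfl
    have h1 := (hb (y := t + s • a)
      (by rw [dist_eq_norm]; exact (hin s hs).trans_lt ht)).2.differentiableAt
    exact h1.comp s (by fun_prop)
  have h2 := Complex.norm_deriv_le_of_forall_mem_sphere_norm_le hρ hd
    (C := C * (‖t - t₀‖ * (1 + ‖a‖)) ^ (n + 1)) fun s hs => by
      have hs' := Metric.sphere_subset_closedBall hs
      refine (hb (y := t + s • a)
        (by rw [dist_eq_norm]; exact (hin s hs').trans_lt ht)).1.trans ?_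
      rw [norm_pow, norm_norm]
      have hC0 : 0 ≤ C := by
        by_contra hC0
        have h3 := (hb (y := t) (by
          rw [dist_eq_norm]; nlinarith [norm_nonneg a])).1
        rw [norm_pow, norm_norm] at h3
        have : C * ‖t - t₀‖ ^ (n + 1) < 0 := mul_neg_of_neg_of_pos (not_le.1 hC0) (by positivity)
        linarith [norm_nonneg (f t)]
      gcongr
      exact hin s hs'
  refine h2.trans_eq ?_
  rw [norm_pow, norm_norm, mul_pow, pow_succ ‖t - t₀‖]
  field_simp

theorem dirDeriv_isBigO (as : List (Fin d → ℂ)) {n : ℕ} (hf : AnalyticAt ℂ f t₀)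
    (h : f =O[𝓝 t₀] fun t => ‖t - t₀‖ ^ (n + as.length)) :
    dirDeriv as f =O[𝓝 t₀] fun t => ‖t - t₀‖ ^ n := by
  induction as generalizing n with
  | nil => exact h
  | cons a as ih =>
    refine lineDeriv_isBigO (analyticAt_dirDeriv as hf) (ih ?_) a
    rwa [List.length_cons, ← add_assoc, add_right_comm] at h

theorem dirDeriv_eq_zero_of_isBigO (as : List (Fin d → ℂ)) {M : ℕ} (hM : as.length ≤ M)
    (hf : AnalyticAt ℂ f t₀) (h : f =O[𝓝 t₀] fun t => ‖t - t₀‖ ^ (M + 1)) :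
    dirDeriv as f t₀ = 0 := by
  obtain ⟨N, rfl⟩ := Nat.exists_eq_add_of_le' hM
  have h1 : dirDeriv as f =O[𝓝 t₀] fun t => ‖t - t₀‖ ^ (N + 1) := by
    refine dirDeriv_isBigO as hf ?_
    rwa [add_right_comm]
  obtain ⟨C, hC⟩ := h1.bound
  have := hC.self_of_nhds
  simpa using this

/-- Iterated partial derivatives along a word. -/
abbrev wordDeriv (l : List (Fin d)) (f : (Fin d → ℂ) → ℂ) : (Fin d → ℂ) → ℂ :=
  dirDeriv (l.map fun k => Pi.single k 1) f

/-- Taylor: if all partial derivatives of order at most `M` vanish at `t₀`, then `f` vanishes to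
order `M + 1`. -/
theorem isBigO_of_wordDeriv_eq_zero {M : ℕ} (hf : AnalyticAt ℂ f t₀)
    (h : ∀ l : List (Fin d), l.length ≤ M → wordDeriv l f t₀ = 0) :
    f =O[𝓝 t₀] fun t => ‖t - t₀‖ ^ (M + 1) := by
  have hf0 : f t₀ = 0 := h [] (Nat.zero_le _)
  induction M generalizing f with
  | zero =>
    have := hf.differentiableAt.isBigO_sub
    simp only [hf0, sub_zero] at this
    simpa using this.norm_right
  | succ M ih =>
    have h1 : ∀ k : Fin d, (fun t => lineDeriv ℂ f t (Pi.single k 1)) =O[𝓝 t₀]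
        fun t => ‖t - t₀‖ ^ (M + 1) := by
      intro k
      have h2 : ∀ l : List (Fin d), l.length ≤ M →
          wordDeriv l (fun t => lineDeriv ℂ f t (Pi.single k 1)) t₀ = 0 := by
        intro l hl
        have := h (l ++ [k]) (by simpa using hl)
        simpa [wordDeriv, dirDeriv] using this
      exact ih (analyticAt_lineDeriv hf _) h2 (h2 [] (Nat.zero_le _))
    have h3 : (fun t => fderiv ℂ f t) =O[𝓝 t₀] fun t => ‖t - t₀‖ ^ (M + 1) := by
      have h4 : (fun t => fderiv ℂ f t) =ᶠ[𝓝 t₀] fun t => ∑ k,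
          lineDeriv ℂ f t (Pi.single k 1) • (ContinuousLinearMap.proj (R := ℂ)
            (φ := fun _ : Fin d => ℂ) k) := by
        filter_upwards [hf.eventually_analyticAt] with t ht
        ext v
        rw [sum_apply]
        conv_lhs => rw [← Finset.univ_sum_single v]
        rw [map_sum]
        refine Finset.sum_congr rfl fun k _ => ?_
        rw [ht.differentiableAt.lineDeriv_eq_fderiv, smul_apply,
          ContinuousLinearMap.proj_apply, smul_eq_mul, mul_comm, ← smul_eq_mul, ← map_smul,
          ← Pi.single_smul, smul_eq_mul, mul_one]
      refine h4.trans_isBigO (IsBigO.fun_sum fun k _ => ?_)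
      have := (h1 k).smul (isBigO_refl (fun _ : Fin d → ℂ => (ContinuousLinearMap.proj (R := ℂ)
            (φ := fun _ : Fin d => ℂ) k)) (𝓝 t₀))
      refine this.trans (IsBigO.of_bound ‖(ContinuousLinearMap.proj (R := ℂ)
            (φ := fun _ : Fin d => ℂ) k)‖ (Eventually.of_forall fun t => ?_))
      rw [norm_smul, mul_comm]
    obtain ⟨C, hC⟩ := h3.bound
    obtain ⟨δ, hδ, hb⟩ := Metric.eventually_nhds_iff.1 (hC.and hf.eventually_analyticAt)
    refine IsBigO.of_bound C (Metric.eventually_nhds_iff.2 ⟨δ, hδ, fun t ht => ?_⟩)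
    have hin : ∀ u ∈ Metric.closedBall t₀ ‖t - t₀‖, dist u t₀ < δ := fun u hu =>
      (Metric.mem_closedBall.1 hu).trans_lt (by rwa [← dist_eq_norm])
    have hC0 : 0 ≤ C ∨ t = t₀ := by
      by_contra hcon
      push Not at hcon
      have h3 := (hb ht).1
      rw [norm_pow, norm_norm] at h3
      have hpos : 0 < ‖t - t₀‖ := norm_pos_iff.2 (sub_ne_zero.2 hcon.2)
      have : C * ‖t - t₀‖ ^ (M + 1) < 0 := mul_neg_of_neg_of_pos hcon.1 (by positivity)
      linarith [norm_nonneg (fderiv ℂ f t)]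
    rcases hC0 with hC0 | rfl
    · have := (convex_closedBall t₀ ‖t - t₀‖).norm_image_sub_le_of_norm_fderiv_le (𝕜 := ℂ)
        (f := f) (C := C * ‖t - t₀‖ ^ (M + 1)) (x := t₀) (y := t)
        (fun u hu => (hb (hin u hu)).2.differentiableAt) (fun u hu => by
          refine (hb (hin u hu)).1.trans ?_
          rw [norm_pow, norm_norm]
          gcongr
          rw [← dist_eq_norm]
          exact Metric.mem_closedBall.1 hu) (by simp) (by simp [dist_eq_norm])
      rw [hf0, sub_zero] at this
      rw [norm_pow, norm_norm, pow_succ ‖t - t₀‖, ← mul_assoc]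
      exact this
    · simp [hf0]

end Jets

/-! ### Derivatives of powers of the determinant -/

section MatrixCalculus

variable {K : Type} {d : ℕ}

theorem analyticAt_mat {ε : ℂ} (c : SymChart ε K d) (i j : K) (t₀ : Fin d → ℂ) :
    AnalyticAt ℂ (fun t => c.mat t i j) t₀ := by
  have : (fun t => c.mat t i j) = fun t : Fin d → ℂ => ∑ k, t k * c.basis k i j := by
    funext t
    rw [c.mat_eq_sum, Matrix.sum_apply]
    rfl
  rw [this]
  exact Finset.analyticAt_fun_sum _ fun k _ =>
    ((ContinuousLinearMap.proj (R := ℂ) (φ := fun _ : Fin d => ℂ) k).analyticAt _).mul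
      analyticAt_const

theorem analyticAt_mat_add {ε : ℂ} (c : SymChart ε K d) (r : Fin d → ℂ) (i j : K) (t₀ : Fin d → ℂ) :
    AnalyticAt ℂ (fun t => c.mat (t + r) i j) t₀ := by
  simp only [map_add, Matrix.add_apply]
  exact (analyticAt_mat c i j t₀).add analyticAt_const

variable [Fintype K]

theorem analyticAt_mul_apply {E : Type*} [NormedAddCommGroup E] [NormedSpace ℂ E]
    {A B : E → Matrix K K ℂ} {t₀ : E} (hA : ∀ i j, AnalyticAt ℂ (fun t => A t i j) t₀)
    (hB : ∀ i j, AnalyticAt ℂ (fun t => B t i j) t₀) (i j : K) :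
    AnalyticAt ℂ (fun t => (A t * B t) i j) t₀ := by
  simp only [Matrix.mul_apply]
  exact Finset.analyticAt_fun_sum _ fun k _ => (hA _ _).mul (hB _ _)

variable [DecidableEq K]

/-- Jacobi's formula along a line. -/
theorem hasDerivAt_det_line {A : Matrix K K ℂ} (B : Matrix K K ℂ) (hA : A.det ≠ 0) :
    HasDerivAt (fun s : ℂ => (A + s • B).det) (A.det * (A⁻¹ * B).trace) 0 := by
  have h1 : ∀ s : ℂ, (A + s • B).det = A.det *
      Polynomial.eval s (1 + (Polynomial.X : Polynomial ℂ) • (A⁻¹ * B).map Polynomial.C).det := by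
    intro s
    have h2 : A + s • B = A * (1 + s • (A⁻¹ * B)) := by
      rw [mul_add, mul_one, mul_smul_comm, ← mul_assoc,
        Matrix.mul_nonsing_inv _ (isUnit_iff_ne_zero.2 hA), one_mul]
    rw [h2, Matrix.det_mul]
    congr 1
    generalize A⁻¹ * B = N
    have := (Polynomial.evalRingHom s).map_det
      (1 + (Polynomial.X : Polynomial ℂ) • N.map Polynomial.C)
    rw [Polynomial.coe_evalRingHom] at this
    rw [this]
    congr 1
    ext i j
    simp only [Matrix.add_apply, Matrix.one_apply, Matrix.smul_apply, smul_eq_mul, RingHom.mapMatrix_apply,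
      Matrix.map_apply, Polynomial.coe_evalRingHom, Polynomial.eval_add, Polynomial.eval_mul,
      Polynomial.eval_X, Polynomial.eval_C]
    split_ifs <;> simp
  simp only [h1]
  have := (Polynomial.hasDerivAt (1 + (Polynomial.X : Polynomial ℂ) •
    (A⁻¹ * B).map Polynomial.C).det 0).const_mul A.det
  rwa [Matrix.derivative_det_one_add_X_smul] at this

attribute [local instance] Matrix.linftyOpNormedRing Matrix.linftyOpNormedAlgebra in
theorem hasDerivAt_inv_line (φ : Matrix K K ℂ →ₗ[ℂ] ℂ) {A : Matrix K K ℂ} (B : Matrix K K ℂ)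
    (hA : A.det ≠ 0) :
    HasDerivAt (fun s : ℂ => φ (A + s • B)⁻¹) (-φ (A⁻¹ * B * A⁻¹)) 0 := by
  have hu : IsUnit A := (Matrix.isUnit_iff_isUnit_det A).2 (isUnit_iff_ne_zero.2 hA)
  have h1 : HasDerivAt (fun s : ℂ => A + s • B) B 0 := by
    have := ((hasDerivAt_id (0 : ℂ)).smul_const B).const_add A
    rwa [one_smul] at this
  have h2 := hasFDerivAt_ringInverse (𝕜 := ℂ) hu.unit
  rw [IsUnit.unit_spec] at h2
  have h3 : HasFDerivAt Ring.inverse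
    (-ContinuousLinearMap.mulLeftRight ℂ (Matrix K K ℂ) ↑hu.unit⁻¹ ↑hu.unit⁻¹) (A + (0 : ℂ) • B) := by
    rwa [zero_smul, add_zero]
  have h4 := h3.comp_hasDerivAt (0 : ℂ) h1
  have h5 := (LinearMap.toContinuousLinearMap φ).hasFDerivAt.comp_hasDerivAt (0 : ℂ) h4
  simp only [Matrix.nonsing_inv_eq_ringInverse]
  convert! h5 using 1
  have h6 : ((hu.unit⁻¹ : (Matrix K K ℂ)ˣ) : Matrix K K ℂ) = Ring.inverse A := by
    rw [← Ring.inverse_unit, IsUnit.unit_spec]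
  simp only [h6, neg_apply, ContinuousLinearMap.mulLeftRight_apply]
  exact (map_neg φ _).symm

theorem analyticAt_linear_entries {E : Type*} [NormedAddCommGroup E] [NormedSpace ℂ E]
    (φ : Matrix K K ℂ →ₗ[ℂ] ℂ) {A : E → Matrix K K ℂ} {t₀ : E}
    (hA : ∀ i j, AnalyticAt ℂ (fun t => A t i j) t₀) : AnalyticAt ℂ (fun t => φ (A t)) t₀ := by
  have h : ∀ t, φ (A t) = ∑ i, ∑ j, A t i j * φ (Matrix.single i j 1) := by
    intro t
    conv_lhs => rw [Matrix.matrix_eq_sum_single (A t)]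
    simp only [map_sum]
    refine Finset.sum_congr rfl fun i _ => Finset.sum_congr rfl fun j _ => ?_
    rw [← smul_eq_mul, ← map_smul, Matrix.smul_single, smul_eq_mul, mul_one]
  simp only [h]
  exact Finset.analyticAt_fun_sum _ fun i _ => Finset.analyticAt_fun_sum _ fun j _ =>
    (hA i j).mul analyticAt_const

theorem analyticAt_det {E : Type*} [NormedAddCommGroup E] [NormedSpace ℂ E]
    {A : E → Matrix K K ℂ} {t₀ : E}
    (hA : ∀ i j, AnalyticAt ℂ (fun t => A t i j) t₀) : AnalyticAt ℂ (fun t => (A t).det) t₀ := by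
  simp only [Matrix.det_apply']
  exact Finset.analyticAt_fun_sum _ fun σ _ => analyticAt_const.mul
    (Finset.analyticAt_fun_prod _ fun i _ => hA _ _)

theorem analyticAt_inv_apply {E : Type*} [NormedAddCommGroup E] [NormedSpace ℂ E]
    {A : E → Matrix K K ℂ} {t₀ : E} (hA : ∀ i j, AnalyticAt ℂ (fun t => A t i j) t₀)
    (h : (A t₀).det ≠ 0) (i j : K) : AnalyticAt ℂ (fun t => (A t)⁻¹ i j) t₀ := by
  simp only [Matrix.inv_def, Ring.inverse_eq_inv', Matrix.smul_apply, smul_eq_mul,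
    Matrix.adjugate_apply]
  refine ((analyticAt_det hA).inv h).mul (analyticAt_det fun k l => ?_)
  simp only [Matrix.updateRow_apply]
  split_ifs
  · exact analyticAt_const
  · exact hA _ _

theorem analyticAt_detPow {ε : ℂ} (c : SymChart ε K d) (κ : ℤ) {r t₀ : Fin d → ℂ}
    (h : (c.mat (t₀ + r)).det ≠ 0) :
    AnalyticAt ℂ (fun t => (c.mat (t + r)).det ^ κ) t₀ :=
  (analyticAt_det fun i j => analyticAt_mat_add c r i j t₀).zpow h

theorem eventually_det_ne_zero {ε : ℂ} (c : SymChart ε K d) {r t₀ : Fin d → ℂ}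
    (h : (c.mat (t₀ + r)).det ≠ 0) : ∀ᶠ t in 𝓝 t₀, (c.mat (t + r)).det ≠ 0 :=
  (analyticAt_det fun i j => analyticAt_mat_add c r i j t₀).continuousAt.eventually_ne h

theorem transpose_inv_mat {ε : ℂ} (hε : ε * ε = 1) (c : SymChart ε K d) (t : Fin d → ℂ) :
    ((c.mat t)⁻¹)ᵀ = ε • (c.mat t)⁻¹ := by
  rw [Matrix.transpose_nonsing_inv, c.transpose_mat]
  by_cases h : IsUnit (c.mat t).det
  · refine Matrix.inv_eq_right_inv ?_
    rw [smul_mul_smul_comm, hε, Matrix.mul_nonsing_inv _ h, one_smul]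
  · have h2 : ¬ IsUnit (ε • c.mat t).det := by
      rw [← c.transpose_mat, Matrix.det_transpose]
      exact h
    rw [Matrix.nonsing_inv_apply_not_isUnit _ h, Matrix.nonsing_inv_apply_not_isUnit _ h2,
      smul_zero]

theorem mat_coords_inv {ε : ℂ} (hε : ε * ε = 1) (c : SymChart ε K d) (t : Fin d → ℂ) :
    c.mat (c.coords (c.mat t)⁻¹) = (c.mat t)⁻¹ :=
  c.mat_coords _ (transpose_inv_mat hε c t)

/-- All derivatives of `det(S)^{-κ}`. -/
theorem wordDeriv_detPow {ε : ℂ} (hε : ε * ε = 1) (c : SymChart ε K d) (κ : ℤ)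
    (l : List (Fin d)) {t r : Fin d → ℂ} (h : (c.mat (t + r)).det ≠ 0) :
    wordDeriv l (fun t => (c.mat (t + r)).det ^ (-κ)) t =
      ev (κ : ℂ) (c.coords (c.mat (t + r))⁻¹) (derivPoly c l) * (c.mat (t + r)).det ^ (-κ) := by
  induction l generalizing t with
  | nil => simp [derivPoly, wordDeriv, dirDeriv]
  | cons k l ih =>
    set F := wordDeriv l (fun t => (c.mat (t + r)).det ^ (-κ)) with hF
    change lineDeriv ℂ F t (Pi.single k 1) = _
    have h1 : F =ᶠ[𝓝 t] fun t => ev (κ : ℂ) (c.coords (c.mat (t + r))⁻¹) (derivPoly c l) *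
        (c.mat (t + r)).det ^ (-κ) := by
      filter_upwards [eventually_det_ne_zero c h] with t ht
      exact ih ht
    rw [h1.lineDeriv_eq]
    have h2 : ∀ s : ℂ, c.mat (t + s • Pi.single k 1 + r) = c.mat (t + r) + s • c.basis k := by
      intro s
      rw [add_right_comm, map_add, map_smul]
      rfl
    have h3 := (hasDerivAt_zpow (-κ) (c.mat (t + r) + (0 : ℂ) • c.basis k).det
      (by rw [zero_smul, add_zero]; exact Or.inl h)).comp (0 : ℂ)
      (hasDerivAt_det_line (c.basis k) h)
    have h4 := hasDerivAt_ev (κ := (κ : ℂ)) (derivPoly c l)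
      (γ := fun s => c.coords (c.mat (t + r) + s • c.basis k)⁻¹) (s₀ := 0)
      (fun j => hasDerivAt_inv_line (LinearMap.proj j ∘ₗ c.coords) (c.basis k) h)
    have h5 := (h4.mul h3).deriv
    rw [zero_smul, add_zero] at h5
    rw [lineDeriv]
    simp only [h2]
    refine h5.trans ?_
    have h6 : c.mat (c.coords (c.mat (t + r))⁻¹) = (c.mat (t + r))⁻¹ := mat_coords_inv hε c _
    rw [ev_derivPoly_cons, h6]
    have h7 : (c.mat (t + r)).det ^ (-κ - 1) * (c.mat (t + r)).det =
        (c.mat (t + r)).det ^ (-κ) := by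
      rw [← zpow_add_one₀ h, sub_add_cancel]
    simp only [LinearMap.comp_apply, LinearMap.proj_apply, Function.comp_apply, zero_smul, add_zero,
      neg_mul, Finset.sum_neg_distrib]
    push_cast
    rw [← h7]
    ring

end MatrixCalculus

/-! ### Reduction to the test functions -/

section Transfer

variable {ε : ℂ} {m : Type} [Fintype m] [DecidableEq m] {d : ℕ} (c : SymChart ε (m ⊕ m) d)

/-- There are invertible matrices in the space, e.g. `[0, 1; ε, 0]`. -/
theorem exists_det_mat_ne_zero (hε : ε * ε = 1) : ∃ u, (c.mat u).det ≠ 0 := by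
  have hT : (Matrix.fromBlocks 0 1 (ε • (1 : Matrix m m ℂ)) 0)ᵀ =
      ε • Matrix.fromBlocks 0 1 (ε • (1 : Matrix m m ℂ)) 0 := by
    simp [Matrix.fromBlocks_transpose, Matrix.fromBlocks_smul, smul_smul, hε]
  refine ⟨c.coords (Matrix.fromBlocks 0 1 (ε • (1 : Matrix m m ℂ)) 0), ?_⟩
  rw [c.mat_coords _ hT]
  have h2 : Matrix.fromBlocks 0 1 (ε • (1 : Matrix m m ℂ)) 0 *
      Matrix.fromBlocks 0 (ε • (1 : Matrix m m ℂ)) (1 : Matrix m m ℂ) 0 = 1 := by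
    simp [Matrix.fromBlocks_multiply, smul_smul, hε, Matrix.fromBlocks_one]
  intro h3
  have := congrArg Matrix.det h2
  rw [Matrix.det_mul, h3, zero_mul, Matrix.det_one] at this
  exact zero_ne_one this

/-- A combination of the polynomials `g_μ` vanishing at the inverses of all small invertible
matrices vanishes identically. -/
theorem sum_ev_eq_zero_of_eventually (hε : ε * ε = 1) {κ : ℂ} {M : ℕ} {a : MultiIdx d M → ℂ}
    (h : ∀ᶠ x in 𝓝 (0 : Fin d → ℂ), (c.mat x).det ≠ 0 →
      ∑ μ, a μ * ev κ (c.coords (c.mat x)⁻¹) (derivPoly c (word μ.1)) = 0) (u : Fin d → ℂ) :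
    ∑ μ, a μ * ev κ u (derivPoly c (word μ.1)) = 0 := by
  set P : MvPolynomial (Fin d) ℂ :=
    ∑ μ, C (a μ) * MvPolynomial.map (Polynomial.evalRingHom κ) (derivPoly c (word μ.1)) with hP
  have hPe : ∀ u, eval u P = ∑ μ, a μ * ev κ u (derivPoly c (word μ.1)) := by
    intro u
    simp only [hP, map_sum, map_mul, eval_C, eval_map]
    rfl
  obtain ⟨u₀, hu₀⟩ := exists_det_mat_ne_zero c hε
  -- `u ↦ (mat u)⁻¹` in coordinates, near a large multiple of `u₀`
  set inv : (Fin d → ℂ) → (Fin d → ℂ) := fun u => c.coords (c.mat u)⁻¹ with hinv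
  have hs : ∀ s : ℂ, s ≠ 0 → (c.mat (s • u₀)).det ≠ 0 := by
    intro s hs
    rw [map_smul, Matrix.det_smul]
    exact mul_ne_zero (pow_ne_zero _ hs) hu₀
  have hlim : Tendsto (fun n : ℕ => inv (((n : ℂ) + 1) • u₀)) atTop (𝓝 0) := by
    have h1 : ∀ n : ℕ, inv (((n : ℂ) + 1) • u₀) = (1 / ((n : ℂ) + 1)) • c.coords (c.mat u₀)⁻¹ := by
      intro n
      have hn : ((n : ℂ) + 1) ≠ 0 := Nat.cast_add_one_ne_zero n
      simp only [hinv, map_smul]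
      have : ((((n : ℂ) + 1) • c.mat u₀))⁻¹ = (1 / ((n : ℂ) + 1)) • (c.mat u₀)⁻¹ := by
        refine Matrix.inv_eq_right_inv ?_
        rw [smul_mul_smul_comm, Matrix.mul_nonsing_inv _ (isUnit_iff_ne_zero.2 hu₀),
          mul_one_div_cancel hn, one_smul]
      rw [this, map_smul]
    simp only [h1]
    have := (tendsto_one_div_add_atTop_nhds_zero_nat (𝕜 := ℂ)).smul_const (c.coords (c.mat u₀)⁻¹)
    rwa [zero_smul] at this
  obtain ⟨n, hn⟩ := (hlim.eventually (eventually_eventually_nhds.2 h)).exists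
  set u₁ := ((n : ℂ) + 1) • u₀ with hu₁
  have hdet : (c.mat u₁).det ≠ 0 := hs _ (Nat.cast_add_one_ne_zero n)
  have hcont : ContinuousAt inv u₁ := by
    refine continuousAt_pi.2 fun j => ?_
    exact (analyticAt_linear_entries (LinearMap.proj j ∘ₗ c.coords)
      (fun i j => analyticAt_inv_apply (fun i j => analyticAt_mat c i j u₁) hdet i j)).continuousAt
  have hev : ∀ᶠ u in 𝓝 u₁, eval u P = 0 := by
    have hdet2 : ∀ᶠ u in 𝓝 u₁, (c.mat u).det ≠ 0 :=
      (analyticAt_det fun i j => analyticAt_mat c i j u₁).continuousAt.eventually_ne hdet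
    filter_upwards [hcont.eventually hn, hdet2] with u hu hu2
    have h3 : c.mat (inv u) = (c.mat u)⁻¹ := mat_coords_inv hε c u
    have h4 := hu (by
      rw [h3, Matrix.det_nonsing_inv, Ring.inverse_eq_inv']
      exact inv_ne_zero hu2)
    rw [h3, Matrix.nonsing_inv_nonsing_inv _ (isUnit_iff_ne_zero.2 hu2), c.coords_mat] at h4
    rw [hPe, h4]
  rw [← hPe, eq_zero_of_eventually_eval_eq_zero hev, map_zero]

/-- The functions analytic at a point. -/
def analyticFunctions (w₀ : Fin d → ℂ) : Submodule ℂ ((Fin d → ℂ) → ℂ) where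
  carrier := {f | AnalyticAt ℂ f w₀}
  add_mem' hf hg := AnalyticAt.add hf hg
  zero_mem' := analyticAt_const
  smul_mem' _ _ hf := analyticAt_const.smul hf

/-- The value at `w₀` of an iterated derivative, as a linear functional. -/
def dirDerivAt (w₀ : Fin d → ℂ) (as : List (Fin d → ℂ)) : analyticFunctions w₀ →ₗ[ℂ] ℂ where
  toFun f := dirDeriv as f.1 w₀
  map_add' f g := (dirDeriv_add as f.2 g.2).eq_of_nhds
  map_smul' a f := (dirDeriv_const_mul as a f.2).eq_of_nhds

/-- A linear functional on functions analytic at `w₀`, depending only on finitely many derivatives,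
vanishes if it vanishes on the functions `det(S - S₀ + X)^{-r}` for all small invertible `X`: the
jets of these functions span all jets. -/
theorem eq_zero_of_detPow (hε : ε = 1 ∨ ε = -1) {r M : ℕ} (hr : Fintype.card m ≤ r)
    {w₀ : Fin d → ℂ} (Λ : analyticFunctions w₀ →ₗ[ℂ] ℂ)
    (hΛ : ∀ f : analyticFunctions w₀,
      (f.1 =O[𝓝 w₀] fun t => ‖t - w₀‖ ^ (M + 1)) → Λ f = 0)
    (hdet : ∀ᶠ x in 𝓝 (0 : Fin d → ℂ), (c.mat x).det ≠ 0 → ∀ f : analyticFunctions w₀,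
      (f.1 = fun t => (c.mat (t + (x - w₀))).det ^ (-(r : ℤ))) → Λ f = 0)
    (f : analyticFunctions w₀) : Λ f = 0 := by
  have hε2 : ε * ε = 1 := by rcases hε with rfl | rfl <;> norm_num
  let δ : analyticFunctions w₀ →ₗ[ℂ] (MultiIdx d M → ℂ) :=
    LinearMap.pi fun μ => dirDerivAt w₀ ((word μ.1).map fun k => Pi.single k 1)
  -- `Λ` factors through the jets
  have hker : ∀ f, δ f = 0 → Λ f = 0 := by
    intro f hf
    refine hΛ f (isBigO_of_wordDeriv_eq_zero f.2 fun l hl => ?_)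
    set μ : Fin d →₀ ℕ := Multiset.toFinsupp (l : Multiset (Fin d)) with hμ
    have hp : l.Perm (word μ) := by
      rw [← Multiset.coe_eq_coe, word, Multiset.coe_toList, hμ, Multiset.toFinsupp_toMultiset]
    have hdeg : μ.degree ≤ M := by rw [← length_word, ← hp.length_eq]; exact hl
    have h1 := (dirDeriv_perm (hp.map fun k => (Pi.single k 1 : Fin d → ℂ)) f.2).eq_of_nhds
    exact h1.trans (congrFun hf ⟨μ, hdeg⟩)
  -- the jets of the test functions in the kernel of `Λ` span
  have hspan : (LinearMap.ker Λ).map δ = ⊤ := by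
    by_contra hne
    obtain ⟨η, hη, hle⟩ := Submodule.exists_le_ker_of_lt_top _ (lt_top_iff_ne_top.2 hne)
    have hη2 : ∀ v : MultiIdx d M → ℂ, η v = ∑ μ, η (Pi.single μ 1) * v μ := by
      intro v
      conv_lhs => rw [← Finset.univ_sum_single v]
      rw [map_sum]
      refine Finset.sum_congr rfl fun k _ => ?_
      rw [mul_comm, ← smul_eq_mul, ← map_smul, ← Pi.single_smul, smul_eq_mul, mul_one]
    have h1 : ∀ u, ∑ μ : MultiIdx d M, η (Pi.single μ 1) * ev (r : ℂ) u (derivPoly c (word μ.1)) = 0 := by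
      refine sum_ev_eq_zero_of_eventually c hε2 ?_
      filter_upwards [hdet] with x hx hx0
      have hx1 : (c.mat (w₀ + (x - w₀))).det ≠ 0 := by rwa [add_sub_cancel]
      let fx : analyticFunctions w₀ := ⟨_, analyticAt_detPow c (-(r : ℤ)) hx1⟩
      have h2 : η (δ fx) = 0 := hle ⟨fx, hx hx0 fx rfl, rfl⟩
      rw [hη2] at h2
      have h3 : ∀ μ, δ fx μ = ev (r : ℂ) (c.coords (c.mat x)⁻¹) (derivPoly c (word μ.1)) *
          (c.mat x).det ^ (-(r : ℤ)) := by
        intro μ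
        have := wordDeriv_detPow hε2 c (r : ℤ) (word μ.1) hx1
        rw [add_sub_cancel] at this
        exact_mod_cast this
      simp only [h3, ← mul_assoc, ← Finset.sum_mul] at h2
      exact (mul_eq_zero.1 h2).resolve_right (zpow_ne_zero _ hx0)
    have h2 := eq_zero_of_sum_ev_derivPoly c hε hr h1
    refine hη (LinearMap.ext fun v => ?_)
    rw [hη2]
    exact Finset.sum_eq_zero fun μ _ => by rw [congrFun h2 μ]; simp
  obtain ⟨g, hg, hgf⟩ := hspan.ge (Submodule.mem_top (x := δ f))
  have h3 := hker (f - g) (by rw [map_sub, hgf, sub_self])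
  rw [map_sub, LinearMap.mem_ker.1 hg, sub_zero] at h3
  exact h3

end Transfer

/-! ### The operator in coordinates -/

section CoreOperator

variable {ε : ℂ} {m : Type} [Fintype m] [DecidableEq m] {d : ℕ} (c : SymChart ε (m ⊕ m) d)

/-- The operator with symbol coefficients `opCoeff`, in linear coordinates. -/
def coreOp (κ : ℂ) (F : (Fin d → ℂ) → ℂ) (t : Fin d → ℂ) : ℂ :=
  ∑ μ, ev κ (fun p : m × m => (c.mat t).toBlocks₁₂ p.1 p.2) (opCoeff c μ) *
    wordDeriv (word μ.1) F t

theorem coreOp_congr {κ : ℂ} {F G : (Fin d → ℂ) → ℂ} {t : Fin d → ℂ} (h : F =ᶠ[𝓝 t] G) :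
    coreOp c κ F t = coreOp c κ G t :=
  Finset.sum_congr rfl fun _ _ => by rw [wordDeriv, (dirDeriv_congr _ h).eq_of_nhds]

theorem coreOp_const_mul {κ : ℂ} {F : (Fin d → ℂ) → ℂ} {t : Fin d → ℂ} (a : ℂ)
    (h : AnalyticAt ℂ F t) : coreOp c κ (fun s => a * F s) t = a * coreOp c κ F t := by
  rw [coreOp, coreOp, Finset.mul_sum]
  refine Finset.sum_congr rfl fun μ _ => ?_
  rw [wordDeriv, (dirDeriv_const_mul _ a h).eq_of_nhds]
  ring

theorem analyticAt_coreOp {κ : ℂ} {F : (Fin d → ℂ) → ℂ} {t : Fin d → ℂ}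
    (h : AnalyticAt ℂ F t) : AnalyticAt ℂ (coreOp c κ F) t := by
  refine Finset.analyticAt_fun_sum _ fun μ _ => AnalyticAt.mul ?_ (analyticAt_dirDeriv _ h)
  generalize opCoeff c μ = P
  induction P using MvPolynomial.induction_on with
  | C a => simpa using analyticAt_const
  | add p q hp hq =>
    simp only [map_add]
    exact hp.add hq
  | mul_X p i hp =>
    simp only [map_mul, ev_X]
    exact hp.mul (analyticAt_mat c _ _ t)

/-- The operator shifts the exponent of the test functions `det(S + R)^{-κ}`: this is the
property from which its coefficients are determined. -/
theorem coreOp_detPow (hε : ε * ε = 1) (κ : ℤ) {t ρ : Fin d → ℂ} (h : (c.mat (t + ρ)).det ≠ 0) :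
    coreOp c κ (fun s => (c.mat (s + ρ)).det ^ (-κ)) t =
      (symbolMatrix c (Fintype.card (m ⊕ m))).det.eval (κ : ℂ) *
        ((c.mat ρ).toBlocks₁₂.det * (c.mat (t + ρ)).det ^ (-κ - 1)) := by
  simp only [coreOp, wordDeriv_detPow hε c κ _ h, ← mul_assoc, ← Finset.sum_mul]
  rw [sum_opCoeff_mul, mat_coords_inv hε, mul_assoc, mul_assoc]
  have h1 := det_pencil_inv (c.mat t).toBlocks₁₂ (isUnit_iff_ne_zero.2 h)
  have h2 : (c.mat (t + ρ)).toBlocks₁₂ - (c.mat t).toBlocks₁₂ = (c.mat ρ).toBlocks₁₂ := by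
    rw [map_add]
    ext i j
    simp [Matrix.toBlocks₁₂]
  rw [h2] at h1
  rw [← h1, mul_assoc, ← zpow_one_add₀ h, add_sub_cancel]

/-- Covariance of the operator under a change of variables `ψ` with automorphy factor `J` can be
checked on the test functions `det(S + R)^{-κ}`. -/
theorem coreOp_comp (hε : ε = 1 ∨ ε = -1) {r : ℕ} (hr : Fintype.card m ≤ r)
    {ψ : (Fin d → ℂ) → (Fin d → ℂ)} {J : (Fin d → ℂ) → ℂ} {t₀ : Fin d → ℂ} {b : ℂ}
    (hψ : AnalyticAt ℂ ψ t₀) (hJ : AnalyticAt ℂ J t₀)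
    (h : ∀ᶠ x in 𝓝 (0 : Fin d → ℂ), (c.mat x).det ≠ 0 → ∃ (a : ℂ) (ρ : Fin d → ℂ),
      (c.mat (t₀ + ρ)).det ≠ 0 ∧
      ((fun t => J t * (c.mat (ψ t + (x - ψ t₀))).det ^ (-(r : ℤ))) =ᶠ[𝓝 t₀]
        fun t => a * (c.mat (t + ρ)).det ^ (-(r : ℤ))) ∧
      a * ((c.mat ρ).toBlocks₁₂.det * (c.mat (t₀ + ρ)).det ^ (-(r : ℤ) - 1)) =
        b * ((c.mat (x - ψ t₀)).toBlocks₁₂.det * (c.mat x).det ^ (-(r : ℤ) - 1)))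
    {f : (Fin d → ℂ) → ℂ} (hf : AnalyticAt ℂ f (ψ t₀)) :
    coreOp c r (fun t => J t * f (ψ t)) t₀ = b * coreOp c r f (ψ t₀) := by
  have hε2 : ε * ε = 1 := by rcases hε with rfl | rfl <;> norm_num
  let T : analyticFunctions (ψ t₀) →ₗ[ℂ] analyticFunctions t₀ :=
    { toFun := fun f => ⟨fun t => J t * f.1 (ψ t), hJ.mul (AnalyticAt.comp f.2 hψ)⟩
      map_add' := fun f g => Subtype.ext (funext fun t => mul_add _ _ _)
      map_smul' := fun a f => Subtype.ext (funext fun t => by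
        change J t * (a * _) = a * (J t * _)
        ring) }
  let Ω : ∀ t, analyticFunctions t →ₗ[ℂ] ℂ := fun t =>
    ∑ μ, ev (r : ℂ) (fun p : m × m => (c.mat t).toBlocks₁₂ p.1 p.2) (opCoeff c μ) •
      dirDerivAt t ((word μ.1).map fun k => Pi.single k 1)
  have hΩ : ∀ t f, Ω t f = coreOp c r f.1 t := by
    intro t f
    simp only [Ω, LinearMap.sum_apply, LinearMap.smul_apply, smul_eq_mul]
    rfl
  have hΩ0 : ∀ t (f : analyticFunctions t),
      (f.1 =O[𝓝 t] fun s => ‖s - t‖ ^ (Fintype.card (m ⊕ m) + 1)) → Ω t f = 0 := by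
    intro t f hf
    simp only [Ω, LinearMap.sum_apply, LinearMap.smul_apply, smul_eq_mul]
    refine Finset.sum_eq_zero fun μ _ => ?_
    have : dirDeriv ((word μ.1).map fun k => (Pi.single k 1 : Fin d → ℂ)) f.1 t = 0 :=
      dirDeriv_eq_zero_of_isBigO _ (by rw [List.length_map, length_word]; exact μ.2) f.2 hf
    change _ * dirDeriv _ _ _ = _
    rw [this, mul_zero]
  have key := eq_zero_of_detPow c hε (M := Fintype.card (m ⊕ m)) hr
    (Ω t₀ ∘ₗ T - b • Ω (ψ t₀)) ?_ ?_ ⟨f, hf⟩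
  · simp only [LinearMap.sub_apply, LinearMap.comp_apply, LinearMap.smul_apply, hΩ,
      smul_eq_mul] at key
    exact sub_eq_zero.1 key
  · intro f hf
    rw [LinearMap.sub_apply, LinearMap.comp_apply, LinearMap.smul_apply, hΩ0 _ f hf, smul_zero,
      sub_zero]
    refine hΩ0 _ _ ?_
    have h1 : (fun t => f.1 (ψ t)) =O[𝓝 t₀] fun t => ‖t - t₀‖ ^ (Fintype.card (m ⊕ m) + 1) :=
      (hf.comp_tendsto hψ.continuousAt).trans
        ((hψ.differentiableAt.isBigO_sub.norm_norm).pow _)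
    have h2 := (hJ.continuousAt.isBigO_one ℝ).mul h1
    simp only [one_mul] at h2
    exact h2
  · filter_upwards [h] with x hx hx0 f hf
    obtain ⟨a, ρ, hρ, he, hab⟩ := hx hx0
    have hx1 : (c.mat (ψ t₀ + (x - ψ t₀))).det ≠ 0 := by rwa [add_sub_cancel]
    rw [LinearMap.sub_apply, LinearMap.comp_apply, LinearMap.smul_apply, hΩ, hΩ, hf, smul_eq_mul,
      sub_eq_zero]
    have h3 : (T f).1 = fun t => J t * (c.mat (ψ t + (x - ψ t₀))).det ^ (-(r : ℤ)) := by
      change (fun t => J t * f.1 (ψ t)) = _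
      rw [hf]
    have h4 := coreOp_detPow c hε2 (r : ℤ) hρ
    have h5 := coreOp_detPow c hε2 (r : ℤ) hx1
    rw [Int.cast_natCast] at h4 h5
    rw [h3, coreOp_congr c he, coreOp_const_mul c _ (analyticAt_detPow c _ hρ), h4, h5,
      add_sub_cancel, mul_left_comm, hab]
    ring

/-- The value at the origin of the operator on `det S₁₂` is nonzero: it is a multiple of the Fischer
norm of a real polynomial whose transform is `det S₁₂`. -/
theorem coreOp_det_ne_zero (hε : ε = 1 ∨ ε = -1) {r : ℕ} (hr : Fintype.card m ≤ r)
    (hm : Even (Fintype.card m)) :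
    coreOp c r (fun t => (c.mat t).toBlocks₁₂.det) 0 ≠ 0 := by
  have hε2 : ε * ε = 1 := by rcases hε with rfl | rfl <;> norm_num
  have hεc : starRingEnd ℂ ε = ε := by rcases hε with rfl | rfl <;> simp
  set M := Fintype.card (m ⊕ m) with hM
  set q : (Fin d → ℂ) → ℂ := fun t => (c.mat t).toBlocks₁₂.det with hq
  set C₀ : ℂ := (symbolMatrix c M).det.eval (r : ℂ) with hC₀
  have hC : C₀ ≠ 0 := eval_det_symbolMatrix_ne_zero c hε hr
  set a : MultiIdx d M → ℂ := fun μ =>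
    ev (r : ℂ) (fun p : m × m => (c.mat 0).toBlocks₁₂ p.1 p.2) (opCoeff c μ) with ha
  have hsum : ∀ u, ∑ μ, a μ * ev (r : ℂ) u (derivPoly c (word μ.1)) = C₀ * q u := by
    intro u
    have h1 := sum_opCoeff_mul c (r : ℂ) (c.mat 0).toBlocks₁₂ u
    rw [h1, hC₀]
    congr 1
    have h2 : pencil (c.mat 0).toBlocks₁₂ (c.mat u) = Matrix.fromBlocks (1 : Matrix m m ℂ) 0
        (-(c.mat u).toBlocks₁₁) (-(c.mat u).toBlocks₁₂) := by
      rw [map_zero, pencil]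
      have h3 : (0 : Matrix (m ⊕ m) (m ⊕ m) ℂ).toBlocks₁₂ = 0 := rfl
      rw [h3]
      conv_lhs => rw [← Matrix.fromBlocks_toBlocks (c.mat u)]
      simp [Matrix.fromBlocks_multiply, Matrix.fromBlocks_add]
    rw [h2, Matrix.det_fromBlocks_zero₁₂, Matrix.det_one, one_mul, Matrix.det_neg, hm.neg_one_pow,
      one_mul]
  set p := wordSum c r fun μ : MultiIdx d M => a μ * (-1) ^ μ.1.degree with hp
  have hpT : ∀ u, transform c M p u = C₀ * q u := by
    intro u
    rw [hp, transform_wordSum c hε2, ← hsum]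
    refine Finset.sum_congr rfl fun μ _ => ?_
    have : ((-1 : ℂ) ^ μ.1.degree) * (-1) ^ μ.1.degree = 1 := by rw [← mul_pow]; simp
    linear_combination (a μ * ev (r : ℂ) u (derivPoly c (word μ.1))) * this
  have hsub : ∀ (p₁ p₂ : MvPolynomial (XY (m ⊕ m) r) ℂ) (b : ℂ) u,
      transform c M (p₁ - b • p₂) u = transform c M p₁ u - b * transform c M p₂ u := by
    intro p₁ p₂ b u
    simp only [transform, map_sub, map_smul, LinearMap.sub_apply, LinearMap.smul_apply, smul_eq_mul,
      mul_sub, Finset.sum_sub_distrib, Finset.mul_sum]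
    congr 1
    exact Finset.sum_congr rfl fun j _ => by ring
  have hpm : p ∈ wordSpan c r M := wordSum_mem c _
  -- the derivatives of `det S₁₂` at the origin pair `p` with a second combination of words
  have hpp : C₀ * coreOp c r q 0 = pair p (wordSum c r fun μ => a μ * ε ^ μ.1.degree) := by
    have h1 : (fun u => C₀ * q u) = transform c M p := (funext hpT).symm
    have hqa : AnalyticAt ℂ q 0 := analyticAt_det fun i j => analyticAt_mat c _ _ 0
    rw [← coreOp_const_mul c _ hqa, h1, coreOp, wordSum, map_sum]
    refine Finset.sum_congr rfl fun μ _ => ?_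
    rw [wordDeriv, dirDeriv_transform_zero c p _ (by rw [List.length_map, length_word]; exact μ.2),
      map_smul, smul_eq_mul, mul_assoc, List.map_map]
    congr 1
    have h2 : ∀ l : List (Fin d), (l.map ((fun a => quadY r (c.mat a)ᵀ) ∘
        fun k => (Pi.single k 1 : Fin d → ℂ))).prod = ε ^ l.length • quadWord c r l := by
      intro l
      induction l with
      | nil => simp [quadWord]
      | cons k l ih =>
        rw [List.map_cons, List.prod_cons, ih, Function.comp_apply, c.transpose_mat, map_smul,
          smul_mul_smul_comm, List.length_cons, pow_succ', quadWord, quadWord, List.map_cons,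
          List.prod_cons]
        rfl
    rw [h2, map_smul, length_word, smul_eq_mul]
  have hhom : ∀ (l : List (Fin d)) (u : Fin d → ℂ), l.length ≤ M →
      ev (r : ℂ) (-u) (derivPoly c l) = (-1) ^ l.length * ev (r : ℂ) u (derivPoly c l) := by
    intro l u hl
    have h1 := transform_quadWord (r := r) c hε2 hl u
    have h2 := transform_quadWord (r := r) c hε2 hl (-u)
    have h3 : transform c M (quadWord c r l) (-u) =
        (-1) ^ l.length * transform c M (quadWord c r l) u := by
      rw [transform, transform, Finset.mul_sum]
      refine Finset.sum_congr rfl fun j _ => ?_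
      rw [map_neg, Matrix.transpose_neg, map_neg, neg_pow, ← map_one C, ← map_neg, ← map_pow,
        ← smul_eq_C_mul, map_smul, smul_eq_mul, pair_quadWord_pow c hε2]
      split_ifs with h
      · rw [h]; ring
      · simp
    have h4 : ((-1 : ℂ) ^ l.length) * (-1) ^ l.length = 1 := by rw [← mul_pow]; simp
    rw [h1, h2] at h3
    linear_combination (-1) ^ l.length * h3 + (ev (r : ℂ) u (derivPoly c l) * (-1) ^ l.length -
      ev (r : ℂ) (-u) (derivPoly c l)) * h4
  -- the two combinations agree, since `det S₁₂` is invariant under `S ↦ -ε S`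
  have hp2 : wordSum c r (fun μ : MultiIdx d M => a μ * ε ^ μ.1.degree) = p := by
    rcases hε with rfl | rfl
    · rw [← sub_eq_zero]
      have h1 := hsub (wordSum c r fun μ : MultiIdx d M => a μ * 1 ^ μ.1.degree) p 1
      rw [one_smul] at h1
      refine eq_zero_of_transform_eq_zero c (Or.inl rfl) (sub_mem (wordSum_mem c _) hpm)
        fun u => ?_
      have h2 : q (-u) = q u := by
        have : (-c.mat u).toBlocks₁₂ = -(c.mat u).toBlocks₁₂ := rfl
        simp only [hq]
        rw [map_neg, this, Matrix.det_neg, hm.neg_one_pow, one_mul]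
      rw [h1, hpT, ← h2, ← hsum, transform_wordSum c hε2, one_mul, sub_eq_zero]
      refine Finset.sum_congr rfl fun μ _ => ?_
      rw [hhom _ u ((length_word _).trans_le μ.2), length_word]
      ring
    · rfl
  rw [hp2] at hpp
  -- up to a scalar `p` has real coefficients
  have hconj : conjP p = (starRingEnd ℂ C₀ * C₀⁻¹) • p := by
    rw [← sub_eq_zero]
    refine eq_zero_of_transform_eq_zero c hε (sub_mem (conjP_mem_wordSpan c hεc hpm)
      (Submodule.smul_mem _ _ hpm)) fun u => ?_
    have h1 : transform c M (conjP p) u = starRingEnd ℂ C₀ * q u := by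
      have hu : c.mat (c.coords ((c.mat u).map (starRingEnd ℂ))) = (c.mat u).map (starRingEnd ℂ) := by
        refine c.mat_coords _ ?_
        rw [← Matrix.transpose_map, c.transpose_mat]
        ext i j
        simp [hεc]
      have h2 : ((c.mat u).map (starRingEnd ℂ)).map (starRingEnd ℂ) = c.mat u := by
        ext i j
        simp
      have h3 := hpT (c.coords ((c.mat u).map (starRingEnd ℂ)))
      have h4 : transform c M (conjP p) u = starRingEnd ℂ
          (transform c M p (c.coords ((c.mat u).map (starRingEnd ℂ)))) := by
        simp only [transform, map_sum, map_mul, map_inv₀, map_natCast]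
        refine Finset.sum_congr rfl fun j _ => ?_
        rw [← pair_conj, map_pow conjP, conjP_quadY, hu, Matrix.transpose_map, h2]
      have h5 : q (c.coords ((c.mat u).map (starRingEnd ℂ))) = starRingEnd ℂ (q u) := by
        simp only [hq]
        rw [hu, RingHom.map_det]
        rfl
      rw [h4, h3, map_mul, h5, Complex.conj_conj]
    rw [hsub, h1, hpT]
    field_simp
    ring
  intro h0
  rw [h0, mul_zero] at hpp
  have hp0 : p = 0 := by
    refine eq_zero_of_pair_conj_eq_zero ?_
    rw [hconj, map_smul, ← hpp, smul_zero]
  -- `det S₁₂ = 1` at `S = [0, 1; ε, 0]`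
  have hT : (Matrix.fromBlocks 0 1 (ε • (1 : Matrix m m ℂ)) 0)ᵀ =
      ε • Matrix.fromBlocks 0 1 (ε • (1 : Matrix m m ℂ)) 0 := by
    simp [Matrix.fromBlocks_transpose, Matrix.fromBlocks_smul, smul_smul, hε2]
  have h1 := hpT (c.coords (Matrix.fromBlocks 0 1 (ε • (1 : Matrix m m ℂ)) 0))
  simp only [hq] at h1
  rw [c.mat_coords _ hT, Matrix.toBlocks_fromBlocks₁₂, Matrix.det_one, mul_one, hp0] at h1
  refine hC (h1.symm.trans ?_)
  simp [transform]

end CoreOperator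

/-! ### The image of the determinant of the off-diagonal block -/

section Constant

variable {ε : ℂ} {m : Type} [Fintype m] [DecidableEq m] {d : ℕ} (c : SymChart ε (m ⊕ m) d)

/-- By covariance under homotheties the image of `det S₁₂` is homogeneous of degree zero, hence
constant. -/
theorem coreOp_det_eq (hε : ε = 1 ∨ ε = -1) {r : ℕ} (hr : Fintype.card m ≤ r) (t₀ : Fin d → ℂ) :
    coreOp c r (fun t => (c.mat t).toBlocks₁₂.det) t₀ =
      coreOp c r (fun t => (c.mat t).toBlocks₁₂.det) 0 := by
  set q : (Fin d → ℂ) → ℂ := fun t => (c.mat t).toBlocks₁₂.det with hq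
  have hqa : ∀ t, AnalyticAt ℂ q t := fun t => analyticAt_det fun i j => analyticAt_mat c _ _ t
  have hsm : ∀ (σ : ℂ) t, q (σ • t) = σ ^ Fintype.card m * q t := by
    intro σ t
    have h1 : (σ • c.mat t).toBlocks₁₂ = σ • (c.mat t).toBlocks₁₂ := rfl
    simp only [hq]
    rw [map_smul, h1, Matrix.det_smul]
  have hdet : ∀ (σ : ℂ) t, (c.mat (σ • t)).det = σ ^ Fintype.card (m ⊕ m) * (c.mat t).det := by
    intro σ t
    rw [map_smul, Matrix.det_smul]
  have hconst : ∀ σ : ℂ, σ ≠ 0 → coreOp c r q (σ • t₀) = coreOp c r q t₀ := by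
    intro σ hσ
    have h1 := coreOp_comp c hε hr (ψ := fun t => σ • t) (J := fun _ => 1) (t₀ := t₀)
      (b := σ ^ Fintype.card m) ((analyticAt_const (v := σ)).fun_smul analyticAt_id) analyticAt_const
      (Eventually.of_forall fun x hx => ?_) (hqa _)
    · simp only [one_mul, hsm] at h1
      rw [coreOp_const_mul c _ (hqa _)] at h1
      exact (mul_left_cancel₀ (pow_ne_zero _ hσ) h1).symm
    · refine ⟨(σ ^ Fintype.card (m ⊕ m)) ^ (-(r : ℤ)), σ⁻¹ • (x - σ • t₀), ?_, ?_, ?_⟩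
      · rw [smul_sub, inv_smul_smul₀ hσ, add_sub_cancel, hdet]
        exact mul_ne_zero (pow_ne_zero _ (inv_ne_zero hσ)) hx
      · refine Eventually.of_forall fun t => ?_
        have h2 : σ • t + (x - σ • t₀) = σ • (t + σ⁻¹ • (x - σ • t₀)) := by
          rw [smul_add, smul_inv_smul₀ hσ]
        simp only []
        rw [one_mul, h2, hdet, mul_zpow]
      · have h2 : t₀ + σ⁻¹ • (x - σ • t₀) = σ⁻¹ • x := by
          rw [smul_sub, inv_smul_smul₀ hσ, add_sub_cancel]
        have h3 : (c.mat (σ⁻¹ • (x - σ • t₀))).toBlocks₁₂.det =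
            σ⁻¹ ^ Fintype.card m * (c.mat (x - σ • t₀)).toBlocks₁₂.det := hsm _ _
        have h4 : Fintype.card (m ⊕ m) = Fintype.card m + Fintype.card m := Fintype.card_sum
        simp only [h2, h3, hdet, mul_zpow, h4, pow_add, inv_pow]
        have h5 : σ ^ Fintype.card m ≠ 0 := pow_ne_zero _ hσ
        generalize σ ^ Fintype.card m = s at h5
        have h6 : s ^ (-(r : ℤ)) * s ^ (-(r : ℤ)) *
            (s⁻¹ * (s⁻¹ ^ (-(r : ℤ) - 1) * s⁻¹ ^ (-(r : ℤ) - 1))) = s := by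
          rw [inv_zpow', neg_sub, sub_neg_eq_add, zpow_one_add₀ h5, zpow_neg]
          field_simp
        linear_combination ((c.mat (x - σ • t₀)).toBlocks₁₂.det *
          (c.mat x).det ^ (-(r : ℤ) - 1)) * h6
  -- let `σ → 0`
  have h1 : Tendsto (fun σ : ℂ => coreOp c r q (σ • t₀)) (𝓝[≠] 0) (𝓝 (coreOp c r q 0)) := by
    have h2 : Tendsto (fun σ : ℂ => σ • t₀) (𝓝 0) (𝓝 ((0 : ℂ) • t₀)) :=
      tendsto_id.smul tendsto_const_nhds
    rw [zero_smul] at h2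
    exact ((analyticAt_coreOp c (hqa 0)).continuousAt.tendsto.comp h2).mono_left nhdsWithin_le_nhds
  refine tendsto_nhds_unique (tendsto_const_nhds.congr' ?_) h1
  filter_upwards [self_mem_nhdsWithin] with σ hσ
  exact (hconst σ hσ).symm

end Constant

/-! ### A basis of the symmetric matrices -/

section Chart

/-- The space of matrices with `Sᵀ = ε S`. -/
def symSubmodule (ε : ℂ) (K : Type) : Submodule ℂ (Matrix K K ℂ) where
  carrier := {S | Sᵀ = ε • S}
  add_mem' {S T} hS hT := by
    change (S + T)ᵀ = ε • (S + T)
    rw [Matrix.transpose_add, smul_add, hS, hT]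
  zero_mem' := by
    change (0 : Matrix K K ℂ)ᵀ = ε • 0
    simp
  smul_mem' a S hS := by
    change (a • S)ᵀ = ε • a • S
    rw [Matrix.transpose_smul, hS, smul_comm]

variable {ε : ℂ} {K : Type} [Fintype K]

/-- Coordinates with respect to a basis of the space of `ε`-symmetric matrices, extended to all
matrices through the projection `S ↦ (S + ε Sᵀ) / 2`. -/
def symChart (hε : ε * ε = 1) : SymChart ε K (Module.finrank ℂ (symSubmodule ε K)) where
  mat := (symSubmodule ε K).subtype ∘ₗ
    (Module.finBasis ℂ (symSubmodule ε K)).equivFun.symm.toLinearMap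
  coords := (Module.finBasis ℂ (symSubmodule ε K)).equivFun.toLinearMap ∘ₗ
    LinearMap.codRestrict (symSubmodule ε K)
      ((2⁻¹ : ℂ) • (LinearMap.id + ε • (Matrix.transposeLinearEquiv K K ℂ ℂ).toLinearMap)) (by
        intro S
        change _ᵀ = ε • _
        simp [smul_smul, mul_comm ε, mul_assoc, hε, add_comm])
  transpose_mat t := ((Module.finBasis ℂ (symSubmodule ε K)).equivFun.symm t).2
  coords_mat t := by
    rw [LinearMap.comp_apply]
    refine (LinearEquiv.eq_symm_apply _).1 (Subtype.ext ?_)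
    set S := (Module.finBasis ℂ (symSubmodule ε K)).equivFun.symm t with hS
    have h : (S : Matrix K K ℂ)ᵀ = ε • (S : Matrix K K ℂ) := S.2
    change (2⁻¹ : ℂ) • ((S : Matrix K K ℂ) + ε • (S : Matrix K K ℂ)ᵀ) = S
    rw [h, smul_smul, hε, one_smul, ← two_smul ℂ, smul_smul]
    norm_num
  mat_coords S hS := by
    simp only [LinearMap.comp_apply, LinearEquiv.coe_coe, LinearEquiv.symm_apply_apply]
    change (2⁻¹ : ℂ) • (S + ε • Sᵀ) = S
    rw [hS, smul_smul, hε, one_smul, ← two_smul ℂ, smul_smul]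
    norm_num

end Chart

/-! ### Quaternionic matrices -/

section Split

variable {c : QCase} {ι : Type}

theorem split_smul (s : ℂ) (X : Matrix ι ι (BC c)) : split (s • X) = s • split X := by
  ext ⟨i, k⟩ ⟨j, l⟩
  fin_cases k <;> fin_cases l <;> simp [split, splitEntry] <;> ring

section

variable [DecidableEq ι]

theorem Jdiag_eq : Jdiag ι = Matrix.kroneckerMap (· * ·) (1 : Matrix ι ι ℂ) !![0, -1; 1, 0] := by
  ext ⟨i, k⟩ ⟨j, l⟩
  by_cases h : i = j <;> simp [Jdiag, h]

theorem transpose_Jdiag : (Jdiag ι)ᵀ = -Jdiag ι := by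
  ext ⟨i, k⟩ ⟨j, l⟩
  by_cases h : i = j
  · subst h
    fin_cases k <;> fin_cases l <;> simp [Jdiag]
  · simp [Jdiag, h, Ne.symm h]

end

variable [Fintype ι] [DecidableEq ι]

theorem rootEps_mul_self (c : QCase) : c.rootEps * c.rootEps = (c.eps : ℂ) := by
  cases c <;> simp [QCase.rootEps, QCase.eps]

theorem rootEps_ne_zero (c : QCase) : c.rootEps ≠ 0 := by
  cases c <;> simp [QCase.rootEps]

theorem eps_mul_self (c : QCase) : (c.eps : ℂ) * (c.eps : ℂ) = 1 := by
  cases c <;> simp [QCase.eps]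

theorem eps_eq (c : QCase) : (c.eps : ℂ) = 1 ∨ (c.eps : ℂ) = -1 := by
  cases c <;> simp [QCase.eps]

theorem splitEntry_mul (x y : BC c) : splitEntry (x * y) = splitEntry x * splitEntry y := by
  have h := rootEps_mul_self c
  ext i j
  fin_cases i <;> fin_cases j <;>
    simp [splitEntry, Matrix.mul_apply, Fin.sum_univ_two, ← h] <;> ring

/-- `split` as an isomorphism of rings. -/
def splitEquiv (c : QCase) (ι : Type) [Fintype ι] [DecidableEq ι] :
    Matrix ι ι (BC c) ≃+* Matrix (ι × Fin 2) (ι × Fin 2) ℂ where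
  toFun := split
  invFun M := Matrix.of fun i j =>
    ⟨(M (i, 0) (j, 0) + M (i, 1) (j, 1)) / 2, (M (i, 0) (j, 0) - M (i, 1) (j, 1)) / (2 * c.rootEps),
      (M (i, 0) (j, 1) - M (i, 1) (j, 0)) / 2, (M (i, 0) (j, 1) + M (i, 1) (j, 0)) / (2 * c.rootEps)⟩
  left_inv X := by
    have h := rootEps_ne_zero c
    ext i j <;> simp [split, splitEntry] <;> field_simp <;> ring
  right_inv M := by
    have h := rootEps_ne_zero c
    ext ⟨i, k⟩ ⟨j, l⟩
    fin_cases k <;> fin_cases l <;> simp [split, splitEntry] <;> field_simp <;> ring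
  map_mul' X Y := by
    ext ⟨i, k⟩ ⟨j, l⟩
    have h1 : splitEntry ((X * Y) i j) = ∑ a, splitEntry (X i a) * splitEntry (Y a j) := by
      simp only [← splitEntry_mul, Matrix.mul_apply]
      let φ : BC c →+ Matrix (Fin 2) (Fin 2) ℂ :=
        AddMonoidHom.mk' splitEntry fun x y => by
          ext i j
          fin_cases i <;> fin_cases j <;> simp [splitEntry] <;> ring
      exact map_sum φ _ _
    change splitEntry ((X * Y) i j) k l = _
    rw [h1]
    simp only [split, Matrix.of_apply, Matrix.mul_apply, Matrix.sum_apply, Fintype.sum_prod_type]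
  map_add' X Y := by
    ext ⟨i, k⟩ ⟨j, l⟩
    fin_cases k <;> fin_cases l <;> simp [split, splitEntry] <;> ring

theorem split_mul (X Y : Matrix ι ι (BC c)) : split (X * Y) = split X * split Y :=
  map_mul (splitEquiv c ι) X Y

theorem split_add (X Y : Matrix ι ι (BC c)) : split (X + Y) = split X + split Y :=
  map_add (splitEquiv c ι) X Y

theorem split_one : split (1 : Matrix ι ι (BC c)) = 1 := map_one (splitEquiv c ι)

theorem nrd_mul (X Y : Matrix ι ι (BC c)) : nrd (X * Y) = nrd X * nrd Y := by
  rw [nrd, split_mul, Matrix.det_mul, nrd, nrd]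

theorem nrd_one : nrd (1 : Matrix ι ι (BC c)) = 1 := by rw [nrd, split_one, Matrix.det_one]

theorem isUnit_iff_nrd_ne_zero {X : Matrix ι ι (BC c)} : IsUnit X ↔ nrd X ≠ 0 := by
  rw [← MulEquiv.isUnit_map (splitEquiv c ι), Matrix.isUnit_iff_isUnit_det, isUnit_iff_ne_zero]
  rfl

theorem mul_eq_one_comm_of_BC {X Y : Matrix ι ι (BC c)} (h : X * Y = 1) : Y * X = 1 := by
  apply (splitEquiv c ι).injective
  rw [map_mul, map_one]
  refine mul_eq_one_comm.1 ?_
  rw [← map_mul, h, map_one]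

theorem det_Jdiag : (Jdiag ι).det = 1 := by
  rw [Jdiag_eq, Matrix.det_kronecker]
  simp

theorem Jdiag_mul_self : Jdiag ι * Jdiag ι = -1 := by
  have h : (!![0, -1; 1, 0] : Matrix (Fin 2) (Fin 2) ℂ) * !![0, -1; 1, 0] = (-1 : ℂ) • 1 := by
    ext i j
    fin_cases i <;> fin_cases j <;> simp
  rw [Jdiag_eq, ← Matrix.mul_kronecker_mul, mul_one, h, Matrix.kronecker_smul,
    Matrix.one_kronecker_one, neg_smul, one_smul]

/-- The main involution on `M₂(ℂ)` is `x ↦ J xᵀ J⁻¹`. -/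
theorem split_conjTranspose_mul (X : Matrix ι ι (BC c)) :
    split Xᴴ * Jdiag ι = Jdiag ι * (split X)ᵀ := by
  ext ⟨i, k⟩ ⟨j, l⟩
  simp only [Matrix.mul_apply, Fintype.sum_prod_type, Fin.sum_univ_two]
  fin_cases k <;> fin_cases l <;> simp [split, splitEntry, Jdiag] <;> ring

theorem nrd_conjTranspose (X : Matrix ι ι (BC c)) : nrd Xᴴ = nrd X := by
  have := congrArg Matrix.det (split_conjTranspose_mul X)
  rwa [Matrix.det_mul, Matrix.det_mul, det_Jdiag, mul_one, one_mul, Matrix.det_transpose] at this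

theorem posDef_iff_of_Jdiag (Y : Matrix (ι × Fin 2) (ι × Fin 2) ℂ) :
    (Y * Jdiag ι).PosDef ↔ (Jdiag ι * Y).PosDef := by
  have hu : IsUnit (Jdiag ι) :=
    (Matrix.isUnit_iff_isUnit_det _).2 (by rw [det_Jdiag]; exact isUnit_one)
  have hs : star (Jdiag ι) = -Jdiag ι := by
    rw [← transpose_Jdiag]
    ext ⟨i, k⟩ ⟨j, l⟩
    by_cases h : j = i
    · subst h
      fin_cases k <;> fin_cases l <;> simp [Jdiag, Matrix.star_apply]
    · simp [Jdiag, h, Matrix.star_apply]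
  have h := Matrix.IsUnit.posDef_star_left_conjugate_iff (x := Jdiag ι * Y) hu
  rwa [hs, ← mul_assoc, neg_mul, Jdiag_mul_self, neg_neg, one_mul] at h

end Split

/-! ### The action on the upper half space -/

section Conj

variable {q : QCase} {ι : Type}

/-- Complex conjugation of a matrix over `𝔹 ⊗ ℂ` with respect to the real form `𝔹_∞`. -/
def conjM (X : Matrix ι ι (BC q)) : Matrix ι ι (BC q) := X.map fun x =>
  ⟨starRingEnd ℂ x.re, starRingEnd ℂ x.imI, starRingEnd ℂ x.imJ, starRingEnd ℂ x.imK⟩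

theorem conjM_map_toBC (X : Matrix ι ι (BR q)) : conjM (X.map toBC) = X.map toBC := by
  ext i j <;> simp [conjM, toBC]

theorem conjM_mem_hermC {Z : Matrix ι ι (BC q)} (hZ : Z ∈ hermC q ι) : conjM Z ∈ hermC q ι := by
  have h : Zᴴ = -((q.eps : ℂ) • Z) := hZ
  change (conjM Z)ᴴ = -((q.eps : ℂ) • conjM Z)
  ext i j
  · have := congrArg (fun M : Matrix ι ι (BC q) => starRingEnd ℂ (M i j).re) h
    simpa [conjM] using this
  · have := congrArg (fun M : Matrix ι ι (BC q) => starRingEnd ℂ (M i j).imI) h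
    simpa [conjM] using this
  · have := congrArg (fun M : Matrix ι ι (BC q) => starRingEnd ℂ (M i j).imJ) h
    simpa [conjM] using this
  · have := congrArg (fun M : Matrix ι ι (BC q) => starRingEnd ℂ (M i j).imK) h
    simpa [conjM] using this

theorem sub_conjM (Z : Matrix ι ι (BC q)) :
    Z - conjM Z = (2 * Complex.I) • (Z.map imPart).map toBC := by
  have h : ∀ z : ℂ, z - starRingEnd ℂ z = 2 * Complex.I * (z.im : ℂ) := by
    intro z
    rw [Complex.sub_conj]
    push_cast
    ring
  ext i j <;> simp [conjM, toBC, imPart, h]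

variable [Fintype ι] [DecidableEq ι]

/-- The matrix `h` with `split (X̄^*) = h⁻¹ (split X)^† h`. -/
def hMat : QCase → (ι : Type) → [DecidableEq ι] → Matrix (ι × Fin 2) (ι × Fin 2) ℂ
  | .I, _, _ => 1
  | .II, ι, _ => Jdiag ι

theorem hMat_mul_split (X : Matrix ι ι (BC q)) :
    hMat q ι * split (conjM X)ᴴ = (split X)ᴴ * hMat q ι := by
  cases q
  · simp only [hMat, one_mul, mul_one]
    ext ⟨i, k⟩ ⟨j, l⟩
    fin_cases k <;> fin_cases l <;> simp [split, splitEntry, conjM, QCase.rootEps]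
  · simp only [hMat]
    ext ⟨i, k⟩ ⟨j, l⟩
    simp only [Matrix.mul_apply, Fintype.sum_prod_type, Fin.sum_univ_two]
    fin_cases k <;> fin_cases l <;>
      simp [split, splitEntry, Jdiag, conjM, QCase.rootEps] <;> ring

/-- The hermitian form on `ℂ^{2m}` attached to a point of `S(ℝ) ⊗ ℂ`. -/
def imForm (Z : Matrix ι ι (BC q)) : Matrix (ι × Fin 2) (ι × Fin 2) ℂ :=
  hMat q ι * split ((Z.map imPart).map toBC)

theorem isPosDef_iff (Z : Matrix ι ι (BC q)) : IsPosDef (Z.map imPart) ↔ (imForm Z).PosDef := by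
  cases q
  · simp [IsPosDef, imForm, hMat]
  · exact posDef_iff_of_Jdiag _

theorem two_I_smul_imForm {Z : Matrix ι ι (BC q)} (hZ : Z ∈ hermC q ι) :
    (2 * Complex.I) • imForm Z =
      hMat q ι * split Z + (q.eps : ℂ) • ((split Z)ᴴ * hMat q ι) := by
  have h1 : conjM Z = -((q.eps : ℂ) • (conjM Z)ᴴ) := by
    rw [show (conjM Z)ᴴ = _ from conjM_mem_hermC hZ, smul_neg, neg_neg, smul_smul, eps_mul_self,
      one_smul]
  rw [imForm, ← Matrix.mul_smul, ← split_smul, ← sub_conjM, ← hMat_mul_split, ← Matrix.mul_smul,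
    ← mul_add, ← split_smul, ← split_add]
  conv_lhs => rw [h1, sub_neg_eq_add]

end Conj

section Group

variable {q : QCase} {ι : Type} [Fintype ι] [DecidableEq ι]

/-- The block form of the relation `g K g^* = K` for a real matrix `g = [a, b; c, d]`. -/
structure IsIsometry (a b c d : Matrix ι ι (BC q)) : Prop where
  conj_a : conjM a = a
  conj_b : conjM b = b
  conj_c : conjM c = c
  conj_d : conjM d = d
  ba : b * aᴴ + (q.eps : ℂ) • (a * bᴴ) = 0
  bc : b * cᴴ + (q.eps : ℂ) • (a * dᴴ) = (q.eps : ℂ) • 1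
  da : d * aᴴ + (q.eps : ℂ) • (c * bᴴ) = 1
  dc : d * cᴴ + (q.eps : ℂ) • (c * dᴴ) = 0

namespace IsIsometry

variable {a b c d Z R : Matrix ι ι (BC q)}

theorem left_inv (h : IsIsometry a b c d) :
    Matrix.fromBlocks dᴴ ((q.eps : ℂ) • bᴴ) ((q.eps : ℂ) • cᴴ) aᴴ *
      Matrix.fromBlocks a b c d = 1 := by
  apply mul_eq_one_comm_of_BC
  have hε := eps_mul_self q
  have h1 : a * dᴴ + (q.eps : ℂ) • (b * cᴴ) = 1 := by
    have := congrArg (fun X => (q.eps : ℂ) • X) h.bc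
    simp only [smul_add, smul_smul, hε, one_smul] at this
    rw [add_comm]
    exact this
  have h2 : (q.eps : ℂ) • (a * bᴴ) + b * aᴴ = 0 := by rw [add_comm]; exact h.ba
  have h3 : c * dᴴ + (q.eps : ℂ) • (d * cᴴ) = 0 := by
    have := congrArg (fun X => (q.eps : ℂ) • X) h.dc
    simp only [smul_add, smul_smul, hε, one_smul, smul_zero] at this
    rw [add_comm]
    exact this
  have h4 : (q.eps : ℂ) • (c * bᴴ) + d * aᴴ = 1 := by rw [add_comm]; exact h.da
  simp only [Matrix.fromBlocks_multiply, Matrix.mul_smul, h1, h2, h3, h4, Matrix.fromBlocks_one]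

theorem left_relations (h : IsIsometry a b c d) :
    dᴴ * a + (q.eps : ℂ) • (bᴴ * c) = 1 ∧ dᴴ * b + (q.eps : ℂ) • (bᴴ * d) = 0 ∧
      (q.eps : ℂ) • (cᴴ * a) + aᴴ * c = 0 ∧ (q.eps : ℂ) • (cᴴ * b) + aᴴ * d = 1 := by
  have := h.left_inv
  rw [Matrix.fromBlocks_multiply, ← Matrix.fromBlocks_one, Matrix.fromBlocks_inj] at this
  simpa only [Matrix.smul_mul] using this

theorem pairing (h : IsIsometry a b c d) (W Z : Matrix ι ι (BC q)) :
    (a * W + b)ᴴ * (c * Z + d) + (q.eps : ℂ) • ((c * W + d)ᴴ * (a * Z + b)) =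
      Wᴴ + (q.eps : ℂ) • Z := by
  obtain ⟨h1, h2, h3, h4⟩ := h.left_relations
  have hε := eps_mul_self q
  calc _ = Wᴴ * ((q.eps : ℂ) • (cᴴ * a) + aᴴ * c) * Z +
        Wᴴ * ((q.eps : ℂ) • (cᴴ * b) + aᴴ * d) +
        (q.eps : ℂ) • ((dᴴ * a + (q.eps : ℂ) • (bᴴ * c)) * Z) +
        (q.eps : ℂ) • (dᴴ * b + (q.eps : ℂ) • (bᴴ * d)) := by
        simp only [Matrix.conjTranspose_add, Matrix.conjTranspose_mul, mul_add, add_mul,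
          smul_mul_assoc, mul_smul_comm, smul_add, smul_smul, hε, one_smul, mul_assoc]
        abel
    _ = _ := by rw [h1, h2, h3, h4]; simp

theorem conjTranspose_mul_eq (h : IsIsometry a b c d) (hZ : Z ∈ hermC q ι) :
    (a * Z + b)ᴴ * (c * Z + d) = -((q.eps : ℂ) • ((c * Z + d)ᴴ * (a * Z + b))) := by
  have h1 := h.pairing Z Z
  rw [show Zᴴ = _ from hZ, neg_add_cancel] at h1
  exact eq_neg_of_add_eq_zero_left h1

/-- The image of a point of `S(ℝ) ⊗ ℂ` lies in `S(ℝ) ⊗ ℂ` where it is defined. -/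
theorem mem_hermC (h : IsIsometry a b c d) (hZ : Z ∈ hermC q ι) {W : Matrix ι ι (BC q)}
    (hu : IsUnit (c * Z + d)) (hW : W * (c * Z + d) = a * Z + b) : W ∈ hermC q ι := by
  have h1 := h.conjTranspose_mul_eq hZ
  rw [← hW, Matrix.conjTranspose_mul, ← mul_assoc, mul_assoc, mul_assoc, ← mul_assoc _ W,
    ← smul_mul_assoc, ← neg_mul, ← mul_assoc] at h1
  have h2 := hu.mul_right_cancel h1
  rw [← mul_smul_comm, ← mul_neg] at h2
  exact hu.star.mul_left_cancel h2

/-- The relation between the imaginary parts of `Z` and of its image. -/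
theorem imForm_pairing (h : IsIsometry a b c d) (hZ : Z ∈ hermC q ι) :
    (split (a * Z + b))ᴴ * hMat q ι * split (c * Z + d) +
      (q.eps : ℂ) • ((split (c * Z + d))ᴴ * hMat q ι * split (a * Z + b)) =
      (q.eps : ℂ) • (2 * Complex.I) • imForm Z := by
  have hconj : ∀ {x y : Matrix ι ι (BC q)}, conjM x = x → conjM y = y →
      hMat q ι * split (x * conjM Z + y)ᴴ = (split (x * Z + y))ᴴ * hMat q ι := by
    intro x y hx hy
    rw [Matrix.conjTranspose_add, Matrix.conjTranspose_mul, split_add, split_mul, mul_add,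
      ← mul_assoc, hMat_mul_split, mul_assoc, split_add, split_mul, Matrix.conjTranspose_add,
      Matrix.conjTranspose_mul, add_mul]
    have h1 := hMat_mul_split x
    have h2 := hMat_mul_split y
    rw [hx] at h1
    rw [hy] at h2
    rw [h1, h2, mul_assoc]
  have ha := hconj h.conj_a h.conj_b
  have hc := hconj h.conj_c h.conj_d
  have h1 := h.pairing (conjM Z) Z
  generalize (a * conjM Z + b)ᴴ = A at h1 ha
  generalize (c * conjM Z + d)ᴴ = B at h1 hc
  generalize a * Z + b = P at h1 ha ⊢
  generalize c * Z + d = Q at h1 hc ⊢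
  have h2 := congrArg (fun X => hMat q ι * split X) h1
  simp only [split_add, split_smul, split_mul, mul_add, Matrix.mul_smul, ← mul_assoc, ha, hc,
    hMat_mul_split] at h2
  rw [h2, two_I_smul_imForm hZ, smul_add, smul_smul, eps_mul_self, one_smul, add_comm]

theorem isUnit_mu (h : IsIsometry a b c d) (hZ : Z ∈ upperHalf q ι) : IsUnit (c * Z + d) := by
  rw [isUnit_iff_nrd_ne_zero]
  intro h0
  obtain ⟨v, hv, hv0⟩ := Matrix.exists_mulVec_eq_zero_iff.2 h0
  have h1 := h.imForm_pairing hZ.1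
  have h2 := congrArg (fun M => star v ⬝ᵥ (M *ᵥ v)) h1
  have h3 : star v ᵥ* (split (c * Z + d))ᴴ = 0 := by
    rw [← Matrix.star_mulVec, hv0, star_zero]
  have h4 : star v ⬝ᵥ (imForm Z *ᵥ v) = 0 := by
    simp only [Matrix.add_mulVec, Matrix.smul_mulVec, ← Matrix.mulVec_mulVec, hv0,
      Matrix.mulVec_zero, zero_add, dotProduct_smul] at h2
    rw [Matrix.dotProduct_mulVec _ (split (c * Z + d))ᴴ, h3, zero_dotProduct, smul_zero, eq_comm,
      smul_eq_zero, smul_eq_zero] at h2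
    refine (h2.resolve_left fun h5 => ?_).resolve_left (by simp)
    have := eps_mul_self q
    rw [h5, zero_mul] at this
    exact zero_ne_one this
  exact (((isPosDef_iff Z).1 hZ.2).dotProduct_mulVec_pos hv).ne' h4

theorem mem_upperHalf (h : IsIsometry a b c d) (hZ : Z ∈ upperHalf q ι) {W : Matrix ι ι (BC q)}
    (hW : W * (c * Z + d) = a * Z + b) : W ∈ upperHalf q ι := by
  have hu := h.isUnit_mu hZ
  have hWh := h.mem_hermC hZ.1 hu hW
  refine ⟨hWh, (isPosDef_iff W).2 ?_⟩
  have h1 := h.imForm_pairing hZ.1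
  have h2 := two_I_smul_imForm hWh
  have hQ : IsUnit (split (c * Z + d)) := hu.map (splitEquiv q ι)
  rw [← Matrix.IsUnit.posDef_star_left_conjugate_iff hQ]
  have h3 : star (split (c * Z + d)) * imForm W * split (c * Z + d) = imForm Z := by
    have h4 : (2 * Complex.I) • (star (split (c * Z + d)) * imForm W * split (c * Z + d)) =
        (2 * Complex.I) • imForm Z := by
      have h5 := congrArg (fun X => (q.eps : ℂ) • X) h1
      simp only [smul_add, smul_smul, eps_mul_self, one_smul] at h5
      rw [← mul_assoc, eps_mul_self, one_mul] at h5
      rw [← h5, ← hW, split_mul, ← smul_mul_assoc, ← mul_smul_comm, h2, Matrix.star_eq_conjTranspose,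
        Matrix.conjTranspose_mul]
      simp only [mul_add, add_mul, mul_smul_comm, smul_mul_assoc, mul_assoc]
      rw [add_comm]
    exact smul_right_injective _ (by simp) h4
  rw [h3]
  exact (isPosDef_iff Z).1 hZ.2

/-- The translates `gZ + R` by points of `S(ℝ) ⊗ ℂ`: with `(a + Rc) R' = b + Rd` one has
`(gZ + R)(cZ + d) = (a + Rc)(Z + R')`. -/
theorem add_mul_mu {R' W : Matrix ι ι (BC q)} (hW : W * (c * Z + d) = a * Z + b)
    (hR : (a + R * c) * R' = b + R * d) :
    (W + R) * (c * Z + d) = (a + R * c) * (Z + R') := by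
  rw [add_mul, hW, mul_add (a + R * c), hR]
  simp only [mul_add, add_mul, mul_assoc]
  abel

theorem right_pairing (h : IsIsometry a b c d) (R : Matrix ι ι (BC q)) :
    (b + R * d) * (a + R * c)ᴴ + (q.eps : ℂ) • ((a + R * c) * (b + R * d)ᴴ) =
      R + (q.eps : ℂ) • Rᴴ := by
  calc _ = (b * aᴴ + (q.eps : ℂ) • (a * bᴴ)) + R * (d * aᴴ + (q.eps : ℂ) • (c * bᴴ)) +
        (b * cᴴ + (q.eps : ℂ) • (a * dᴴ)) * Rᴴ +
        R * (d * cᴴ + (q.eps : ℂ) • (c * dᴴ)) * Rᴴ := by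
        simp only [Matrix.conjTranspose_add, Matrix.conjTranspose_mul, mul_add, add_mul,
          smul_mul_assoc, mul_smul_comm, smul_add, mul_assoc]
        abel
    _ = _ := by rw [h.ba, h.da, h.bc, h.dc]; simp

theorem right_mem_hermC (h : IsIsometry a b c d) (hR : R ∈ hermC q ι) (hu : IsUnit (a + R * c))
    {R' : Matrix ι ι (BC q)} (hR' : (a + R * c) * R' = b + R * d) : R' ∈ hermC q ι := by
  have h1 := h.right_pairing R
  rw [show Rᴴ = _ from hR, smul_neg, smul_smul, eps_mul_self, one_smul, add_neg_cancel, ← hR',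
    Matrix.conjTranspose_mul] at h1
  have h2 := eq_neg_of_add_eq_zero_left h1
  rw [← mul_assoc, ← smul_mul_assoc, ← neg_mul] at h2
  have h3 := hu.star.mul_right_cancel h2
  rw [← mul_smul_comm, ← mul_neg] at h3
  have h4 := hu.mul_left_cancel h3
  have h5 := congrArg (fun X => -((q.eps : ℂ) • X)) h4
  simp only [smul_neg, smul_smul, eps_mul_self, one_smul, neg_neg] at h5
  exact h5.symm

/-- The relation `(cZ + d)^* (a - (gZ) c) = 1`. -/
theorem conjTranspose_mu_mul (h : IsIsometry a b c d) (hZ : Z ∈ hermC q ι)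
    {W : Matrix ι ι (BC q)} (hu : IsUnit (c * Z + d)) (hW : W * (c * Z + d) = a * Z + b) :
    (c * Z + d)ᴴ * (a - W * c) = 1 := by
  obtain ⟨h1, h2, h3, h4⟩ := h.left_relations
  have hε := eps_mul_self q
  have hWh : Wᴴ = _ := h.mem_hermC hZ hu hW
  have hW1 : W = -((q.eps : ℂ) • Wᴴ) := by
    rw [hWh, smul_neg, smul_smul, hε, one_smul, neg_neg]
  have hW2 : (c * Z + d)ᴴ * Wᴴ = (a * Z + b)ᴴ := by rw [← Matrix.conjTranspose_mul, hW]
  calc (c * Z + d)ᴴ * (a - W * c) =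
        (c * Z + d)ᴴ * a + (q.eps : ℂ) • ((c * Z + d)ᴴ * Wᴴ * c) := by
        conv_lhs => rw [hW1]
        simp only [neg_mul, sub_neg_eq_add, mul_add, smul_mul_assoc, mul_smul_comm, mul_assoc]
    _ = (q.eps : ℂ) • (Zᴴ * ((q.eps : ℂ) • (cᴴ * a) + aᴴ * c)) +
        (dᴴ * a + (q.eps : ℂ) • (bᴴ * c)) := by
        rw [hW2]
        simp only [Matrix.conjTranspose_add, Matrix.conjTranspose_mul, mul_add, add_mul,
          mul_smul_comm, smul_add, smul_smul, hε, one_smul, mul_assoc]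
        abel
    _ = 1 := by rw [h1, h3]; simp

end IsIsometry

end Group

/-! ### Coordinates on the upper half space -/

section Coordinates

variable (q : QCase) (ι : Type) [Fintype ι] [DecidableEq ι]

/-- Multiplication by `diag[J₁, …, J₁]`, followed by the arrangement in blocks. -/
def twist : Matrix ((ι ⊕ ι) × Fin 2) ((ι ⊕ ι) × Fin 2) ℂ →ₗ[ℂ]
    Matrix (ι × Fin 2 ⊕ ι × Fin 2) (ι × Fin 2 ⊕ ι × Fin 2) ℂ where
  toFun M := Matrix.reindex (Equiv.sumProdDistrib ι ι (Fin 2)) (Equiv.sumProdDistrib ι ι (Fin 2))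
    (M * Jdiag (ι ⊕ ι))
  map_add' M N := by rw [add_mul]; rfl
  map_smul' s M := by rw [smul_mul_assoc]; rfl

/-- The inverse of `twist`. -/
def untwist : Matrix (ι × Fin 2 ⊕ ι × Fin 2) (ι × Fin 2 ⊕ ι × Fin 2) ℂ →ₗ[ℂ]
    Matrix ((ι ⊕ ι) × Fin 2) ((ι ⊕ ι) × Fin 2) ℂ where
  toFun M := -(Matrix.reindex (Equiv.sumProdDistrib ι ι (Fin 2)).symm
    (Equiv.sumProdDistrib ι ι (Fin 2)).symm M * Jdiag (ι ⊕ ι))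
  map_add' M N := by
    rw [← neg_add, ← add_mul]
    rfl
  map_smul' s M := by
    rw [RingHom.id_apply, smul_neg, ← smul_mul_assoc]
    rfl

theorem twist_untwist (M : Matrix (ι × Fin 2 ⊕ ι × Fin 2) (ι × Fin 2 ⊕ ι × Fin 2) ℂ) :
    twist ι (untwist ι M) = M := by
  simp only [twist, untwist, LinearMap.coe_mk, AddHom.coe_mk, neg_mul, mul_assoc, Jdiag_mul_self,
    mul_neg, mul_one, neg_neg]
  ext i j
  simp

theorem untwist_twist (M : Matrix ((ι ⊕ ι) × Fin 2) ((ι ⊕ ι) × Fin 2) ℂ) :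
    untwist ι (twist ι M) = M := by
  have h : Matrix.reindex (Equiv.sumProdDistrib ι ι (Fin 2)).symm
      (Equiv.sumProdDistrib ι ι (Fin 2)).symm (twist ι M) = M * Jdiag (ι ⊕ ι) := by
    ext i j
    simp [twist]
  simp only [untwist, LinearMap.coe_mk, AddHom.coe_mk]
  rw [h, mul_assoc, Jdiag_mul_self, mul_neg, mul_one, neg_neg]

variable {ι} in
theorem det_twist (M : Matrix ((ι ⊕ ι) × Fin 2) ((ι ⊕ ι) × Fin 2) ℂ) :
    (twist ι M).det = M.det := by
  simp only [twist, LinearMap.coe_mk, AddHom.coe_mk, Matrix.det_reindex_self, Matrix.det_mul,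
    det_Jdiag, mul_one]

variable {q ι}

theorem mem_hermC_iff {X : Matrix (ι ⊕ ι) (ι ⊕ ι) (BC q)} :
    X ∈ hermC q (ι ⊕ ι) ↔ (twist ι (split X))ᵀ = (q.eps : ℂ) • twist ι (split X) := by
  have h1 : (twist ι (split X))ᵀ = -twist ι (split Xᴴ) := by
    rw [← map_neg]
    have h2 : (split X * Jdiag (ι ⊕ ι))ᵀ = -split Xᴴ * Jdiag (ι ⊕ ι) := by
      rw [Matrix.transpose_mul, transpose_Jdiag, neg_mul, neg_mul, split_conjTranspose_mul]
    change (Matrix.reindex _ _ (split X * Jdiag (ι ⊕ ι)))ᵀ = _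
    rw [Matrix.transpose_reindex, h2]
    rfl
  rw [h1, neg_eq_iff_eq_neg, ← map_smul, ← map_neg]
  constructor
  · intro h
    have h3 : Xᴴ = (-(q.eps : ℂ)) • X := by
      rw [neg_smul]
      exact h
    rw [h3, split_smul, neg_smul]
  · intro h
    have h3 := congrArg (untwist ι) h
    rw [untwist_twist, untwist_twist, ← neg_smul, ← split_smul] at h3
    have h4 := (splitEquiv q (ι ⊕ ι)).injective h3
    rw [neg_smul] at h4
    exact h4

theorem toBlocks_twist (X : Matrix (ι ⊕ ι) (ι ⊕ ι) (BC q)) :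
    (twist ι (split X)).toBlocks₁₂ = split X.toBlocks₁₂ * Jdiag ι := by
  ext ⟨i, k⟩ ⟨j, l⟩
  simp only [twist, LinearMap.coe_mk, AddHom.coe_mk, Matrix.toBlocks₁₂, Matrix.of_apply,
    Matrix.reindex_apply, Matrix.submatrix_apply, Matrix.mul_apply, Fintype.sum_prod_type,
    Fintype.sum_sum_type]
  simp [Jdiag, split]

theorem det_toBlocks_twist (X : Matrix (ι ⊕ ι) (ι ⊕ ι) (BC q)) :
    (twist ι (split X)).toBlocks₁₂.det = nrd X.toBlocks₁₂ := by
  rw [toBlocks_twist, Matrix.det_mul, det_Jdiag, mul_one, nrd]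

variable (q ι)

/-- The dimension of `S(ℝ) ⊗ ℂ`. -/
abbrev hermDim : ℕ :=
  Module.finrank ℂ (symSubmodule (q.eps : ℂ) (ι × Fin 2 ⊕ ι × Fin 2))

/-- Linear coordinates on the `ε`-symmetric matrices `split X * diag[J₁, …, J₁]`. -/
abbrev hermChart : SymChart (q.eps : ℂ) (ι × Fin 2 ⊕ ι × Fin 2) (hermDim q ι) :=
  symChart (eps_mul_self q)

/-- The point of `S(ℝ) ⊗ ℂ` with given coordinates. -/
def point : (Fin (hermDim q ι) → ℂ) →ₗ[ℂ] Matrix (ι ⊕ ι) (ι ⊕ ι) (BC q) where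
  toFun t := (splitEquiv q (ι ⊕ ι)).symm (untwist ι ((hermChart q ι).mat t))
  map_add' s t := by rw [map_add, map_add, map_add]
  map_smul' a t := by
    refine (splitEquiv q (ι ⊕ ι)).injective ?_
    rw [RingEquiv.apply_symm_apply, map_smul, map_smul]
    refine Eq.trans ?_ (split_smul a _).symm
    exact congrArg (a • ·) ((splitEquiv q (ι ⊕ ι)).apply_symm_apply _).symm

/-- The coordinates of a point of `S(ℝ) ⊗ ℂ`. -/
def pointCoords (X : Matrix (ι ⊕ ι) (ι ⊕ ι) (BC q)) : Fin (hermDim q ι) → ℂ :=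
  (hermChart q ι).coords (twist ι (split X))

variable {q ι}

theorem split_point (t : Fin (hermDim q ι) → ℂ) :
    split (point q ι t) = untwist ι ((hermChart q ι).mat t) :=
  (splitEquiv q (ι ⊕ ι)).apply_symm_apply _

theorem twist_split_point (t : Fin (hermDim q ι) → ℂ) :
    twist ι (split (point q ι t)) = (hermChart q ι).mat t := by
  rw [split_point, twist_untwist]

theorem point_mem (t : Fin (hermDim q ι) → ℂ) : point q ι t ∈ hermC q (ι ⊕ ι) := by
  rw [mem_hermC_iff, twist_split_point, (hermChart q ι).transpose_mat]

theorem point_pointCoords {X : Matrix (ι ⊕ ι) (ι ⊕ ι) (BC q)} (hX : X ∈ hermC q (ι ⊕ ι)) :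
    point q ι (pointCoords q ι X) = X := by
  refine (splitEquiv q (ι ⊕ ι)).injective ?_
  change split _ = split X
  rw [split_point, pointCoords, (hermChart q ι).mat_coords _ (mem_hermC_iff.1 hX), untwist_twist]

theorem det_mat (t : Fin (hermDim q ι) → ℂ) : ((hermChart q ι).mat t).det = nrd (point q ι t) := by
  rw [← twist_split_point, det_twist, nrd]

theorem det_mat_toBlocks (t : Fin (hermDim q ι) → ℂ) :
    ((hermChart q ι).mat t).toBlocks₁₂.det = nrd (point q ι t).toBlocks₁₂ := by
  rw [← twist_split_point, det_toBlocks_twist]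

theorem analyticAt_split_point (i j : (ι ⊕ ι) × Fin 2) (t₀ : Fin (hermDim q ι) → ℂ) :
    AnalyticAt ℂ (fun t => split (point q ι t) i j) t₀ := by
  simp only [split_point]
  exact analyticAt_linear_entries (A := fun t => (hermChart q ι).mat t)
    (Matrix.entryLinearMap ℂ ℂ i j ∘ₗ untwist ι) fun i j => analyticAt_mat _ i j t₀

theorem analyticAt_of_isHolo {f : Matrix (ι ⊕ ι) (ι ⊕ ι) (BC q) → ℂ} (hf : IsHolo f)
    {t₀ : Fin (hermDim q ι) → ℂ} (ht : point q ι t₀ ∈ upperHalf q (ι ⊕ ι)) :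
    AnalyticAt ℂ (fun t => f (point q ι t)) t₀ := by
  have h1 := hf _ ht (hermDim q ι) (fun k => point q ι (Pi.single k 1)) fun k => point_mem _
  have h2 : ∀ t : Fin (hermDim q ι) → ℂ,
      point q ι t₀ + ∑ k, t k • point q ι (Pi.single k 1) = point q ι (t₀ + t) := by
    intro t
    rw [map_add]
    conv_rhs => rw [← Finset.univ_sum_single t]
    rw [map_sum]
    congr 1
    refine Finset.sum_congr rfl fun k _ => ?_
    rw [← map_smul, ← Pi.single_smul, smul_eq_mul, mul_one]
  simp only [h2] at h1
  have h3 : AnalyticAt ℂ (fun t : Fin (hermDim q ι) → ℂ => t - t₀) t₀ :=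
    analyticAt_id.fun_sub analyticAt_const
  have h4 := AnalyticAt.comp_of_eq h1 h3 (sub_self t₀)
  simpa only [Function.comp_def, add_sub_cancel] using h4

end Coordinates

/-! ### The family of operators -/

section Family

variable (q : QCase) (ι : Type) [Fintype ι] [DecidableEq ι]

/-- The entries of `split z * diag[J₁, …, J₁]` as linear forms in the coordinates of `z`. -/
def entryForm (p : (ι × Fin 2) × (ι × Fin 2)) : MvPolynomial (ι × ι × Fin 4) (Polynomial ℂ) :=
  (!![X (p.1.1, p.2.1, 2) + C (Polynomial.C q.rootEps) * X (p.1.1, p.2.1, 3),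
      -(X (p.1.1, p.2.1, 0) + C (Polynomial.C q.rootEps) * X (p.1.1, p.2.1, 1));
      X (p.1.1, p.2.1, 0) - C (Polynomial.C q.rootEps) * X (p.1.1, p.2.1, 1),
      X (p.1.1, p.2.1, 2) - C (Polynomial.C q.rootEps) * X (p.1.1, p.2.1, 3)] :
    Matrix (Fin 2) (Fin 2) (MvPolynomial (ι × ι × Fin 4) (Polynomial ℂ))) p.1.2 p.2.2

variable {q ι} in
theorem ev_entryForm (κ : ℂ) (z : Matrix ι ι (BC q)) (p : (ι × Fin 2) × (ι × Fin 2)) :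
    ev κ (coord z) (entryForm q ι p) = (split z * Jdiag ι) p.1 p.2 := by
  obtain ⟨⟨i, k⟩, ⟨j, l⟩⟩ := p
  simp only [Matrix.mul_apply, Fintype.sum_prod_type, Fin.sum_univ_two]
  fin_cases k <;> fin_cases l <;> simp [entryForm, split, splitEntry, Jdiag, coord]
  ring

/-- The family `𝔇_α`. -/
def diffOp : DiffOpFamily q ι where
  len := Fintype.card (MultiIdx (hermDim q ι) (Fintype.card (ι × Fin 2 ⊕ ι × Fin 2)))
  coeff k := bind₁ (entryForm q ι) (opCoeff (hermChart q ι) ((Fintype.equivFin _).symm k))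
  dirs k := (word ((Fintype.equivFin
    (MultiIdx (hermDim q ι) (Fintype.card (ι × Fin 2 ⊕ ι × Fin 2)))).symm k).1).map
      fun i => ⟨point q ι (Pi.single i 1), point_mem _⟩

variable {q ι}

theorem iterDeriv_point (l : List (Fin (hermDim q ι)))
    (f : Matrix (ι ⊕ ι) (ι ⊕ ι) (BC q) → ℂ) (t : Fin (hermDim q ι) → ℂ) :
    iterDeriv (l.map fun i => (⟨point q ι (Pi.single i 1), point_mem _⟩ : hermC q (ι ⊕ ι))) f
      (point q ι t) = wordDeriv l (fun t => f (point q ι t)) t := by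
  induction l generalizing t with
  | nil => rfl
  | cons k l ih =>
    change lineDeriv ℂ (iterDeriv _ f) (point q ι t) (point q ι (Pi.single k 1)) =
      lineDeriv ℂ (wordDeriv l _) t (Pi.single k 1)
    simp only [lineDeriv, ← map_smul, ← map_add, ih]

theorem diffOp_op (κ : ℂ) (f : Matrix (ι ⊕ ι) (ι ⊕ ι) (BC q) → ℂ) (t : Fin (hermDim q ι) → ℂ) :
    (diffOp q ι).op κ f (point q ι t) =
      coreOp (hermChart q ι) κ (fun t => f (point q ι t)) t := by
  rw [DiffOpFamily.op, coreOp]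
  refine Fintype.sum_equiv (Fintype.equivFin _).symm _ _ fun k => ?_
  congr 1
  · change eval₂Hom _ _ (bind₁ _ _) = _
    rw [eval₂Hom_bind₁]
    congr 2
    funext p
    refine (ev_entryForm κ _ p).trans ?_
    rw [← twist_split_point, toBlocks_twist]
  · exact iterDeriv_point _ f t

end Family

/-! ### Covariance -/

section Covariance

variable {q : QCase} {ι : Type} [Fintype ι] [DecidableEq ι]

theorem act_mul_muFactor {κ : Type} [Fintype κ] [DecidableEq κ]
    {g : Matrix (κ ⊕ κ) (κ ⊕ κ) (BR q)} {Z : Matrix κ κ (BC q)} (h : IsUnit (muFactor g Z)) :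
    act g Z * muFactor g Z = g.toBlocks₁₁.map toBC * Z + g.toBlocks₁₂.map toBC := by
  rw [act, mul_assoc, Ring.inverse_mul_cancel _ h, mul_one]

theorem analyticAt_split_affine (x y : Matrix (ι ⊕ ι) (ι ⊕ ι) (BC q))
    (i j : (ι ⊕ ι) × Fin 2) (t₀ : Fin (hermDim q ι) → ℂ) :
    AnalyticAt ℂ (fun t => split (x * point q ι t + y) i j) t₀ := by
  simp only [split_add, split_mul, Matrix.add_apply]
  exact (analyticAt_mul_apply (A := fun _ => split x) (B := fun t => split (point q ι t))
    (fun i j => analyticAt_const)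
    (fun i j => analyticAt_split_point i j t₀) i j).add analyticAt_const

/-- Covariance of the family of operators under a real isometry `g` of the form `K`, if the
transformation `R ↦ R' = (a + Rc)⁻¹(b + Rd)` of translations multiplies the reduced norm of the
block `R₁₂` by `nrd(a + Rc)⁻¹`. -/
theorem diffOp_slash {r : ℕ} (hr : Fintype.card (ι × Fin 2) ≤ r)
    {g : Matrix ((ι ⊕ ι) ⊕ (ι ⊕ ι)) ((ι ⊕ ι) ⊕ (ι ⊕ ι)) (BR q)}
    (hg : IsIsometry (g.toBlocks₁₁.map toBC) (g.toBlocks₁₂.map toBC) (g.toBlocks₂₁.map toBC)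
      (g.toBlocks₂₂.map toBC))
    (hR : ∀ R ∈ hermC q (ι ⊕ ι), ∀ R' ∈ hermC q (ι ⊕ ι),
      IsUnit (g.toBlocks₁₁.map toBC + R * g.toBlocks₂₁.map toBC) →
      (g.toBlocks₁₁.map toBC + R * g.toBlocks₂₁.map toBC) * R' =
        g.toBlocks₁₂.map toBC + R * g.toBlocks₂₂.map toBC →
      nrd R'.toBlocks₁₂ * nrd (g.toBlocks₁₁.map toBC + R * g.toBlocks₂₁.map toBC) =
        nrd R.toBlocks₁₂)
    {f : Matrix (ι ⊕ ι) (ι ⊕ ι) (BC q) → ℂ} (hf : IsHolo f) {Z : Matrix (ι ⊕ ι) (ι ⊕ ι) (BC q)}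
    (hZ : Z ∈ upperHalf q (ι ⊕ ι)) :
    (diffOp q ι).op (r : ℂ) (slash r f g) Z = slash (r + 1) ((diffOp q ι).op (r : ℂ) f) g Z := by
  set t₀ := pointCoords q ι Z with ht₀
  have hpZ : point q ι t₀ = Z := point_pointCoords hZ.1
  have hmu0 : IsUnit (muFactor g Z) := hg.isUnit_mu hZ
  set W := act g Z with hWdef
  have hW : W * muFactor g Z = g.toBlocks₁₁.map toBC * Z + g.toBlocks₁₂.map toBC :=
    act_mul_muFactor hmu0
  have hWH : W ∈ upperHalf q (ι ⊕ ι) := hg.mem_upperHalf hZ hW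
  set ψ : (Fin (hermDim q ι) → ℂ) → (Fin (hermDim q ι) → ℂ) :=
    fun t => pointCoords q ι (act g (point q ι t)) with hψ
  set J : (Fin (hermDim q ι) → ℂ) → ℂ := fun t => nrd (muFactor g (point q ι t)) ^ (-(r : ℤ)) with hJ
  have hpψ : point q ι (ψ t₀) = W := by
    simp only [hψ]
    rw [hpZ, point_pointCoords hWH.1]
  have hmua : AnalyticAt ℂ (fun t => nrd (muFactor g (point q ι t))) t₀ :=
    analyticAt_det fun i j => analyticAt_split_affine _ _ i j t₀
  have hmu1 : nrd (muFactor g (point q ι t₀)) ≠ 0 := by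
    rw [hpZ]
    exact isUnit_iff_nrd_ne_zero.1 hmu0
  have hmu : ∀ᶠ t in 𝓝 t₀, IsUnit (muFactor g (point q ι t)) := by
    filter_upwards [hmua.continuousAt.eventually_ne hmu1] with t ht
    exact isUnit_iff_nrd_ne_zero.2 ht
  have hact : ∀ᶠ t in 𝓝 t₀, point q ι (ψ t) = act g (point q ι t) := by
    filter_upwards [hmu] with t ht
    exact point_pointCoords (hg.mem_hermC (point_mem t) ht (act_mul_muFactor ht))
  have hJa : AnalyticAt ℂ J t₀ := hmua.zpow hmu1
  have hψa : AnalyticAt ℂ ψ t₀ := by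
    have h1 : ∀ i j, AnalyticAt ℂ (fun t => split (act g (point q ι t)) i j) t₀ := by
      intro i j
      have h2 : (fun t => (split (g.toBlocks₁₁.map toBC * point q ι t + g.toBlocks₁₂.map toBC) *
          (split (muFactor g (point q ι t)))⁻¹) i j) =ᶠ[𝓝 t₀]
          fun t => split (act g (point q ι t)) i j := by
        filter_upwards [hmu] with t ht
        rw [← act_mul_muFactor ht, split_mul, Matrix.mul_nonsing_inv_cancel_right]
        exact isUnit_iff_ne_zero.2 (isUnit_iff_nrd_ne_zero.1 ht)
      refine AnalyticAt.congr ?_ h2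
      exact analyticAt_mul_apply (fun i j => analyticAt_split_affine _ _ i j t₀)
        (fun i j => analyticAt_inv_apply (fun i j => analyticAt_split_affine _ _ i j t₀) hmu1 i j)
        i j
    refine analyticAt_pi_iff.2 fun k => ?_
    exact analyticAt_linear_entries (A := fun t => split (act g (point q ι t)))
      (LinearMap.proj k ∘ₗ (hermChart q ι).coords ∘ₗ twist ι) h1
  have hfa : AnalyticAt ℂ (fun t => f (point q ι t)) (ψ t₀) :=
    analyticAt_of_isHolo hf (by rw [hpψ]; exact hWH)
  have key := coreOp_comp (hermChart q ι) (eps_eq q) hr (b := nrd (muFactor g Z) ^ (-((r : ℤ) + 1)))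
    hψa hJa ?_ hfa
  · rw [← diffOp_op, hpψ] at key
    rw [slash, ← key]
    conv_lhs => rw [← hpZ]
    rw [diffOp_op]
    refine coreOp_congr _ ?_
    filter_upwards [hact] with t ht
    simp only [hJ]
    rw [ht, slash]
  · -- the translates of `W` by points of `S(ℝ) ⊗ ℂ` close to `-W`
    set a := g.toBlocks₁₁.map toBC with ha
    set b := g.toBlocks₁₂.map toBC with hb
    set c := g.toBlocks₂₁.map toBC with hc
    set d := g.toBlocks₂₂.map toBC with hd
    have hu0 : nrd (a - W * c) ≠ 0 := by
      have h1 := congrArg nrd (hg.conjTranspose_mu_mul hZ.1 hmu0 hW)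
      rw [nrd_mul, nrd_one] at h1
      exact right_ne_zero_of_mul_eq_one h1
    have hucont : ContinuousAt (fun x => nrd (a + (point q ι x - W) * c)) 0 := by
      refine (analyticAt_det (A := fun x => split (a + (point q ι x - W) * c)) fun i j => ?_).continuousAt
      have h1 : ∀ x, split (a + (point q ι x - W) * c) =
          split (point q ι x) * split c + split (a - W * c) := by
        intro x
        rw [← split_mul, ← split_add]
        congr 1
        rw [sub_mul]
        abel
      simp only [h1, Matrix.add_apply]
      exact (analyticAt_mul_apply (A := fun x => split (point q ι x)) (B := fun _ => split c)
        (fun i j => analyticAt_split_point i j 0)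
        (fun i j => analyticAt_const) i j).add analyticAt_const
    have hev : ∀ᶠ x in 𝓝 (0 : Fin (hermDim q ι) → ℂ), nrd (a + (point q ι x - W) * c) ≠ 0 := by
      refine hucont.eventually_ne ?_
      rw [map_zero, zero_sub, neg_mul, ← sub_eq_add_neg]
      exact hu0
    filter_upwards [hev] with x hx hx0
    set R := point q ι x - W with hRdef
    have hRp : R = point q ι (x - ψ t₀) := by rw [map_sub, hpψ]
    have hRm : R ∈ hermC q (ι ⊕ ι) := by rw [hRp]; exact point_mem _
    have hu : IsUnit (a + R * c) := isUnit_iff_nrd_ne_zero.2 hx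
    set R' := Ring.inverse (a + R * c) * (b + R * d) with hR'def
    have hR' : (a + R * c) * R' = b + R * d := by
      rw [hR'def, ← mul_assoc, Ring.mul_inverse_cancel _ hu, one_mul]
    have hR'm : R' ∈ hermC q (ι ⊕ ι) := hg.right_mem_hermC hRm hu hR'
    have hpR' : point q ι (pointCoords q ι R') = R' := point_pointCoords hR'm
    have hnorm : ∀ {Z' W' : Matrix (ι ⊕ ι) (ι ⊕ ι) (BC q)}, W' * muFactor g Z' = a * Z' + b →
        nrd (W' + R) * nrd (muFactor g Z') = nrd (a + R * c) * nrd (Z' + R') := by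
      intro Z' W' h
      rw [← nrd_mul, ← nrd_mul]
      congr 1
      exact IsIsometry.add_mul_mu h hR'
    have hWR : W + R = point q ι x := add_sub_cancel _ _
    have hn0 := hnorm hW
    rw [hWR] at hn0
    rw [det_mat] at hx0
    have hmuZ : nrd (muFactor g Z) ≠ 0 := isUnit_iff_nrd_ne_zero.1 hmu0
    have hZR : nrd (Z + R') ≠ 0 := right_ne_zero_of_mul (hn0 ▸ mul_ne_zero hx0 hmuZ)
    refine ⟨nrd (a + R * c) ^ (-(r : ℤ)), pointCoords q ι R', ?_, ?_, ?_⟩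
    · rw [det_mat, map_add, hpZ, hpR']
      exact hZR
    · filter_upwards [hact, hmu] with t ht1 ht2
      have h1 := hnorm (act_mul_muFactor ht2)
      rw [det_mat, det_mat, map_add, map_add, ← hRp, ht1, hpR']
      simp only [hJ]
      rw [← mul_zpow, ← mul_zpow, mul_comm, h1]
    · rw [det_mat_toBlocks, det_mat_toBlocks, det_mat, det_mat, map_add, hpZ, hpR', ← hRp,
        ← hR R hRm R' hR'm hu hR']
      have h1 : (nrd (point q ι x) * nrd (muFactor g Z)) ^ (-(r : ℤ) - 1) =
          (nrd (a + R * c) * nrd (Z + R')) ^ (-(r : ℤ) - 1) := by rw [hn0]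
      rw [mul_zpow, mul_zpow] at h1
      have h2 : -((r : ℤ) + 1) = -(r : ℤ) - 1 := by ring
      have h3 : nrd (a + R * c) ^ (-(r : ℤ)) =
          nrd (a + R * c) ^ (-(r : ℤ) - 1) * nrd (a + R * c) := by
        rw [← zpow_add_one₀ hx, sub_add_cancel]
      rw [h2, h3]
      linear_combination (-(nrd R'.toBlocks₁₂ * nrd (a + R * c))) * h1

end Covariance

/-! ### The group elements `1 × γ`, `γ × 1` and the interchange of the diagonal blocks -/

section Real

variable {q : QCase} {ι : Type}

/-- The inclusion `𝔹_∞ → 𝔹_∞ ⊗ ℂ` as a homomorphism of rings. -/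
def toBCHom (q : QCase) : BR q →+* BC q where
  toFun := toBC
  map_one' := by ext <;> simp [toBC]
  map_mul' x y := by ext <;> simp [toBC]
  map_zero' := by ext <;> simp [toBC]
  map_add' x y := by ext <;> simp [toBC]

theorem map_toBC_add (X Y : Matrix ι ι (BR q)) :
    (X + Y).map toBC = X.map toBC + Y.map toBC := Matrix.map_add (toBCHom q) (map_add _) X Y

theorem map_toBC_zero : (0 : Matrix ι ι (BR q)).map toBC = 0 :=
  Matrix.map_zero (toBCHom q) (map_zero _)

theorem map_toBC_one [DecidableEq ι] : (1 : Matrix ι ι (BR q)).map toBC = 1 :=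
  Matrix.map_one (toBCHom q) (map_zero _) (map_one _)

theorem map_toBC_mul [Fintype ι] (X Y : Matrix ι ι (BR q)) :
    (X * Y).map toBC = X.map toBC * Y.map toBC := Matrix.map_mul (f := toBCHom q)

theorem map_toBC_conjTranspose (X : Matrix ι ι (BR q)) : Xᴴ.map toBC = (X.map toBC)ᴴ := by
  ext i j <;> simp [toBC]

theorem map_toBC_smul (X : Matrix ι ι (BR q)) :
    ((q.eps : ℝ) • X).map toBC = (q.eps : ℂ) • X.map toBC := by
  ext i j <;> simp [toBC]

variable [Fintype ι] [DecidableEq ι]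

theorem isIsometry_of_mem_groupG {g : Matrix (ι ⊕ ι) (ι ⊕ ι) (BR q)} (hg : g ∈ groupG q ι) :
    IsIsometry (g.toBlocks₁₁.map toBC) (g.toBlocks₁₂.map toBC) (g.toBlocks₂₁.map toBC)
      (g.toBlocks₂₂.map toBC) := by
  have h := hg.2
  rw [formK] at h
  conv_lhs at h => rw [← Matrix.fromBlocks_toBlocks g]
  simp only [Matrix.fromBlocks_conjTranspose, Matrix.fromBlocks_multiply, mul_zero, zero_add,
    add_zero, mul_one, mul_smul_comm, smul_mul_assoc] at h
  rw [Matrix.fromBlocks_inj] at h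
  obtain ⟨h1, h2, h3, h4⟩ := h
  refine ⟨conjM_map_toBC _, conjM_map_toBC _, conjM_map_toBC _, conjM_map_toBC _, ?_, ?_, ?_, ?_⟩
  · simpa only [map_toBC_add, map_toBC_mul, map_toBC_smul, map_toBC_conjTranspose, map_toBC_zero]
      using congrArg (fun X => X.map toBC) h1
  · simpa only [map_toBC_add, map_toBC_mul, map_toBC_smul, map_toBC_conjTranspose, map_toBC_one]
      using congrArg (fun X => X.map toBC) h2
  · simpa only [map_toBC_add, map_toBC_mul, map_toBC_smul, map_toBC_conjTranspose, map_toBC_one]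
      using congrArg (fun X => X.map toBC) h3
  · simpa only [map_toBC_add, map_toBC_mul, map_toBC_smul, map_toBC_conjTranspose, map_toBC_zero]
      using congrArg (fun X => X.map toBC) h4

end Real

section Blocks

variable {q : QCase} {ι : Type}

theorem conjM_fromBlocks {A B C D : Matrix ι ι (BC q)} :
    conjM (Matrix.fromBlocks A B C D) =
      Matrix.fromBlocks (conjM A) (conjM B) (conjM C) (conjM D) := Matrix.fromBlocks_map ..

theorem conjM_zero : conjM (0 : Matrix ι ι (BC q)) = 0 := by
  ext i j <;> simp [conjM]

theorem fromBlocks_mem_hermC {A B C D : Matrix ι ι (BC q)}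
    (h : Matrix.fromBlocks A B C D ∈ hermC q (ι ⊕ ι)) :
    D ∈ hermC q ι ∧ Bᴴ = -((q.eps : ℂ) • C) := by
  have h1 : (Matrix.fromBlocks A B C D)ᴴ = -((q.eps : ℂ) • Matrix.fromBlocks A B C D) := h
  rw [Matrix.fromBlocks_conjTranspose, Matrix.fromBlocks_smul, Matrix.fromBlocks_neg,
    Matrix.fromBlocks_inj] at h1
  exact ⟨h1.2.2.2, h1.2.2.1⟩

variable [Fintype ι] [DecidableEq ι]

theorem isIsometry_one : IsIsometry (1 : Matrix ι ι (BC q)) 0 0 1 := by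
  have h1 : conjM (1 : Matrix ι ι (BC q)) = 1 := by
    rw [← map_toBC_one, conjM_map_toBC]
  exact ⟨h1, conjM_zero, conjM_zero, h1, by simp, by simp, by simp, by simp⟩

theorem IsIsometry.prod {a b c d a' b' c' d' : Matrix ι ι (BC q)} (h : IsIsometry a b c d)
    (h' : IsIsometry a' b' c' d') :
    IsIsometry (Matrix.fromBlocks a 0 0 a') (Matrix.fromBlocks b 0 0 b')
      (Matrix.fromBlocks c 0 0 c') (Matrix.fromBlocks d 0 0 d') where
  conj_a := by rw [conjM_fromBlocks, conjM_zero, h.conj_a, h'.conj_a]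
  conj_b := by rw [conjM_fromBlocks, conjM_zero, h.conj_b, h'.conj_b]
  conj_c := by rw [conjM_fromBlocks, conjM_zero, h.conj_c, h'.conj_c]
  conj_d := by rw [conjM_fromBlocks, conjM_zero, h.conj_d, h'.conj_d]
  ba := by
    simp [Matrix.fromBlocks_conjTranspose, Matrix.fromBlocks_multiply, Matrix.fromBlocks_smul,
      Matrix.fromBlocks_add, h.ba, h'.ba]
  bc := by
    simp [Matrix.fromBlocks_conjTranspose, Matrix.fromBlocks_multiply, Matrix.fromBlocks_smul,
      Matrix.fromBlocks_add, h.bc, h'.bc, ← Matrix.fromBlocks_one]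
  da := by
    simp [Matrix.fromBlocks_conjTranspose, Matrix.fromBlocks_multiply, Matrix.fromBlocks_smul,
      Matrix.fromBlocks_add, h.da, h'.da]
  dc := by
    simp [Matrix.fromBlocks_conjTranspose, Matrix.fromBlocks_multiply, Matrix.fromBlocks_smul,
      Matrix.fromBlocks_add, h.dc, h'.dc]

theorem nrd_fromBlocks (A B C D : Matrix ι ι (BC q)) : nrd (Matrix.fromBlocks A B C D) =
    (Matrix.fromBlocks (split A) (split B) (split C) (split D)).det := by
  rw [nrd, ← Matrix.det_reindex_self (Equiv.sumProdDistrib ι ι (Fin 2))]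
  congr 1
  ext (⟨i, k⟩ | ⟨i, k⟩) (⟨j, l⟩ | ⟨j, l⟩) <;> rfl

theorem split_zero : split (0 : Matrix ι ι (BC q)) = 0 := map_zero (splitEquiv q ι)

theorem nrd_fromBlocks_zero₂₁ (A B D : Matrix ι ι (BC q)) :
    nrd (Matrix.fromBlocks A B 0 D) = nrd A * nrd D := by
  rw [nrd_fromBlocks, split_zero, Matrix.det_fromBlocks_zero₂₁, nrd, nrd]

theorem nrd_fromBlocks_zero₁₂ (A C D : Matrix ι ι (BC q)) :
    nrd (Matrix.fromBlocks A 0 C D) = nrd A * nrd D := by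
  rw [nrd_fromBlocks, split_zero, Matrix.det_fromBlocks_zero₁₂, nrd, nrd]

theorem nrd_smul_of_mul_self {s : ℂ} (hs : s * s = 1) (X : Matrix ι ι (BC q)) :
    nrd (s • X) = nrd X := by
  rw [nrd, split_smul, Matrix.det_smul, Fintype.card_prod, Fintype.card_fin, mul_comm _ 2, pow_mul,
    sq, hs, one_pow, one_mul, nrd]

/-- Under `1 × γ`, the block `R₁₂` becomes `R₁₂ (d - c R'₂₂)`, and
`(d - c R'₂₂)(a + R₂₂ c)^* = 1`. -/
theorem nrd_toBlocks_one_prod {a b c d : Matrix ι ι (BC q)} (h : IsIsometry a b c d)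
    {R R' : Matrix (ι ⊕ ι) (ι ⊕ ι) (BC q)} (hR : R ∈ hermC q (ι ⊕ ι)) (hR' : R' ∈ hermC q (ι ⊕ ι))
    (he : (Matrix.fromBlocks 1 0 0 a + R * Matrix.fromBlocks 0 0 0 c) * R' =
      Matrix.fromBlocks 0 0 0 b + R * Matrix.fromBlocks 1 0 0 d) :
    nrd R'.toBlocks₁₂ * nrd (Matrix.fromBlocks 1 0 0 a + R * Matrix.fromBlocks 0 0 0 c) =
      nrd R.toBlocks₁₂ := by
  obtain ⟨R₁, R₂, R₃, R₄, rfl⟩ : ∃ R₁ R₂ R₃ R₄, R = Matrix.fromBlocks R₁ R₂ R₃ R₄ :=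
    ⟨_, _, _, _, (Matrix.fromBlocks_toBlocks R).symm⟩
  obtain ⟨S₁, S₂, S₃, S₄, rfl⟩ : ∃ S₁ S₂ S₃ S₄, R' = Matrix.fromBlocks S₁ S₂ S₃ S₄ :=
    ⟨_, _, _, _, (Matrix.fromBlocks_toBlocks R').symm⟩
  have hS : S₄ᴴ = -((q.eps : ℂ) • S₄) := (fromBlocks_mem_hermC hR').1
  simp only [Matrix.fromBlocks_multiply, Matrix.fromBlocks_add, mul_zero, mul_one, zero_add,
    add_zero, one_mul, zero_mul, Matrix.fromBlocks_inj] at he ⊢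
  obtain ⟨-, h2, -, h4⟩ := he
  rw [nrd_fromBlocks_zero₂₁, nrd_one, one_mul, Matrix.toBlocks_fromBlocks₁₂,
    Matrix.toBlocks_fromBlocks₁₂]
  have h5 : S₂ = R₂ * (d - c * S₄) := by
    rw [mul_sub, ← h2, mul_assoc]
    abel
  have h6 : S₄ * (a + R₄ * c)ᴴ = -((q.eps : ℂ) • (b + R₄ * d)ᴴ) := by
    rw [← h4, Matrix.conjTranspose_mul, hS, neg_mul, smul_neg, smul_mul_assoc, smul_smul,
      eps_mul_self, one_smul, neg_neg]
  have h7 : (d - c * S₄) * (a + R₄ * c)ᴴ = 1 := by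
    calc _ = (d * aᴴ + (q.eps : ℂ) • (c * bᴴ)) +
          (d * cᴴ + (q.eps : ℂ) • (c * dᴴ)) * R₄ᴴ := by
          rw [sub_mul, mul_assoc, h6]
          simp only [Matrix.conjTranspose_add, Matrix.conjTranspose_mul, mul_add, add_mul, mul_neg,
            sub_neg_eq_add, mul_smul_comm, smul_mul_assoc, smul_add, mul_assoc]
          abel
      _ = 1 := by rw [h.da, h.dc, zero_mul, add_zero]
  have h8 := congrArg nrd h7
  rw [nrd_mul, nrd_conjTranspose, nrd_one] at h8
  rw [h5, nrd_mul, mul_assoc, h8, mul_one]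

/-- Under `γ × 1`, the block `R₁₂` becomes `(a + R₁₁ c)⁻¹ R₁₂`. -/
theorem nrd_toBlocks_prod_one {a b c d : Matrix ι ι (BC q)}
    {R R' : Matrix (ι ⊕ ι) (ι ⊕ ι) (BC q)}
    (he : (Matrix.fromBlocks a 0 0 1 + R * Matrix.fromBlocks c 0 0 0) * R' =
      Matrix.fromBlocks b 0 0 0 + R * Matrix.fromBlocks d 0 0 1) :
    nrd R'.toBlocks₁₂ * nrd (Matrix.fromBlocks a 0 0 1 + R * Matrix.fromBlocks c 0 0 0) =
      nrd R.toBlocks₁₂ := by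
  obtain ⟨R₁, R₂, R₃, R₄, rfl⟩ : ∃ R₁ R₂ R₃ R₄, R = Matrix.fromBlocks R₁ R₂ R₃ R₄ :=
    ⟨_, _, _, _, (Matrix.fromBlocks_toBlocks R).symm⟩
  obtain ⟨S₁, S₂, S₃, S₄, rfl⟩ : ∃ S₁ S₂ S₃ S₄, R' = Matrix.fromBlocks S₁ S₂ S₃ S₄ :=
    ⟨_, _, _, _, (Matrix.fromBlocks_toBlocks R').symm⟩
  simp only [Matrix.fromBlocks_multiply, Matrix.fromBlocks_add, mul_zero, mul_one, zero_add,
    add_zero, one_mul, zero_mul, Matrix.fromBlocks_inj] at he ⊢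
  obtain ⟨-, h2, -, -⟩ := he
  rw [nrd_fromBlocks_zero₁₂, nrd_one, mul_one, Matrix.toBlocks_fromBlocks₁₂,
    Matrix.toBlocks_fromBlocks₁₂, ← h2, nrd_mul, mul_comm]

theorem nrd_swap : nrd (Matrix.fromBlocks 0 1 1 0 : Matrix (ι ⊕ ι) (ι ⊕ ι) (BC q)) = 1 := by
  have h1 := det_fromBlocks_neg_one (0 : Matrix (ι × Fin 2) (ι × Fin 2) ℂ) 1
  have h2 : Matrix.fromBlocks 0 1 (-1 : Matrix (ι × Fin 2) (ι × Fin 2) ℂ) 0 =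
      Matrix.fromBlocks (1 : Matrix (ι × Fin 2) (ι × Fin 2) ℂ) 0 0
        (-1 : Matrix (ι × Fin 2) (ι × Fin 2) ℂ) *
      Matrix.fromBlocks 0 (1 : Matrix (ι × Fin 2) (ι × Fin 2) ℂ)
        (1 : Matrix (ι × Fin 2) (ι × Fin 2) ℂ) 0 := by
    simp [Matrix.fromBlocks_multiply]
  rw [h2, Matrix.det_mul, Matrix.det_fromBlocks_zero₂₁, Matrix.det_one, one_mul, Matrix.det_neg,
    Matrix.det_one, mul_one, Fintype.card_prod, Fintype.card_fin, mul_comm _ 2, pow_mul, neg_one_sq,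
    one_pow, one_mul] at h1
  rw [nrd_fromBlocks, split_zero, split_one, h1]

theorem nrd_toBlocks_swap {R R' : Matrix (ι ⊕ ι) (ι ⊕ ι) (BC q)} (hR : R ∈ hermC q (ι ⊕ ι))
    (he : Matrix.fromBlocks 0 1 1 0 * R' = R * Matrix.fromBlocks 0 1 1 0) :
    nrd R'.toBlocks₁₂ = nrd R.toBlocks₁₂ := by
  obtain ⟨R₁, R₂, R₃, R₄, rfl⟩ : ∃ R₁ R₂ R₃ R₄, R = Matrix.fromBlocks R₁ R₂ R₃ R₄ :=
    ⟨_, _, _, _, (Matrix.fromBlocks_toBlocks R).symm⟩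
  obtain ⟨S₁, S₂, S₃, S₄, rfl⟩ : ∃ S₁ S₂ S₃ S₄, R' = Matrix.fromBlocks S₁ S₂ S₃ S₄ :=
    ⟨_, _, _, _, (Matrix.fromBlocks_toBlocks R').symm⟩
  have h1 := (fromBlocks_mem_hermC hR).2
  simp only [Matrix.fromBlocks_multiply, mul_zero, mul_one, zero_add, add_zero, one_mul, zero_mul,
    Matrix.fromBlocks_inj] at he
  rw [Matrix.toBlocks_fromBlocks₁₂, Matrix.toBlocks_fromBlocks₁₂, he.2.2.2, ← nrd_conjTranspose R₂,
    h1, ← neg_smul, nrd_smul_of_mul_self]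
  rw [neg_mul_neg, eps_mul_self]

end Blocks

section Applications

variable {q : QCase} {ι : Type}

theorem map_toBC_fromBlocks (A D : Matrix ι ι (BR q)) :
    (Matrix.fromBlocks A 0 0 D).map toBC = Matrix.fromBlocks (A.map toBC) 0 0 (D.map toBC) := by
  rw [Matrix.fromBlocks_map, map_toBC_zero]

section

variable [DecidableEq ι]

/-- The matrix `diag[P, P]` with `P = [0, 1; 1, 0]`, which acts by interchanging the blocks. -/
def swapMatrix (q : QCase) (ι : Type) [DecidableEq ι] :
    Matrix ((ι ⊕ ι) ⊕ (ι ⊕ ι)) ((ι ⊕ ι) ⊕ (ι ⊕ ι)) (BR q) :=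
  Matrix.fromBlocks (Matrix.fromBlocks 0 1 1 0) 0 0 (Matrix.fromBlocks 0 1 1 0)

theorem map_toBlocks_swapMatrix :
    (swapMatrix q ι).toBlocks₁₁.map toBC = Matrix.fromBlocks 0 1 1 0 ∧
    (swapMatrix q ι).toBlocks₁₂.map toBC = 0 ∧ (swapMatrix q ι).toBlocks₂₁.map toBC = 0 ∧
    (swapMatrix q ι).toBlocks₂₂.map toBC = Matrix.fromBlocks 0 1 1 0 := by
  simp only [swapMatrix, Matrix.toBlocks_fromBlocks₁₁, Matrix.toBlocks_fromBlocks₁₂,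
    Matrix.toBlocks_fromBlocks₂₁, Matrix.toBlocks_fromBlocks₂₂, Matrix.fromBlocks_map,
    map_toBC_zero, map_toBC_one, and_self]

end

theorem map_toBlocks_one [DecidableEq ι] :
    (1 : Matrix (ι ⊕ ι) (ι ⊕ ι) (BR q)).toBlocks₁₁.map toBC = 1 ∧
    (1 : Matrix (ι ⊕ ι) (ι ⊕ ι) (BR q)).toBlocks₁₂.map toBC = 0 ∧
    (1 : Matrix (ι ⊕ ι) (ι ⊕ ι) (BR q)).toBlocks₂₁.map toBC = 0 ∧
    (1 : Matrix (ι ⊕ ι) (ι ⊕ ι) (BR q)).toBlocks₂₂.map toBC = 1 := by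
  rw [← Matrix.fromBlocks_one, Matrix.toBlocks_fromBlocks₁₁, Matrix.toBlocks_fromBlocks₁₂,
    Matrix.toBlocks_fromBlocks₂₁, Matrix.toBlocks_fromBlocks₂₂]
  exact ⟨map_toBC_one, map_toBC_zero, map_toBC_zero, map_toBC_one⟩

variable [Fintype ι] [DecidableEq ι]

theorem diffOp_slash_one_prod {r : ℕ} (hr : Fintype.card (ι × Fin 2) ≤ r)
    {γ : Matrix (ι ⊕ ι) (ι ⊕ ι) (BR q)} (hγ : γ ∈ groupG q ι)
    {f : Matrix (ι ⊕ ι) (ι ⊕ ι) (BC q) → ℂ} (hf : IsHolo f) {Z : Matrix (ι ⊕ ι) (ι ⊕ ι) (BC q)}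
    (hZ : Z ∈ upperHalf q (ι ⊕ ι)) :
    (diffOp q ι).op (r : ℂ) (slash r f (double 1 γ)) Z =
      slash (r + 1) ((diffOp q ι).op (r : ℂ) f) (double 1 γ) Z := by
  have h := isIsometry_of_mem_groupG hγ
  obtain ⟨e₁, e₂, e₃, e₄⟩ := map_toBlocks_one (q := q) (ι := ι)
  refine diffOp_slash hr ?_ ?_ hf hZ <;>
    simp only [double, Matrix.toBlocks_fromBlocks₁₁, Matrix.toBlocks_fromBlocks₁₂,
      Matrix.toBlocks_fromBlocks₂₁, Matrix.toBlocks_fromBlocks₂₂, map_toBC_fromBlocks, e₁, e₂, e₃, e₄]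
  · exact isIsometry_one.prod h
  · exact fun R hR R' hR' _ he => nrd_toBlocks_one_prod h hR hR' he

theorem diffOp_slash_prod_one {r : ℕ} (hr : Fintype.card (ι × Fin 2) ≤ r)
    {γ : Matrix (ι ⊕ ι) (ι ⊕ ι) (BR q)} (hγ : γ ∈ groupG q ι)
    {f : Matrix (ι ⊕ ι) (ι ⊕ ι) (BC q) → ℂ} (hf : IsHolo f) {Z : Matrix (ι ⊕ ι) (ι ⊕ ι) (BC q)}
    (hZ : Z ∈ upperHalf q (ι ⊕ ι)) :
    (diffOp q ι).op (r : ℂ) (slash r f (double γ 1)) Z =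
      slash (r + 1) ((diffOp q ι).op (r : ℂ) f) (double γ 1) Z := by
  have h := isIsometry_of_mem_groupG hγ
  obtain ⟨e₁, e₂, e₃, e₄⟩ := map_toBlocks_one (q := q) (ι := ι)
  refine diffOp_slash hr ?_ ?_ hf hZ <;>
    simp only [double, Matrix.toBlocks_fromBlocks₁₁, Matrix.toBlocks_fromBlocks₁₂,
      Matrix.toBlocks_fromBlocks₂₁, Matrix.toBlocks_fromBlocks₂₂, map_toBC_fromBlocks, e₁, e₂, e₃, e₄]
  · exact h.prod isIsometry_one
  · exact fun R _ R' _ _ he => nrd_toBlocks_prod_one he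

theorem isIsometry_swapMatrix : IsIsometry ((swapMatrix q ι).toBlocks₁₁.map toBC)
    ((swapMatrix q ι).toBlocks₁₂.map toBC) ((swapMatrix q ι).toBlocks₂₁.map toBC)
    ((swapMatrix q ι).toBlocks₂₂.map toBC) := by
  refine ⟨conjM_map_toBC _, conjM_map_toBC _, conjM_map_toBC _, conjM_map_toBC _, ?_, ?_, ?_, ?_⟩ <;>
    obtain ⟨e₁, e₂, e₃, e₄⟩ := map_toBlocks_swapMatrix (q := q) (ι := ι) <;>
    simp [e₁, e₂, e₃, e₄, Matrix.fromBlocks_conjTranspose, Matrix.fromBlocks_multiply]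

theorem slash_swapMatrix (κ : ℤ) (f : Matrix (ι ⊕ ι) (ι ⊕ ι) (BC q) → ℂ) :
    slash κ f (swapMatrix q ι) = swapV f := by
  funext Z
  obtain ⟨e₁, e₂, e₃, e₄⟩ := map_toBlocks_swapMatrix (q := q) (ι := ι)
  have hmu : muFactor (swapMatrix q ι) Z = Matrix.fromBlocks 0 1 1 0 := by
    rw [muFactor, e₃, e₄, zero_mul, zero_add]
  have hu : IsUnit (muFactor (swapMatrix q ι) Z) := by
    rw [isUnit_iff_nrd_ne_zero, hmu, nrd_swap]
    exact one_ne_zero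
  have hact : act (swapMatrix q ι) Z =
      Matrix.fromBlocks Z.toBlocks₂₂ Z.toBlocks₂₁ Z.toBlocks₁₂ Z.toBlocks₁₁ := by
    refine hu.mul_right_cancel ?_
    rw [act_mul_muFactor hu, hmu, e₁, e₂, add_zero]
    conv_lhs => rw [← Matrix.fromBlocks_toBlocks Z]
    simp [Matrix.fromBlocks_multiply]
  rw [slash, hmu, nrd_swap, one_zpow, one_mul, hact, swapV]

theorem diffOp_swapV {r : ℕ} (hr : Fintype.card (ι × Fin 2) ≤ r)
    {f : Matrix (ι ⊕ ι) (ι ⊕ ι) (BC q) → ℂ} (hf : IsHolo f) {Z : Matrix (ι ⊕ ι) (ι ⊕ ι) (BC q)}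
    (hZ : Z ∈ upperHalf q (ι ⊕ ι)) :
    (diffOp q ι).op (r : ℂ) (swapV f) Z = swapV ((diffOp q ι).op (r : ℂ) f) Z := by
  rw [← slash_swapMatrix r f, ← slash_swapMatrix (r + 1)]
  refine diffOp_slash hr isIsometry_swapMatrix ?_ hf hZ
  obtain ⟨e₁, e₂, e₃, e₄⟩ := map_toBlocks_swapMatrix (q := q) (ι := ι)
  simp only [e₁, e₂, e₃, e₄, mul_zero, zero_add, add_zero, nrd_swap, mul_one]
  exact fun R hR R' _ _ he => nrd_toBlocks_swap hR he

theorem exists_diffOp_nrd {r : ℕ} (hr : Fintype.card (ι × Fin 2) ≤ r) :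
    ∃ a : ℂ, a ≠ 0 ∧ ∀ Z ∈ upperHalf q (ι ⊕ ι),
      (diffOp q ι).op (r : ℂ) (fun W => nrd W.toBlocks₁₂) Z = a := by
  refine ⟨_, coreOp_det_ne_zero (hermChart q ι) (eps_eq q) hr ?_, fun Z hZ => ?_⟩
  · rw [Fintype.card_prod, Fintype.card_fin]
    exact even_two.mul_left _
  · rw [← point_pointCoords hZ.1, diffOp_op, ← coreOp_det_eq (hermChart q ι) (eps_eq q) hr
      (pointCoords q ι Z)]
    simp only [det_mat_toBlocks]

end Applications

end QuaternionicDiffOp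

end

open QuaternionicUpperHalfSpace in
theorem mainTheorem9 (c : QCase) (n : ℕ) :
    ∃ D : DiffOpFamily c (Fin n), ∀ κ : ℤ, 2 * (n : ℤ) < κ →
      (∀ f : Matrix (Fin n ⊕ Fin n) (Fin n ⊕ Fin n) (BC c) → ℂ, IsHolo f →
        (∀ Z ∈ upperHalf c (Fin n ⊕ Fin n),
          D.op (κ : ℂ) (swapV f) Z = swapV (D.op (κ : ℂ) f) Z) ∧
        ∀ γ ∈ groupG c (Fin n), ∀ Z ∈ upperHalf c (Fin n ⊕ Fin n),
          D.op (κ : ℂ) (slash κ f (double 1 γ)) Z =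
            slash (κ + 1) (D.op (κ : ℂ) f) (double 1 γ) Z ∧
          D.op (κ : ℂ) (slash κ f (double γ 1)) Z =
            slash (κ + 1) (D.op (κ : ℂ) f) (double γ 1) Z) ∧
      ∃ a : ℂ, a ≠ 0 ∧ ∀ Z ∈ upperHalf c (Fin n ⊕ Fin n),
        D.op (κ : ℂ) (fun W => nrd W.toBlocks₁₂) Z = a := by
  refine ⟨QuaternionicDiffOp.diffOp c (Fin n), fun κ hκ => ?_⟩
  obtain ⟨r, rfl⟩ : ∃ r : ℕ, κ = r := ⟨κ.toNat, by omega⟩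
  have hr : Fintype.card (Fin n × Fin 2) ≤ r := by
    rw [Fintype.card_prod, Fintype.card_fin, Fintype.card_fin]
    omega
  rw [Int.cast_natCast]
  exact ⟨fun f hf => ⟨fun Z hZ => QuaternionicDiffOp.diffOp_swapV hr hf hZ,
    fun γ hγ Z hZ => ⟨QuaternionicDiffOp.diffOp_slash_one_prod hr hγ hf hZ,
      QuaternionicDiffOp.diffOp_slash_prod_one hr hγ hf hZ⟩⟩,
    QuaternionicDiffOp.exists_diffOp_nrd hr⟩
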